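/- \textbf{The string calculus.} Types of $\mathrm L^{brac}$ are built from primitive types by $\backslash,/,\cdot$ and the unary operations $^{R}$ (reversal) and $^{brac}$ (bracelet). Sequents are $\Pi\to A$ with $\Pi$ a non-empty finite sequence of types. The axioms are $A\to A$ and $A^{R}\to A^{brac}$. The rules (with $\Pi,\Psi$ non-empty, $\Gamma,\Delta$ possibly empty) are those of the Lambek calculus, including cut: from $\Gamma,B,\Delta\to C$ and $\Pi\to A$ infer $\Gamma,\Pi,A\backslash B,\Delta\to C$ and $\Gamma,B/A,\Pi,\Delta\to C$; from $A,\Pi\to B$ infer $\Pi\to A\backslash B$; from $\Pi,A\to B$ infer $\Pi\to B/A$; from $\Gamma,A,B,\Delta\to C$ infer $\Gamma,A\cdot B,\Delta\to C$; from $\Pi\to A$ and $\Psi\to B$ infer $\Pi,\Psi\to A\cdot B$; from $\Pi\to A$ and $\Gamma,A,\Delta\to B$ infer $\Gamma,\Pi,\Delta\to B$; together with: from $A_1,\dots,A_n\to B$ infer $A_n^{R},\dots,A_1^{R}\to B^{R}$; from $\Gamma,A,\Delta\to B$ infer $\Gamma,A^{RR},\Delta\to B$; from $\Pi\to A$ infer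 $\Pi\to A^{RR}$; from $\Pi\to A$ infer $\Pi\to A^{brac}$; from $B\to A^{brac}$ infer $B^{brac}\to A^{brac}$; from $\Pi,\Psi\to A^{brac}$ infer $\Psi,\Pi\to A^{brac}$. \textbf{Hypergraphs.} A hypergraph $G$ consists of finite sets of nodes and of hyperedges, an attachment word of nodes and a label for each hyperedge, and a word $ext_G$ of pairwise distinct external nodes; $rank(G)=|ext_G|$. Labels have ranks, and the rank of the label of a hyperedge is the length of its attachment word. If the attachment word of a hyperedge $e$ of $G$ has length $rank(H)$, then $G[e/H]$ is obtained by removing $e$, adding a disjoint copy of $H$ and fusing its $i$-th external node with the $i$-th attachment node of $e$, for all $i$. Isomorphic hypergraphs are not distinguished. For a label $a$ of rank $n$, $a^\bullet$ has nodes $v_1,\dots,v_n$, external word $v_1\dots v_n$ and one hyperedge, labelled $a$ and attached to $v_1\dots v_n$. For a word $w=a_1\dots a_n$ of labels of rank 2, $\mathrm{SG}(w)$ has nodes $v_0,\dots,v_n$, external word $v_0v_n$ and hyperedges $e_i$ labelled $a_i$ and attached to $v_{i-1}v_i$ ($1\le i\le n$). A node is isolated if it occurs in no attachment word (even if it is external).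 \textbf{The hypergraph Lambek calculus $\mathrm{HL}^{WI}$ without isolated nodes.} Primitive types $p\in Pr$ have given ranks. If $M$ is a hypergraph labelled by types, $\times(M)$ is a type of rank $rank(M)$. If $N$ is a type and $D$ is a hypergraph with $rank(D)=rank(N)$, exactly one hyperedge $e^\$_D$ of which has the special label $\$_d$ of rank $d$, while the others are labelled by types, then $N\div D$ is a type of rank $d$. A sequent is $H\to A$, with $H$ a hypergraph labelled by types and $A$ a type. No hypergraph, in types or as an antecedent, has isolated nodes. The axioms are $p^\bullet\to p$ for $p\in Pr$, and the rules are: \begin{itemize} \item $(\div\to)$: from $H\to A$, where the hyperedge $e$ of $H$ is labelled $N$, and $H_i\to lab_D(d_i)$ ($1\le i\le k$), where $d_1,\dots,d_k$ are the hyperedges of $D$ other than $e^\$_D$, infer $H[e/D][e^\$_D/(N\div D)^\bullet][d_1/H_1]\dots[d_k/H_k]\to A$; \item $(\to\div)$: from $D[e^\$_D/F]\to N$ infer $F\to N\div D$; \item $(\times\to)$: from $G[e/F]\to A$, where $e$ is labelled $\times(F)$ in $G$, infer $G\to A$; \item $(\to\times)$: from $H_i\to lab_M(m_i)$ ($1\le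 i\le l$), where $m_1,\dots,m_l$ are all the hyperedges of $M$, infer $M[m_1/H_1]\dots[m_l/H_l]\to\times(M)$. \end{itemize} \textbf{The translation.} Take the primitive types of $\mathrm L^{brac}$ to be the primitive types of rank $2$ in $Pr$. Let $Loop(a)$ be the hypergraph with one node $v$, one hyperedge labelled $a$ and attached to $vv$, and no external nodes. Put $\mathrm{neck}_{\mathrm H}(A)=\times(Loop(A))\div Loop(\$_2)$ and define $tr(p)=p$, $tr(A/B)=tr(A)\div\mathrm{SG}(\$_2\,tr(B))$, $tr(B\backslash A)=tr(A)\div\mathrm{SG}(tr(B)\,\$_2)$, $tr(A\cdot B)=\times(\mathrm{SG}(tr(A)\,tr(B)))$, $tr(A^{brac})=\mathrm{neck}_{\mathrm H}(tr(A))$, and let $tr(A^{R})=\times(M)$, where $M$ has nodes $v_0,v_1$, one hyperedge labelled $tr(A)$ and attached to $v_0v_1$, and external word $v_1v_0$. \textbf{Theorem.} For all $n\ge 1$ and all types $A_1,\dots,A_n,B$ of $\mathrm L^{brac}$, $$\mathrm L^{brac}\vdash A_1,\dots,A_n\to B\quad\Longleftrightarrow\quad \mathrm{HL}^{WI}\vdash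 \mathrm{SG}(tr(A_1)\dots tr(A_n))\to tr(B).$$ -/

import Mathlib

universe u

namespace HypergraphLambek

/-! ### The Lambek calculus with reversal and bracelet -/

/-- Types built from primitive types `P` by `\`, `/`, `·`, reversal and bracelet. -/
inductive BType (P : Type u) : Type u
  | prim (p : P)
  /-- `ldiv B A` is `B \ A` -/
  | ldiv (B A : BType P)
  /-- `rdiv A B` is `A / B` -/
  | rdiv (A B : BType P)
  | mul (A B : BType P)
  | rev (A : BType P)
  | brac (A : BType P)

open BType in
/-- `LBrac Γ A`: the sequent `Γ → A` is derivable in the Lambek calculus with reversal and bracelet.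
Sequences named `X`, `Y` are non-empty; `Γ`, `Δ` may be empty. -/
inductive LBrac {P : Type u} : List (BType P) → BType P → Prop
  | ax (A : BType P) : LBrac [A] A
  | ldiv_left (Γ X Δ : List (BType P)) (A B C : BType P) (hX : X ≠ []) :
      LBrac (Γ ++ [B] ++ Δ) C → LBrac X A → LBrac (Γ ++ X ++ [ldiv A B] ++ Δ) C
  | ldiv_right (X : List (BType P)) (A B : BType P) (hX : X ≠ []) :
      LBrac ([A] ++ X) B → LBrac X (ldiv A B)
  | rdiv_left (Γ X Δ : List (BType P)) (A B C : BType P) (hX : X ≠ []) :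
      LBrac (Γ ++ [B] ++ Δ) C → LBrac X A → LBrac (Γ ++ [rdiv B A] ++ X ++ Δ) C
  | rdiv_right (X : List (BType P)) (A B : BType P) (hX : X ≠ []) :
      LBrac (X ++ [A]) B → LBrac X (rdiv B A)
  | mul_left (Γ Δ : List (BType P)) (A B C : BType P) :
      LBrac (Γ ++ [A, B] ++ Δ) C → LBrac (Γ ++ [mul A B] ++ Δ) C
  | mul_right (X Y : List (BType P)) (A B : BType P) (hX : X ≠ []) (hY : Y ≠ []) :
      LBrac X A → LBrac Y B → LBrac (X ++ Y) (mul A B)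
  | cut (Γ X Δ : List (BType P)) (A B : BType P) (hX : X ≠ []) :
      LBrac X A → LBrac (Γ ++ [A] ++ Δ) B → LBrac (Γ ++ X ++ Δ) B
  | rev_rev (X : List (BType P)) (B : BType P) (hX : X ≠ []) :
      LBrac X B → LBrac (X.map rev).reverse (rev B)
  | rev_left (Γ Δ : List (BType P)) (A B : BType P) :
      LBrac (Γ ++ [A] ++ Δ) B → LBrac (Γ ++ [rev (rev A)] ++ Δ) B
  | rev_right (X : List (BType P)) (A : BType P) (hX : X ≠ []) :
      LBrac X A → LBrac X (rev (rev A))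
  | brac_right (X : List (BType P)) (A : BType P) (hX : X ≠ []) :
      LBrac X A → LBrac X (brac A)
  | brac_left (A B : BType P) :
      LBrac [B] (brac A) → LBrac [brac B] (brac A)
  | brac_shift (X Y : List (BType P)) (A : BType P) (hX : X ≠ []) (hY : Y ≠ []) :
      LBrac (X ++ Y) (brac A) → LBrac (Y ++ X) (brac A)
  | ax_rev_brac (A : BType P) : LBrac [rev A] (brac A)

/-! ### Hypergraphs and hyperedge replacement -/

/-- A finite hypergraph without its labels: nodes, hyperedges, attachment words, and the word of
external nodes. -/
structure Shape : Type 1 where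
  V : Type
  E : Type
  finV : Finite V
  finE : Finite E
  att : E → List V
  ext : List V

/-- A hypergraph with labels in `L`. -/
structure HGraph (L : Type u) : Type (max u 1) where
  shape : Shape
  lab : shape.E → L

/-- No node is isolated: each one is attached to some hyperedge. -/
def Shape.NoIsolated (S : Shape) : Prop :=
  ∀ v : S.V, ∃ e : S.E, v ∈ S.att e

/-- Isomorphisms (of the unlabelled structure). -/
structure Shape.Iso (S T : Shape) where
  node : S.V ≃ T.V
  edge : S.E ≃ T.E
  att_edge : ∀ e, T.att (edge e) = (S.att e).map node
  ext_eq : T.ext = S.ext.map node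

/-- Fusion of nodes in a replacement of every hyperedge `e` of `S` by the hypergraph `K e`: the
`i`-th external node of `K e` is fused with the `i`-th attachment node of `e`. -/
inductive Shape.Fuse {L : Type u} (S : Shape) (K : S.E → HGraph L) :
    (S.V ⊕ Σ e, (K e).shape.V) → (S.V ⊕ Σ e, (K e).shape.V) → Prop
  | fuse (e : S.E) (i : ℕ) (hi : i < (K e).shape.ext.length) (hj : i < (S.att e).length) :
      Shape.Fuse S K (Sum.inr ⟨e, (K e).shape.ext[i]⟩) (Sum.inl (S.att e)[i])

/-- Simultaneous replacement of every hyperedge `e` of `S` by (a copy of) `K e`. Replacing a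
hyperedge by the one-edge hypergraph `a•` (see `handle`) amounts to (re)labelling it by `a`, so
this covers the replacement of only some of the hyperedges. -/
def Shape.replace {L : Type u} (S : Shape) (K : S.E → HGraph L) : HGraph L where
  shape :=
    { V := Quot (S.Fuse K)
      E := Σ e, (K e).shape.E
      finV := by
        have := S.finV
        have := S.finE
        have := fun e => (K e).shape.finV
        infer_instance
      finE := by
        have := S.finE
        have := fun e => (K e).shape.finE
        infer_instance
      att := fun f => ((K f.1).shape.att f.2).map fun v => Quot.mk _ (Sum.inr ⟨f.1, v⟩)
      ext := S.ext.map fun v => Quot.mk _ (Sum.inl v) }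
  lab := fun f => (K f.1).lab f.2

open Classical in
/-- The family of hypergraphs indexed by the hyperedges of `S` that is `F` at `d` and `K`
elsewhere. -/
noncomputable def Shape.assign {L : Type u} (S : Shape) (d : S.E) (F : HGraph L)
    (K : {e : S.E // e ≠ d} → HGraph L) : S.E → HGraph L :=
  fun e => if h : e = d then F else K ⟨e, h⟩

/-- Nodes `v₁, …, vₙ`, all external, and one hyperedge attached to `v₁ … vₙ`. -/
def handleShape (n : ℕ) : Shape where
  V := Fin n
  E := Unit
  finV := inferInstance
  finE := inferInstance
  att := fun _ => List.finRange n
  ext := List.finRange n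

/-- The path `v₀ → v₁ → ⋯ → vₙ` with external nodes `v₀ vₙ`. -/
def stringShape (n : ℕ) : Shape where
  V := Fin (n + 1)
  E := Fin n
  finV := inferInstance
  finE := inferInstance
  att := fun i => [i.castSucc, i.succ]
  ext := [0, Fin.last n]

/-- One node, one hyperedge attached to it twice, no external nodes. -/
def loopShape : Shape where
  V := Unit
  E := Unit
  finV := inferInstance
  finE := inferInstance
  att := fun _ => [(), ()]
  ext := []

/-- One hyperedge from `v₀` to `v₁`, with external nodes `v₁ v₀`. -/
def flipShape : Shape where
  V := Fin 2
  E := Unit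
  finV := inferInstance
  finE := inferInstance
  att := fun _ => [0, 1]
  ext := [1, 0]

/-- The string graph of a word. -/
def stringGraph {L : Type u} (w : List L) : HGraph L where
  shape := stringShape w.length
  lab := fun i => w.get i

/-! ### Types of the hypergraph Lambek calculus -/

/-- Expressions for types over the primitive types `Pr`. In `div N S d lab`, the hypergraph
`D` in `N ÷ D` has underlying structure `S`, the hyperedge `d` carries the label `$`, and the
others are labelled by `lab`. The rank conditions are imposed by `HType.IsType`. -/
inductive HType (Pr : Type u) : Type (max u 1)
  | prim (p : Pr) : HType Pr
  | div (N : HType Pr) (S : Shape) (d : S.E) (lab : {e : S.E // e ≠ d} → HType Pr) : HType Pr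
  | times (S : Shape) (lab : S.E → HType Pr) : HType Pr

variable {Pr : Type u}

/-- The rank of a type, given the ranks of the primitive types. -/
def HType.rank (rk : Pr → ℕ) : HType Pr → ℕ
  | .prim p => rk p
  | .div _ S d _ => (S.att d).length
  | .times S _ => S.ext.length

/-- Legitimate types, all of whose hypergraphs satisfy `Adm`: external nodes are distinct, the rank
of the label of a hyperedge is the number of its attachment nodes, and in `N ÷ D` the ranks of
`N` and `D` agree. -/
def HType.IsType (rk : Pr → ℕ) (Adm : Shape → Prop) : HType Pr → Prop
  | .prim _ => True
  | .div N S _ lab => N.IsType rk Adm ∧ N.rank rk = S.ext.length ∧ S.ext.Nodup ∧ Adm S ∧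
      (∀ e, (lab e).rank rk = (S.att e.1).length) ∧ ∀ e, (lab e).IsType rk Adm
  | .times S lab => S.ext.Nodup ∧ Adm S ∧
      (∀ e, (lab e).rank rk = (S.att e).length) ∧ ∀ e, (lab e).IsType rk Adm

/-- Equality of types when isomorphic hypergraphs are not distinguished (hereditarily). -/
inductive HType.Same : HType Pr → HType Pr → Prop
  | prim (p : Pr) : HType.Same (.prim p) (.prim p)
  | div {N N' : HType Pr} {S S' : Shape} {d : S.E} {d' : S'.E}
      {lab : {e : S.E // e ≠ d} → HType Pr} {lab' : {e : S'.E // e ≠ d'} → HType Pr}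
      (i : S.Iso S') (hd : i.edge d = d') (hN : HType.Same N N')
      (hlab : ∀ (e : {e : S.E // e ≠ d}) (e' : {e : S'.E // e ≠ d'}), i.edge e.1 = e'.1 →
        HType.Same (lab e) (lab' e')) :
      HType.Same (.div N S d lab) (.div N' S' d' lab')
  | times {S S' : Shape} {lab : S.E → HType Pr} {lab' : S'.E → HType Pr}
      (i : S.Iso S') (hlab : ∀ e, HType.Same (lab e) (lab' (i.edge e))) :
      HType.Same (.times S lab) (.times S' lab')

/-- Isomorphism of hypergraphs labelled by types. -/
def HGraph.Same (H H' : HGraph (HType Pr)) : Prop :=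
  ∃ i : H.shape.Iso H'.shape, ∀ e, (H.lab e).Same (H'.lab (i.edge e))

/-- The hypergraph `A•`: a single hyperedge labelled by `A`, with all nodes external. -/
def handle (rk : Pr → ℕ) (A : HType Pr) : HGraph (HType Pr) where
  shape := handleShape (A.rank rk)
  lab := fun _ => A

/-- The replacement `G[e/F]` of one hyperedge. -/
noncomputable def HGraph.replaceAt (rk : Pr → ℕ) (G : HGraph (HType Pr)) (e : G.shape.E)
    (F : HGraph (HType Pr)) : HGraph (HType Pr) :=
  G.shape.replace (G.shape.assign e F fun e' => handle rk (G.lab e'.1))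

/-! ### The hypergraph Lambek calculus -/

/-- `H → A` is a sequent all of whose hypergraphs satisfy `Adm`. -/
def IsSequent (rk : Pr → ℕ) (Adm : Shape → Prop) (H : HGraph (HType Pr)) (A : HType Pr) : Prop :=
  H.shape.ext.Nodup ∧ Adm H.shape ∧
    (∀ e, (H.lab e).rank rk = (H.shape.att e).length) ∧ (∀ e, (H.lab e).IsType rk Adm) ∧
    A.IsType rk Adm ∧ H.shape.ext.length = A.rank rk

/-- Derivability in the hypergraph Lambek calculus in which only hypergraphs that satisfy `Adm`
are allowed, both in types and as antecedents. The constructor `same` expresses that isomorphic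
hypergraphs are not distinguished; the others are the axiom and the four rules. -/
inductive HLDerivable (rk : Pr → ℕ) (Adm : Shape → Prop) :
    HGraph (HType Pr) → HType Pr → Prop
  | same (H H' : HGraph (HType Pr)) (A A' : HType Pr) (hs : IsSequent rk Adm H' A')
      (hH : H.Same H') (hA : A.Same A') :
      HLDerivable rk Adm H A → HLDerivable rk Adm H' A'
  | ax (p : Pr) (hs : IsSequent rk Adm (handle rk (.prim p)) (.prim p)) :
      HLDerivable rk Adm (handle rk (.prim p)) (.prim p)
  /-- From `H → A` and `Hᵢ → lab(dᵢ)` infer `H[e/D][$/(N÷D)•][d₁/H₁]…[d_k/H_k] → A`,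
  where `e` is labelled by `N`. -/
  | div_left (H : HGraph (HType Pr)) (A : HType Pr) (e : H.shape.E)
      (N : HType Pr) (S : Shape) (d : S.E) (lab : {e : S.E // e ≠ d} → HType Pr)
      (K : {e : S.E // e ≠ d} → HGraph (HType Pr)) (he : H.lab e = N)
      (hs : IsSequent rk Adm
        (H.replaceAt rk e (S.replace (S.assign d (handle rk (.div N S d lab)) K))) A) :
      HLDerivable rk Adm H A → (∀ i, HLDerivable rk Adm (K i) (lab i)) →
      HLDerivable rk Adm
        (H.replaceAt rk e (S.replace (S.assign d (handle rk (.div N S d lab)) K))) A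
  /-- From `D[$/F] → N` infer `F → N ÷ D`. -/
  | div_right (F : HGraph (HType Pr)) (N : HType Pr) (S : Shape) (d : S.E)
      (lab : {e : S.E // e ≠ d} → HType Pr) (hs : IsSequent rk Adm F (.div N S d lab)) :
      HLDerivable rk Adm (S.replace (S.assign d F fun i => handle rk (lab i))) N →
      HLDerivable rk Adm F (.div N S d lab)
  /-- From `G[e/F] → A` infer `G → A`, where `e` is labelled by `×(F)`. -/
  | times_left (G : HGraph (HType Pr)) (A : HType Pr) (e : G.shape.E) (S : Shape)
      (lab : S.E → HType Pr) (he : G.lab e = .times S lab) (hs : IsSequent rk Adm G A) :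
      HLDerivable rk Adm (G.replaceAt rk e ⟨S, lab⟩) A → HLDerivable rk Adm G A
  /-- From `Hᵢ → lab(mᵢ)` infer `M[m₁/H₁]…[m_l/H_l] → ×(M)`. -/
  | times_right (S : Shape) (lab : S.E → HType Pr) (K : S.E → HGraph (HType Pr))
      (hs : IsSequent rk Adm (S.replace K) (.times S lab)) :
      (∀ m, HLDerivable rk Adm (K m) (lab m)) → HLDerivable rk Adm (S.replace K) (.times S lab)

/-- The hypergraph Lambek calculus restricted to hypergraphs without isolated nodes. -/
def HLWI (rk : Pr → ℕ) (H : HGraph (HType Pr)) (A : HType Pr) : Prop :=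
  HLDerivable rk Shape.NoIsolated H A

/-! ### The translation -/

/-- `×(Loop(A)) ÷ Loop($₂)`. -/
def neckH (A : HType Pr) : HType Pr :=
  .div (.times loopShape fun _ => A) loopShape () fun e => (e.2 rfl).elim

/-- The translation of types; the primitive types of the string calculus are the primitive
types of rank `2`. -/
def tr {rk : Pr → ℕ} : BType {p : Pr // rk p = 2} → HType Pr
  | .prim p => .prim p.1
  | .rdiv A B => .div (tr A) (stringShape 2) (0 : Fin 2) fun _ => tr B
  | .ldiv B A => .div (tr A) (stringShape 2) (1 : Fin 2) fun _ => tr B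
  | .mul A B => .times (stringShape 2) ![tr A, tr B]
  | .rev A => .times flipShape fun _ => tr A
  | .brac A => neckH (tr A)

end HypergraphLambek

/-!
The translation is faithful because all hypergraphs that can occur are paths and cycles. A path
with two external nodes and a cycle without external nodes are determined up to isomorphism by the
signed word of labels and directions that is read along them (`HGraph.Reads`,
`HGraph.Reads.exists_iso`); the word of a path is unique, that of a cycle is unique up to rotation
and inversion. A signed word stands for the sequence of types in which `(A, true)` is `A` and
`(A, false)` is `Aᴿ` (`sgn`).

*From hypergraphs to strings.* By induction on a derivation of `H → A` whose labels are
translations, possibly of the form `×(Loop(tr C))` (`Translated`): if `A` is the translation of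
`B`, then `H` is a path, and if `A` is `×(Loop(tr C))`, then `H` is a cycle, in which case `B` is
taken to be `C` with a bracelet; in both cases the word read along `H` derives `B` in the string
calculus. The only exception is a single hyperedge without nodes, labelled with some
`×(Loop(tr D))`, in which case `D` derives `B`. This is `Faithful`, proved in
`HLDerivable.faithful`. The rules that compose hypergraphs need that replacing the
hyperedges of a path or a cycle by paths gives a path or a cycle (`Shape.Trav.replace`). The
rules that decompose them need the converse: if the result of a replacement is a path or a cycle,
then so is the hypergraph in which paths were inserted (`Shape.Trav.contract`), and a hypergraph
inserted in `SG($ B)`, `SG(B $)` or `Loop($)` is a path (`Shape.Trav.cut_end`,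
`Shape.Trav.cut_loop`). The absence of isolated nodes is needed when a loop is cut: otherwise the
inserted hypergraph might be a cycle through one of its external nodes, the other one being
isolated. Contracting the loop of `×(Loop(tr D))` leads to the exception
(`Shape.Trav.contract_loop`).

*From strings to hypergraphs.* The string calculus has a cut rule, so a phase semantics is used
instead of a translation of derivations. A type is interpreted by a language of signed words
(`val`) that is closed under replacing words, as far as they are interchangeable in the antecedents
of derivable hypergraph sequents (`IsClosed`). A type belongs to its interpretation, whose elements
all derive it in the hypergraph calculus (`mem_val_and_provable`). As the interpretation is sound
for all rules of the string calculus, including cut (`LBrac.prod_val_le`), the antecedent of a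
derivable sequent belongs to the interpretation of the succedent and hence derives it.
-/

namespace HypergraphLambek

/-! ### Signed words -/

/-- The inverse of a signed word: it is read backwards and every sign is changed. -/
def inv {α : Type*} (l : List (α × Bool)) : List (α × Bool) :=
  (l.map fun d => (d.1, !d.2)).reverse

/-- The signed word `l` or its inverse, according to the sign. -/
def orient {α : Type*} (s : Bool) (l : List (α × Bool)) : List (α × Bool) :=
  bif s then l else inv l

section SignedWords
variable {α β : Type*}

@[simp] theorem orient_true (l : List (α × Bool)) : orient true l = l := rfl
@[simp] theorem orient_false (l : List (α × Bool)) : orient false l = inv l := rfl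
@[simp] theorem inv_singleton (a : α) (s : Bool) : inv [(a, s)] = [(a, !s)] := rfl
@[simp] theorem inv_append (l m : List (α × Bool)) : inv (l ++ m) = inv m ++ inv l := by
  simp [inv]
theorem inv_cons (d : α × Bool) (l : List (α × Bool)) :
    inv (d :: l) = inv l ++ [(d.1, !d.2)] := by
  simp [inv]
@[simp] theorem inv_inv (l : List (α × Bool)) : inv (inv l) = l := by
  simp [inv, Function.comp_def]
@[simp] theorem inv_eq_nil {l : List (α × Bool)} : inv l = [] ↔ l = [] := by simp [inv]
@[simp] theorem orient_eq_nil {s : Bool} {l : List (α × Bool)} : orient s l = [] ↔ l = [] := by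
  cases s <;> simp
theorem orient_singleton (a : α) (s : Bool) : orient s [(a, true)] = [(a, s)] := by
  cases s <;> rfl
theorem orient_map (f : α → β) (s : Bool) (l : List (α × Bool)) :
    orient s (l.map fun d => (f d.1, d.2)) = (orient s l).map fun d => (f d.1, d.2) := by
  cases s <;> simp [inv, Function.comp_def]
theorem map_fst_inv (l : List (α × Bool)) : (inv l).map Prod.fst = (l.map Prod.fst).reverse := by
  simp [inv, Function.comp_def]
theorem mem_map_fst_orient {s : Bool} {l : List (α × Bool)} {a : α} :
    a ∈ (orient s l).map Prod.fst ↔ a ∈ l.map Prod.fst := by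
  cases s
  · rw [orient_false, map_fst_inv, List.mem_reverse]
  · rfl
theorem nodup_map_fst_orient {s : Bool} {l : List (α × Bool)} :
    ((orient s l).map Prod.fst).Nodup ↔ (l.map Prod.fst).Nodup := by
  cases s
  · rw [orient_false, map_fst_inv, List.nodup_reverse]
  · rfl

/-- The list `l` enumerates a type without repetition. -/
def Enum (l : List α) : Prop := l.Nodup ∧ ∀ a, a ∈ l

theorem Enum.perm {l m : List α} (h : Enum l) (p : l.Perm m) : Enum m :=
  ⟨p.nodup_iff.1 h.1, fun a => p.mem_iff.1 (h.2 a)⟩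

theorem Enum.map {l : List α} (h : Enum l) {f : α → β} (hf : f.Bijective) : Enum (l.map f) :=
  ⟨h.1.map hf.1, fun b => by
    obtain ⟨a, rfl⟩ := hf.2 b
    exact List.mem_map_of_mem (h.2 a)⟩

theorem Enum.exists_equiv {l : List α} {m : List β} (hl : Enum l) (hm : Enum m)
    (h : l.length = m.length) : ∃ g : α ≃ β, l.map g = m := by
  classical
  let g1 := hl.1.getEquivOfForallMemList l hl.2
  let g2 := hm.1.getEquivOfForallMemList m hm.2
  refine ⟨g1.symm.trans ((finCongr h).trans g2), ?_⟩
  apply List.ext_getElem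
  · simpa using h
  · intro i h1 h2
    have : g1.symm l[i] = ⟨i, by simpa using h1⟩ := by
      rw [Equiv.symm_apply_eq]; rfl
    simp [this, g2]

end SignedWords

/-! ### Trails -/

/-- The dart `d`, a hyperedge with a direction, leads from `x` to `y`. -/
def Shape.Dart (S : Shape) (d : S.E × Bool) (x y : S.V) : Prop :=
  S.att d.1 = bif d.2 then [x, y] else [y, x]

/-- `S.Trail x l vs y`: the darts `l` lead consecutively from `x` to `y`, and `vs` lists the nodes
in which they start (so `y` is not listed unless it is passed before the end). -/
inductive Shape.Trail (S : Shape) : S.V → List (S.E × Bool) → List S.V → S.V → Prop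
  | nil (x : S.V) : Shape.Trail S x [] [] x
  | cons {x y z : S.V} {d : S.E × Bool} {l : List (S.E × Bool)} {vs : List S.V} :
      S.Dart d x y → Shape.Trail S y l vs z → Shape.Trail S x (d :: l) (x :: vs) z

namespace Shape
variable {S T : Shape}

theorem Dart.rev {d : S.E × Bool} {x y : S.V} (h : S.Dart d x y) : S.Dart (d.1, !d.2) y x := by
  obtain ⟨e, s⟩ := d
  cases s <;> exact h

theorem Dart.left_mem {d : S.E × Bool} {x y : S.V} (h : S.Dart d x y) : x ∈ S.att d.1 := by
  obtain ⟨e, s⟩ := d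
  cases s <;> simp_all [Dart]

theorem Dart.right_mem {d : S.E × Bool} {x y : S.V} (h : S.Dart d x y) : y ∈ S.att d.1 :=
  h.rev.left_mem

theorem Dart.eq_or_of_mem {d : S.E × Bool} {x y v : S.V} (h : S.Dart d x y)
    (hv : v ∈ S.att d.1) : v = x ∨ v = y := by
  obtain ⟨e, s⟩ := d
  cases s <;> simp_all [Dart, or_comm]

theorem Dart.length {d : S.E × Bool} {x y : S.V} (h : S.Dart d x y) :
    (S.att d.1).length = 2 := by
  obtain ⟨e, s⟩ := d
  cases s <;> simp_all [Dart]

theorem Dart.unique {d : S.E × Bool} {x y x' y' : S.V} (h : S.Dart d x y) (h' : S.Dart d x' y') :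
    x = x' ∧ y = y' := by
  obtain ⟨e, s⟩ := d
  cases s <;> simp_all [Dart]

theorem Dart.map {d : S.E × Bool} {x y : S.V} (h : S.Dart d x y) (g : S.V → T.V) (k : S.E → T.E)
    (hk : T.att (k d.1) = (S.att d.1).map g) : T.Dart (k d.1, d.2) (g x) (g y) := by
  obtain ⟨e, s⟩ := d
  cases s <;> simp_all [Dart]

theorem Trail.congr {x y : S.V} {l l' : List (S.E × Bool)} {vs vs' : List S.V}
    (h : S.Trail x l vs y) (hl : l = l') (hv : vs = vs') : S.Trail x l' vs' y :=
  hl ▸ hv ▸ h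

theorem Trail.nil_inv {x y : S.V} {vs : List S.V} (h : S.Trail x [] vs y) : x = y ∧ vs = [] := by
  cases h; exact ⟨rfl, rfl⟩

theorem Trail.cons_inv {x z : S.V} {d : S.E × Bool} {l : List (S.E × Bool)} {vs : List S.V}
    (h : S.Trail x (d :: l) vs z) :
    ∃ y vs', vs = x :: vs' ∧ S.Dart d x y ∧ S.Trail y l vs' z := by
  cases h; exact ⟨_, _, rfl, ‹_›, ‹_›⟩

theorem Trail.append {x y z : S.V} {l m : List (S.E × Bool)} {vs ws : List S.V}
    (h : S.Trail x l vs y) (h' : S.Trail y m ws z) : S.Trail x (l ++ m) (vs ++ ws) z := by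
  induction h with
  | nil => exact h'
  | cons hd _ ih => exact .cons hd (ih h')

theorem Trail.append_inv {l m : List (S.E × Bool)} : ∀ {x z : S.V} {vs : List S.V},
    S.Trail x (l ++ m) vs z →
    ∃ y vs' ws, vs = vs' ++ ws ∧ S.Trail x l vs' y ∧ S.Trail y m ws z := by
  induction l with
  | nil => exact fun {x} _ _ h => ⟨x, [], _, rfl, .nil x, h⟩
  | cons d l ih =>
    intro x z vs h
    obtain ⟨y, vs', rfl, hd, ht⟩ := h.cons_inv
    obtain ⟨y', a, b, rfl, h1, h2⟩ := ih ht
    exact ⟨y', _, b, rfl, .cons hd h1, h2⟩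

theorem Dart.trail {d : S.E × Bool} {x y : S.V} (h : S.Dart d x y) : S.Trail x [d] [x] y :=
  .cons h (.nil y)

theorem Trail.singleton_inv {d : S.E × Bool} {x y : S.V} {vs : List S.V}
    (h : S.Trail x [d] vs y) : S.Dart d x y ∧ vs = [x] := by
  obtain ⟨_, _, rfl, hd, h'⟩ := h.cons_inv
  obtain ⟨rfl, rfl⟩ := h'.nil_inv
  exact ⟨hd, rfl⟩

theorem Trail.length_eq {x y : S.V} {l : List (S.E × Bool)} {vs : List S.V}
    (h : S.Trail x l vs y) : vs.length = l.length := by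
  induction h with
  | nil => rfl
  | cons _ _ ih => simp [ih]

theorem Trail.eq_cons {x y : S.V} {l : List (S.E × Bool)} {vs : List S.V}
    (h : S.Trail x l vs y) (hl : l ≠ []) : ∃ ws, vs = x :: ws := by
  cases h with
  | nil => exact absurd rfl hl
  | cons => exact ⟨_, rfl⟩

theorem Trail.map {x y : S.V} {l : List (S.E × Bool)} {vs : List S.V} (h : S.Trail x l vs y)
    (g : S.V → T.V) (k : S.E → T.E) (hk : ∀ d ∈ l, T.att (k d.1) = (S.att d.1).map g) :
    T.Trail (g x) (l.map fun d => (k d.1, d.2)) (vs.map g) (g y) := by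
  induction h with
  | nil => exact .nil _
  | cons hd _ ih =>
    exact .cons (hd.map g k (hk _ (by simp))) (ih fun d h => hk d (by simp [h]))

theorem Trail.rev {x y : S.V} {l : List (S.E × Bool)} {vs : List S.V} (h : S.Trail x l vs y) :
    ∃ ws, S.Trail y (inv l) ws x ∧ ws ++ [x] = (vs ++ [y]).reverse := by
  induction h with
  | nil x => exact ⟨[], .nil x, rfl⟩
  | @cons x y z d l vs hd _ ih =>
    obtain ⟨ws, h1, h2⟩ := ih
    refine ⟨ws ++ [y], ?_, ?_⟩
    · rw [inv_cons]
      exact h1.append hd.rev.trail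
    · rw [h2]; simp

/-- Every dart of a trail joins consecutive nodes. -/
theorem Trail.dart_of_mem {x y : S.V} {l : List (S.E × Bool)} {vs : List S.V}
    (h : S.Trail x l vs y) {d : S.E × Bool} (hd : d ∈ l) :
    ∃ a b, S.Dart d a b ∧ a ∈ vs ∧ b ∈ vs.tail ++ [y] := by
  induction h with
  | nil => simp at hd
  | @cons x y z d' l vs h1 h2 ih =>
    rcases List.mem_cons.1 hd with rfl | hd
    · refine ⟨x, y, h1, by simp, ?_⟩
      cases h2 <;> simp
    · obtain ⟨a, b, h3, h4, h5⟩ := ih hd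
      refine ⟨a, b, h3, by simp [h4], ?_⟩
      cases vs with
      | nil => simp at h4
      | cons => simp at h5 ⊢; tauto

theorem Trail.mem_att {x y : S.V} {l : List (S.E × Bool)} {vs : List S.V}
    (h : S.Trail x l vs y) (hl : l ≠ []) {v : S.V} (hv : v ∈ vs ++ [y]) :
    ∃ d ∈ l, v ∈ S.att d.1 := by
  induction h with
  | nil => exact absurd rfl hl
  | @cons x y z d' l vs h1 h2 ih =>
    rcases List.mem_cons.1 hv with rfl | hv
    · exact ⟨d', by simp, h1.left_mem⟩
    · by_cases hl' : l = []
      · subst hl'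
        obtain ⟨rfl, rfl⟩ := h2.nil_inv
        obtain rfl : v = y := by simpa using hv
        exact ⟨d', by simp, h1.right_mem⟩
      · obtain ⟨d, hd, h⟩ := ih hl' hv
        exact ⟨d, by simp [hd], h⟩

theorem Trail.left_mem_att {x y : S.V} {l : List (S.E × Bool)} {vs : List S.V}
    (h : S.Trail x l vs y) (hl : l ≠ []) : ∃ d ∈ l, x ∈ S.att d.1 := by
  obtain ⟨ws, rfl⟩ := h.eq_cons hl
  exact h.mem_att hl (by simp)

theorem Trail.right_mem_att {x y : S.V} {l : List (S.E × Bool)} {vs : List S.V}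
    (h : S.Trail x l vs y) (hl : l ≠ []) : ∃ d ∈ l, y ∈ S.att d.1 :=
  h.mem_att hl (by simp)

/-- A trail through the images of the hyperedges of `S` lifts to `S` if the node map is injective
over the nodes that are passed between the ends. -/
theorem Trail.lift {g : S.V → T.V} {k : S.E → T.E} : ∀ {l : List (S.E × Bool)} {X Y : T.V}
    {vs : List T.V}, T.Trail X (l.map fun d => (k d.1, d.2)) vs Y → l ≠ [] →
    (∀ d ∈ l, T.att (k d.1) = (S.att d.1).map g) →
    (∀ a b, g a = g b → g a ∈ vs.tail → a = b) →
    ∃ x y ws, g x = X ∧ g y = Y ∧ S.Trail x l ws y ∧ ws.map g = vs := by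
  intro l
  induction l with
  | nil => exact fun _ h => absurd rfl h
  | cons d l ih =>
    intro X Y vs h _ hk hg
    obtain ⟨Z, vs', rfl, hd, ht⟩ := h.cons_inv
    obtain ⟨p, q, hpq, rfl, rfl⟩ : ∃ p q, S.Dart d p q ∧ g p = X ∧ g q = Z := by
      obtain ⟨e, s⟩ := d
      have h1 := hk (e, s) (by simp)
      have h2 := hd.length
      simp only [h1, List.length_map] at h2
      obtain ⟨p, q, h3⟩ := List.length_eq_two.1 h2
      simp only [Dart, h1, h3] at hd
      cases s
      · simp only [cond_false, List.map_cons, List.map_nil, List.cons.injEq, and_true] at hd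
        exact ⟨q, p, h3, hd.2, hd.1⟩
      · simp only [cond_true, List.map_cons, List.map_nil, List.cons.injEq, and_true] at hd
        exact ⟨p, q, h3, hd.1, hd.2⟩
    by_cases hl : l = []
    · subst hl
      obtain ⟨rfl, rfl⟩ := ht.nil_inv
      exact ⟨p, q, [p], rfl, rfl, hpq.trail, rfl⟩
    · obtain ⟨x, y, ws, h1, h2, h3, h4⟩ := ih ht hl (fun d h => hk d (by simp [h]))
        fun a b hab h => hg a b hab (List.mem_of_mem_tail h)
      have : q = x := by
        refine hg q x h1.symm ?_
        obtain ⟨ws', rfl⟩ := h3.eq_cons hl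
        simp [← h4, h1]
      subst this
      exact ⟨p, y, p :: ws, rfl, h2, .cons hpq h3, by simp [h4]⟩

/-! ### Traversals -/

/-- `S.Ends c x vs y`: a trail from `x` to `y` through the nodes `vs` is a path from the first to
the second external node (for `c = false`) or a cycle without external nodes (for `c = true`), and
passes every node once. -/
def Ends (S : Shape) : Bool → S.V → List S.V → S.V → Prop
  | false, x, vs, y => S.ext = [x, y] ∧ Enum (vs ++ [y])
  | true, x, vs, y => S.ext = [] ∧ y = x ∧ Enum vs

/-- The darts `l` traverse `S`, which is a path (for `c = false`) or a cycle (for `c = true`): each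
hyperedge and each node is passed exactly once. -/
structure Trav (S : Shape) (c : Bool) (l : List (S.E × Bool)) : Prop where
  ne : l ≠ []
  edges : Enum (l.map Prod.fst)
  trail : ∃ x vs y, S.Trail x l vs y ∧ S.Ends c x vs y

theorem Ends.rank {c : Bool} {x y : S.V} {vs : List S.V} (h : S.Ends c x vs y) :
    S.ext.length = bif c then 0 else 2 := by
  cases c <;> simp [h.1]

theorem Ends.mem {c : Bool} {x y : S.V} {vs : List S.V} (h : S.Ends c x vs y) (v : S.V) :
    v ∈ vs ++ [y] := by
  cases c
  · exact h.2.2 v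
  · exact List.mem_append_left _ (h.2.2.2 v)

theorem Ends.nodup {c : Bool} {x y : S.V} {vs : List S.V} (h : S.Ends c x vs y) : vs.Nodup := by
  cases c
  · exact (List.nodup_append.1 h.2.1).1
  · exact h.2.2.1

variable {c : Bool} {l : List (S.E × Bool)}

theorem Trav.exists_mem (h : S.Trav c l) (e : S.E) : ∃ s, (e, s) ∈ l := by
  obtain ⟨d, hd, rfl⟩ := List.mem_map.1 (h.edges.2 e)
  exact ⟨d.2, hd⟩

theorem Trav.length_att (h : S.Trav c l) (e : S.E) : (S.att e).length = 2 := by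
  obtain ⟨s, hs⟩ := h.exists_mem e
  obtain ⟨x, vs, y, ht, -⟩ := h.trail
  obtain ⟨a, b, hd, -⟩ := ht.dart_of_mem hs
  exact hd.length

theorem Trav.rank (h : S.Trav c l) : S.ext.length = bif c then 0 else 2 := by
  obtain ⟨x, vs, y, -, he⟩ := h.trail
  exact he.rank

theorem Trav.ext_nodup (h : S.Trav c l) : S.ext.Nodup := by
  obtain ⟨x, vs, y, ht, he⟩ := h.trail
  cases c
  · obtain ⟨ws, rfl⟩ := ht.eq_cons h.ne
    have := he.2.1
    rw [he.1]
    simp at this ⊢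
    tauto
  · rw [he.1]; exact List.nodup_nil

theorem Trav.noIsolated (h : S.Trav c l) : S.NoIsolated := by
  intro v
  obtain ⟨x, vs, y, ht, he⟩ := h.trail
  obtain ⟨d, -, hd⟩ := ht.mem_att h.ne (he.mem v)
  exact ⟨d.1, hd⟩

theorem Trav.map (h : S.Trav c l) {g : S.V → T.V} {k : S.E → T.E} (hg : g.Bijective)
    (hk : k.Bijective) (ha : ∀ e, T.att (k e) = (S.att e).map g) (hx : T.ext = S.ext.map g) :
    T.Trav c (l.map fun d => (k d.1, d.2)) := by
  obtain ⟨x, vs, y, ht, he⟩ := h.trail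
  refine ⟨by simpa using h.ne, ?_, g x, vs.map g, g y, ht.map g k fun d _ => ha d.1, ?_⟩
  · have := h.edges.map hk
    simpa [Function.comp_def] using this
  · cases c
    · refine ⟨by rw [hx, he.1]; rfl, ?_⟩
      have := he.2.map hg
      simpa using this
    · exact ⟨by rw [hx, he.1]; rfl, by rw [he.2.1], he.2.2.map hg⟩

theorem Trav.iso (h : S.Trav c l) (i : S.Iso T) : T.Trav c (l.map fun d => (i.edge d.1, d.2)) :=
  h.map i.node.bijective i.edge.bijective i.att_edge i.ext_eq

/-- A cycle may be traversed from any of its nodes. -/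
theorem Trav.rotate {l m : List (S.E × Bool)} (h : S.Trav true (l ++ m)) :
    S.Trav true (m ++ l) := by
  obtain ⟨x, vs, y, ht, hx, rfl, hv⟩ := h.trail
  obtain ⟨z, vs', ws, rfl, h1, h2⟩ := ht.append_inv
  refine ⟨?_, ?_, z, ws ++ vs', z, h2.append h1, hx, rfl, hv.perm List.perm_append_comm⟩
  · have := h.ne; simp at this ⊢; tauto
  · have := h.edges
    rw [List.map_append] at this ⊢
    exact this.perm List.perm_append_comm

/-- A cycle may be traversed in the opposite direction. -/
theorem Trav.inverse (h : S.Trav true l) : S.Trav true (inv l) := by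
  obtain ⟨x, vs, y, ht, hx, rfl, hv⟩ := h.trail
  obtain ⟨ws, h1, h2⟩ := ht.rev
  refine ⟨by simpa using h.ne, ?_, y, ws, y, h1, hx, rfl, ?_⟩
  · rw [map_fst_inv]
    exact h.edges.perm (List.reverse_perm _).symm
  · refine hv.perm ?_
    rw [← List.perm_append_right_iff [y], h2]
    exact (List.reverse_perm _).symm

/-- A path determines its traversal. -/
theorem Trail.unique {l l' : List (S.E × Bool)} {x y y' : S.V} {vs vs' : List S.V}
    (h : S.Trail x l vs y) (h' : S.Trail x l' vs' y') (hv : (vs ++ [y]).Nodup)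
    (hn : (l.map Prod.fst).Nodup) (hn' : (l'.map Prod.fst).Nodup)
    (hl : ∀ e, e ∈ l.map Prod.fst ↔ e ∈ l'.map Prod.fst) : l = l' := by
  induction h generalizing l' vs' with
  | nil =>
    cases l' with
    | nil => rfl
    | cons d l' => simpa using hl d.1
  | @cons x z y d l vs hd ht ih =>
    have hx : x ≠ z := by
      rintro rfl
      cases ht <;> simp at hv
    have hx' : ∀ d' ∈ l, x ∉ S.att d'.1 := by
      intro d' hd' hm
      obtain ⟨a, b, h1, h2, h3⟩ := ht.dart_of_mem hd'
      have h4 : x ∈ vs ++ [y] := by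
        rcases h1.eq_or_of_mem hm with rfl | rfl
        · exact List.mem_append_left _ h2
        · rcases List.mem_append.1 h3 with h3 | h3
          · exact List.mem_append_left _ (List.mem_of_mem_tail h3)
          · exact List.mem_append_right _ h3
      exact (List.nodup_cons.1 hv).1 h4
    cases h' with
    | nil => simpa using hl d.1
    | @cons _ z' _ d' l' vs' hd' ht' =>
      have hdd : d'.1 = d.1 := by
        have := (hl d'.1).2 (by simp)
        rcases List.mem_cons.1 this with h | h
        · exact h
        · obtain ⟨d'', h1, h2⟩ := List.mem_map.1 h
          exact absurd (h2 ▸ hd'.left_mem) (hx' _ h1)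
      obtain ⟨e, s⟩ := d
      obtain ⟨e', s'⟩ := d'
      obtain rfl : e' = e := hdd
      have hs : s' = s := by
        cases s <;> cases s' <;> simp_all [Dart]
      subst hs
      obtain ⟨-, rfl⟩ := hd.unique hd'
      simp only [List.map_cons, List.nodup_cons] at hn hn'
      rw [ih ht' (List.nodup_cons.1 hv).2 hn.2 hn'.2]
      intro a
      have := hl a
      simp only [List.map_cons, List.mem_cons] at this
      constructor
      · intro ha
        rcases this.1 (.inr ha) with rfl | h
        · exact absurd ha hn.1
        · exact h
      · intro ha
        rcases this.2 (.inr ha) with rfl | h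
        · exact absurd ha hn'.1
        · exact h

theorem Trav.unique {l' : List (S.E × Bool)} (h : S.Trav false l) (h' : S.Trav false l') :
    l = l' := by
  obtain ⟨x, vs, y, ht, hx, hv⟩ := h.trail
  obtain ⟨x', vs', y', ht', hx', hv'⟩ := h'.trail
  obtain ⟨rfl, rfl⟩ : x = x' ∧ y = y' := by simpa [hx] using hx'
  exact ht.unique ht' hv.1 h.edges.1 h'.edges.1 fun e =>
    ⟨fun _ => h'.edges.2 e, fun _ => h.edges.2 e⟩

theorem Trail.att_map {x y : S.V} {l : List (S.E × Bool)} {vs : List S.V} (h : S.Trail x l vs y)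
    {g : S.V → T.V} {k : S.E → T.E} (hT : T.Trail (g x) (l.map fun d => (k d.1, d.2)) (vs.map g)
      (g y)) : ∀ d ∈ l, T.att (k d.1) = (S.att d.1).map g := by
  induction h with
  | nil => simp
  | @cons x y z d l vs hd ht ih =>
    obtain ⟨z', ws, h1, h2, h3⟩ := hT.cons_inv
    obtain rfl : vs.map g = ws := by simpa using h1
    obtain rfl : z' = g y := by
      cases ht with
      | nil => exact h3.nil_inv.1
      | cons =>
        obtain ⟨_, _, h4, -⟩ := h3.cons_inv
        simp at h4
        exact h4.1.symm
    rintro d' hd'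
    rcases List.mem_cons.1 hd' with rfl | hd'
    · obtain ⟨e, s⟩ := d'
      cases s <;> simp_all [Dart]
    · exact ih h3 d' hd'

/-- Traversals with the same signs give rise to an isomorphism. -/
theorem Trav.exists_iso {m : List (T.E × Bool)} (h : S.Trav c l) (h' : T.Trav c m)
    (hs : l.map Prod.snd = m.map Prod.snd) :
    ∃ i : S.Iso T, m = l.map fun d => (i.edge d.1, d.2) := by
  obtain ⟨x, vs, y, ht, he⟩ := h.trail
  obtain ⟨x', vs', y', ht', he'⟩ := h'.trail
  have hlen : l.length = m.length := by simpa using congrArg List.length hs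
  obtain ⟨k, hk⟩ := h.edges.exists_equiv h'.edges (by simpa using hlen)
  have hm : m = l.map fun d => (k d.1, d.2) := by
    apply List.ext_getElem
    · simp [hlen]
    · intro i h1 h2
      have h3 : i < l.length := by omega
      have h4 : k (l[i].1) = m[i].1 := by
        have := congrArg (fun t => t[i]?) hk
        simpa [h1, h3] using this
      have h5 : l[i].2 = m[i].2 := by
        have := congrArg (fun t => t[i]?) hs
        simpa [h1, h3] using this
      simp [h4, h5]
  have hvl : vs.length = vs'.length := by rw [ht.length_eq, ht'.length_eq, hlen]
  obtain ⟨g, hg, hy⟩ : ∃ g : S.V ≃ T.V, vs.map g = vs' ∧ g y = y' := by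
    cases c
    · obtain ⟨g, hg⟩ := he.2.exists_equiv he'.2 (by simp [hvl])
      rw [List.map_append] at hg
      have := List.append_inj hg (by simp [hvl])
      exact ⟨g, this.1, by simpa using this.2⟩
    · obtain ⟨g, hg⟩ := he.2.2.exists_equiv he'.2.2 hvl
      refine ⟨g, hg, ?_⟩
      obtain ⟨ws, rfl⟩ := ht.eq_cons h.ne
      obtain ⟨ws', rfl⟩ := ht'.eq_cons h'.ne
      rw [he.2.1, he'.2.1]
      simpa using (List.cons.inj hg).1
  have hx : g x = x' := by
    obtain ⟨ws, rfl⟩ := ht.eq_cons h.ne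
    obtain ⟨ws', rfl⟩ := ht'.eq_cons h'.ne
    simpa using (List.cons.inj hg).1
  subst hx hy hg
  rw [hm] at ht'
  refine ⟨⟨g, k, fun e => ?_, ?_⟩, hm⟩
  · obtain ⟨s, hs⟩ := h.exists_mem e
    exact ht.att_map ht' _ hs
  · cases c
    · rw [he.1, he'.1]; rfl
    · rw [he.1, he'.1]; rfl

end Shape

/-! ### The nodes of a replacement -/

namespace Shape
variable {L : Type u} {S : Shape} {K : S.E → HGraph L}

/-- A node of `S` as a node of the replacement. -/
def outer (S : Shape) (K : S.E → HGraph L) (v : S.V) : (S.replace K).shape.V :=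
  Quot.mk _ (Sum.inl v)

/-- A node of the copy of `K e` as a node of the replacement. -/
def inner (S : Shape) (K : S.E → HGraph L) (e : S.E) (w : (K e).shape.V) :
    (S.replace K).shape.V :=
  Quot.mk _ (Sum.inr ⟨e, w⟩)

/-- A hyperedge of the copy of `K e` as a hyperedge of the replacement. -/
def copy (S : Shape) (K : S.E → HGraph L) (e : S.E) (f : (K e).shape.E) :
    (S.replace K).shape.E :=
  ⟨e, f⟩

theorem exists_copy (f : (S.replace K).shape.E) : ∃ e f', f = S.copy K e f' := ⟨f.1, f.2, rfl⟩

theorem copy_injective (e : S.E) : (S.copy K e).Injective := fun a b h =>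
  eq_of_heq (Sigma.mk.inj (show (⟨e, a⟩ : Σ e, (K e).shape.E) = ⟨e, b⟩ from h)).2

theorem copy_fst {e e' : S.E} {f : (K e).shape.E} {f' : (K e').shape.E}
    (h : S.copy K e f = S.copy K e' f') : e = e' := congrArg Sigma.fst h

/-- The external nodes of each `K e` can be fused with the attachment nodes of `e`, without
identifying nodes of `K e`. -/
def Fits (S : Shape) (K : S.E → HGraph L) : Prop :=
  ∀ e, (K e).shape.ext.Nodup ∧ (K e).shape.ext.length = (S.att e).length

open Classical in
/-- The normal form of a node before fusion: an external node of `K e` is replaced by the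
attachment node of `e` with which it is fused. -/
noncomputable def normalize (S : Shape) (K : S.E → HGraph L) :
    (S.V ⊕ Σ e, (K e).shape.V) → (S.V ⊕ Σ e, (K e).shape.V)
  | .inl v => .inl v
  | .inr ⟨e, w⟩ =>
    if h : (K e).shape.ext.idxOf w < (S.att e).length then .inl (S.att e)[(K e).shape.ext.idxOf w]
    else .inr ⟨e, w⟩

theorem normalize_ext (hK : S.Fits K) (e : S.E) (i : ℕ) (hi : i < (K e).shape.ext.length)
    (hj : i < (S.att e).length) :
    S.normalize K (.inr ⟨e, (K e).shape.ext[i]⟩) = .inl (S.att e)[i] := by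
  classical
  have : (K e).shape.ext.idxOf (K e).shape.ext[i] = i := (hK e).1.idxOf_getElem i hi
  simp only [normalize]
  rw [dif_pos (by convert hj)]
  congr 2

theorem normalize_inr (hK : S.Fits K) {e : S.E} {w : (K e).shape.V} (hw : w ∉ (K e).shape.ext) :
    S.normalize K (.inr ⟨e, w⟩) = .inr ⟨e, w⟩ := by
  classical
  simp only [normalize]
  rw [dif_neg]
  rw [not_lt, ← (hK e).2]
  convert (List.idxOf_eq_length hw).ge

theorem normalize_eq (hK : S.Fits K) {a b : S.V ⊕ Σ e, (K e).shape.V}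
    (h : (Quot.mk (S.Fuse K) a) = Quot.mk _ b) : S.normalize K a = S.normalize K b := by
  refine congrArg (Quot.lift (S.normalize K) ?_) h
  rintro _ _ ⟨e, i, hi, hj⟩
  exact normalize_ext hK e i hi hj

theorem outer_injective (hK : S.Fits K) : (S.outer K).Injective := fun _ _ h =>
  Sum.inl_injective (normalize_eq hK h)

theorem inner_ne_outer (hK : S.Fits K) {e : S.E} {w : (K e).shape.V} (hw : w ∉ (K e).shape.ext)
    (v : S.V) : S.inner K e w ≠ S.outer K v := by
  intro h
  have := normalize_eq hK h
  rw [normalize_inr hK hw] at this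
  cases this

theorem inner_eq_inner (hK : S.Fits K) {e e' : S.E} {w : (K e).shape.V} {w' : (K e').shape.V}
    (hw : w ∉ (K e).shape.ext) (h : S.inner K e w = S.inner K e' w') :
    (⟨e, w⟩ : Σ e, (K e).shape.V) = ⟨e', w'⟩ := by
  by_cases hw' : w' ∈ (K e').shape.ext
  · obtain ⟨i, hi, rfl⟩ := List.getElem_of_mem hw'
    have := normalize_eq hK h
    rw [normalize_inr hK hw, normalize_ext hK e' i hi ((hK e').2 ▸ hi)] at this
    cases this
  · have := normalize_eq hK h
    rw [normalize_inr hK hw, normalize_inr hK hw'] at this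
    exact Sum.inr_injective this

theorem inner_ext (e : S.E) (i : ℕ) (hi : i < (K e).shape.ext.length)
    (hj : i < (S.att e).length) :
    S.inner K e (K e).shape.ext[i] = S.outer K (S.att e)[i] :=
  Quot.sound (.fuse e i hi hj)

theorem inner_pair {e : S.E} {a b : (K e).shape.V} {x y : S.V} (he : (K e).shape.ext = [a, b])
    (ha : S.att e = [x, y]) : S.inner K e a = S.outer K x ∧ S.inner K e b = S.outer K y := by
  have h0 := inner_ext (K := K) e 0 (by simp [he]) (by simp [ha])
  have h1 := inner_ext (K := K) e 1 (by simp [he]) (by simp [ha])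
  simp only [he, ha] at h0 h1
  exact ⟨h0, h1⟩

theorem exists_outer_of_mem_ext (hK : S.Fits K) {e : S.E} {w : (K e).shape.V}
    (hw : w ∈ (K e).shape.ext) : ∃ x ∈ S.att e, S.inner K e w = S.outer K x := by
  obtain ⟨i, hi, rfl⟩ := List.getElem_of_mem hw
  have hj : i < (S.att e).length := (hK e).2 ▸ hi
  exact ⟨_, List.getElem_mem hj, inner_ext e i hi hj⟩

/-- A node of `K e` is a node of `S` only if it is fused with an attachment node of `e`. -/
theorem mem_att_of_inner_eq_outer (hK : S.Fits K) {e : S.E} {w : (K e).shape.V} {v : S.V}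
    (h : S.inner K e w = S.outer K v) : v ∈ S.att e := by
  by_cases hw : w ∈ (K e).shape.ext
  · obtain ⟨x, hx, h'⟩ := exists_outer_of_mem_ext hK hw
    rwa [← outer_injective hK (h'.symm.trans h)]
  · exact absurd h (inner_ne_outer hK hw v)

theorem node_cases (hK : S.Fits K) (v : (S.replace K).shape.V) :
    (∃ x, v = S.outer K x) ∨ ∃ e, ∃ w ∉ (K e).shape.ext, v = S.inner K e w := by
  induction v using Quot.ind with
  | mk v =>
    rcases v with x | ⟨e, w⟩
    · exact .inl ⟨x, rfl⟩
    · by_cases hw : w ∈ (K e).shape.ext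
      · obtain ⟨x, -, h⟩ := exists_outer_of_mem_ext hK hw
        exact .inl ⟨x, h⟩
      · exact .inr ⟨e, w, hw, rfl⟩

/-- If `e` is attached to distinct nodes then no nodes of `K e` are identified. -/
theorem inner_injective (hK : S.Fits K) {e : S.E} (he : (S.att e).Nodup) :
    (S.inner K e).Injective := by
  intro w w' h
  by_cases hw : w ∈ (K e).shape.ext
  · by_cases hw' : w' ∈ (K e).shape.ext
    · obtain ⟨i, hi, rfl⟩ := List.getElem_of_mem hw
      obtain ⟨j, hj, rfl⟩ := List.getElem_of_mem hw'
      have hi' : i < (S.att e).length := (hK e).2 ▸ hi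
      have hj' : j < (S.att e).length := (hK e).2 ▸ hj
      rw [inner_ext e i hi hi', inner_ext e j hj hj'] at h
      obtain rfl := (he.getElem_inj_iff).1 (outer_injective hK h)
      rfl
    · simpa using (inner_eq_inner hK hw' h.symm).symm
  · simpa using inner_eq_inner hK hw h

theorem att_replace (e : S.E) (f : (K e).shape.E) :
    (S.replace K).shape.att (S.copy K e f) = ((K e).shape.att f).map (S.inner K e) := rfl

theorem ext_replace : (S.replace K).shape.ext = S.ext.map (S.outer K) := rfl

theorem enum_nodes (hK : S.Fits K) {t : List S.V} (ht : Enum t) {es : List S.E} (hes : Enum es)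
    (int : ∀ e, List (K e).shape.V) (hint : ∀ e, (int e).Nodup)
    (hm : ∀ e w, w ∈ int e ↔ w ∉ (K e).shape.ext) :
    Enum (t.map (S.outer K) ++ es.flatMap fun e => (int e).map (S.inner K e)) := by
  refine ⟨?_, fun v => ?_⟩
  · rw [List.nodup_append]
    refine ⟨ht.1.map (outer_injective hK), ?_, ?_⟩
    · rw [List.nodup_flatMap]
      refine ⟨fun e _ => ?_, hes.1.imp fun {e e'} hne => ?_⟩
      · refine (hint e).map_on fun w hw w' _ h => ?_
        simpa using inner_eq_inner hK ((hm e w).1 hw) h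
      · simp only [Function.onFun, List.disjoint_left, List.mem_map]
        rintro _ ⟨w, hw, rfl⟩ ⟨w', -, h⟩
        exact hne (congrArg Sigma.fst (inner_eq_inner hK ((hm e w).1 hw) h.symm))
    · simp only [List.mem_map, List.mem_flatMap]
      rintro _ ⟨v, -, rfl⟩ _ ⟨e, -, w, hw, rfl⟩ h
      exact inner_ne_outer hK ((hm e w).1 hw) v h.symm
  · rcases node_cases hK v with ⟨x, rfl⟩ | ⟨e, w, hw, rfl⟩
    · exact List.mem_append_left _ (List.mem_map_of_mem (ht.2 x))
    · refine List.mem_append_right _ (List.mem_flatMap.2 ⟨e, hes.2 e, ?_⟩)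
      exact List.mem_map_of_mem ((hm e w).2 hw)

/-! ### Replacing the hyperedges of a path or a cycle by paths -/

/-- The darts of a replacement that run through the copy of `K d.1`, which is traversed by
`le d.1`, in the direction of `d`. -/
def through (K : S.E → HGraph L) (le : ∀ e, List ((K e).shape.E × Bool)) (d : S.E × Bool) :
    List ((S.replace K).shape.E × Bool) :=
  orient d.2 ((le d.1).map fun f => (S.copy K d.1 f.1, f.2))

theorem mem_through {le : ∀ e, List ((K e).shape.E × Bool)} {d : S.E × Bool}
    {f : (S.replace K).shape.E} : f ∈ (through K le d).map Prod.fst ↔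
      f ∈ ((le d.1).map Prod.fst).map (S.copy K d.1) := by
  rw [through, mem_map_fst_orient, List.map_map, List.map_map]
  rfl

theorem enum_through {l : List (S.E × Bool)} (hl : Enum (l.map Prod.fst))
    {le : ∀ e, List ((K e).shape.E × Bool)} (hle : ∀ e, Enum ((le e).map Prod.fst)) :
    Enum ((l.flatMap (through K le)).map Prod.fst) := by
  rw [List.map_flatMap]
  refine ⟨List.nodup_flatMap.2 ⟨fun d _ => ?_, ?_⟩, fun f => ?_⟩
  · rw [through, nodup_map_fst_orient]
    have := (hle d.1).1.map (copy_injective (K := K) d.1)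
    rw [List.map_map] at this ⊢
    exact this
  · have := List.pairwise_map.1 hl.1
    refine this.imp fun {d d'} hne => ?_
    simp only [Function.onFun, List.disjoint_left]
    intro f h h'
    rw [mem_through] at h h'
    obtain ⟨_, -, rfl⟩ := List.mem_map.1 h
    obtain ⟨_, -, h⟩ := List.mem_map.1 h'
    exact hne (copy_fst h).symm
  · obtain ⟨e, f, rfl⟩ := exists_copy f
    obtain ⟨d, hd, rfl⟩ := List.mem_map.1 (hl.2 e)
    refine List.mem_flatMap.2 ⟨d, hd, ?_⟩
    rw [mem_through]
    exact List.mem_map_of_mem ((hle _).2 f)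

theorem fits_of_trav (hS : ∀ e, (S.att e).length = 2) {le : ∀ e, List ((K e).shape.E × Bool)}
    (hK : ∀ e, (K e).shape.Trav false (le e)) : S.Fits K :=
  fun e => ⟨(hK e).ext_nodup, by rw [(hK e).rank, hS]; rfl⟩

theorem Trav.exists_interior {T : Shape} {l : List (T.E × Bool)} (h : T.Trav false l) :
    ∃ (a b : T.V) (int : List T.V), T.ext = [a, b] ∧ T.Trail a l (a :: int) b ∧ int.Nodup ∧
      ∀ w, w ∈ int ↔ w ∉ T.ext := by
  obtain ⟨a, vs, b, ht, hx, hv⟩ := h.trail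
  obtain ⟨int, rfl⟩ := ht.eq_cons h.ne
  refine ⟨a, b, int, hx, ht, ?_, fun w => ?_⟩
  · exact (List.nodup_cons.1 (List.nodup_append.1 hv.1).1).2
  · have h1 := hv.2 w
    have h2 := hv.1
    simp only [List.cons_append, List.nodup_cons, List.mem_append, List.nodup_append,
      List.mem_cons] at h1 h2
    rw [hx]
    simp only [List.mem_cons, List.not_mem_nil, or_false, not_or]
    constructor
    · intro hw
      exact ⟨by rintro rfl; exact h2.1 (.inl hw),
        by rintro rfl; exact h2.2.2.2 _ hw _ (.inl rfl) rfl⟩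
    · tauto

/-- If the hyperedges of a path or a cycle are replaced by paths, the result is a path or a cycle.
-/
theorem Trav.replace {c : Bool} {l : List (S.E × Bool)} (hS : S.Trav c l)
    {le : ∀ e, List ((K e).shape.E × Bool)} (hK : ∀ e, (K e).shape.Trav false (le e)) :
    (S.replace K).shape.Trav c (l.flatMap (through K le)) := by
  have hf : S.Fits K := fits_of_trav hS.length_att hK
  choose a b int hx ht hint hm using fun e => (hK e).exists_interior
  -- Each dart becomes a trail, with the same ends, through the nodes of `K e` that are not fused.
  have key1 : ∀ (d : S.E × Bool) (x y : S.V), S.Dart d x y →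
      ∃ ws, (S.replace K).shape.Trail (S.outer K x) (through K le d) ws (S.outer K y) ∧
        ws.Perm (S.outer K x :: (int d.1).map (S.inner K d.1)) := by
    rintro ⟨e, s⟩ x y hd
    have h1 := (ht e).map (T := (S.replace K).shape) (S.inner K e) (S.copy K e) fun _ _ => rfl
    cases s
    · obtain ⟨h2, h3⟩ := inner_pair (hx e) hd
      obtain ⟨ws, h4, h5⟩ := h1.rev
      rw [h2, h3] at h4
      refine ⟨ws, h4, ?_⟩
      have : ws ++ [S.outer K y] =
          (S.outer K x :: ((int e).map (S.inner K e)).reverse) ++ [S.outer K y] := by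
        rw [h2, h3] at h5
        rw [h5]; simp [h2]
      rw [List.append_cancel_right this]
      exact (List.reverse_perm _).cons _
    · obtain ⟨h2, h3⟩ := inner_pair (hx e) hd
      rw [h2, h3] at h1
      exact ⟨_, h1, by rw [List.map_cons, h2]⟩
  have key2 : ∀ (l : List (S.E × Bool)) (x y : S.V) (vs : List S.V), S.Trail x l vs y →
      ∃ ws, (S.replace K).shape.Trail (S.outer K x) (l.flatMap (through K le)) ws (S.outer K y) ∧
        ws.Perm (vs.map (S.outer K) ++
          (l.map Prod.fst).flatMap fun e => (int e).map (S.inner K e)) := by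
    intro l x y vs h
    induction h with
    | nil x => exact ⟨[], .nil _, .refl _⟩
    | @cons x y z d l vs hd _ ih =>
      obtain ⟨w1, h1, p1⟩ := key1 d x y hd
      obtain ⟨w2, h2, p2⟩ := ih
      refine ⟨w1 ++ w2, h1.append h2, (p1.append p2).trans ?_⟩
      simp only [List.map_cons, List.flatMap_cons, List.cons_append]
      refine List.Perm.cons _ ?_
      rw [← List.append_assoc, ← List.append_assoc]
      exact List.perm_append_comm.append_right _
  obtain ⟨x, vs, y, hxy, he⟩ := hS.trail
  obtain ⟨ws, h1, p⟩ := key2 l x y vs hxy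
  refine ⟨?_, enum_through hS.edges fun e => (hK e).edges, _, ws, _, h1, ?_⟩
  · obtain ⟨d, l', rfl⟩ := List.exists_cons_of_ne_nil hS.ne
    simp [through, (hK d.1).ne]
  · cases c
    · refine ⟨by rw [ext_replace, he.1]; rfl, ?_⟩
      have := enum_nodes hf he.2 hS.edges int hint hm
      refine this.perm ?_
      rw [List.map_append, List.append_assoc]
      refine (List.Perm.append_left _ List.perm_append_comm).trans ?_
      rw [← List.append_assoc]
      exact (p.append_right _).symm
    · refine ⟨by rw [ext_replace, he.1]; rfl, by rw [he.2.1], ?_⟩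
      exact (enum_nodes hf he.2.2 hS.edges int hint hm).perm p.symm

end Shape

/-! ### Words of paths and cycles -/

section Words
variable {L : Type u}

/-- `G` is a path (for `c = false`) or a cycle (for `c = true`), along which the signed word `w` is
read; the sign is `false` where a hyperedge is passed backwards. -/
def HGraph.Reads (G : HGraph L) (c : Bool) (w : List (L × Bool)) : Prop :=
  ∃ l, G.shape.Trav c l ∧ l.map (fun d => (G.lab d.1, d.2)) = w

variable {G : HGraph L} {c : Bool} {w : List (L × Bool)}

theorem HGraph.Reads.ne (h : G.Reads c w) : w ≠ [] := by
  obtain ⟨l, hl, rfl⟩ := h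
  simpa using hl.ne

theorem HGraph.Reads.rotate {w w' : List (L × Bool)} (h : G.Reads true (w ++ w')) :
    G.Reads true (w' ++ w) := by
  obtain ⟨l, hl, h⟩ := h
  obtain ⟨l1, l2, rfl, rfl, rfl⟩ := List.map_eq_append_iff.1 h
  exact ⟨l2 ++ l1, hl.rotate, by simp⟩

theorem HGraph.Reads.inverse (h : G.Reads true w) : G.Reads true (inv w) := by
  obtain ⟨l, hl, rfl⟩ := h
  exact ⟨_, hl.inverse, (orient_map G.lab false l).symm⟩

theorem HGraph.Reads.unique {w' : List (L × Bool)} (h : G.Reads false w) (h' : G.Reads false w') :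
    w = w' := by
  obtain ⟨l, hl, rfl⟩ := h
  obtain ⟨l', hl', rfl⟩ := h'
  rw [hl.unique hl']

theorem HGraph.Reads.exists_iso {G' : HGraph L} (h : G.Reads c w) (h' : G'.Reads c w) :
    ∃ i : G.shape.Iso G'.shape, ∀ e, G'.lab (i.edge e) = G.lab e := by
  obtain ⟨l, hl, rfl⟩ := h
  obtain ⟨m, hm, h⟩ := h'
  obtain ⟨i, rfl⟩ := hl.exists_iso hm (by simpa [Function.comp_def] using
    (congrArg (List.map Prod.snd) h).symm)
  refine ⟨i, fun e => ?_⟩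
  obtain ⟨s, hs⟩ := hl.exists_mem e
  rw [List.map_map, List.map_inj_left] at h
  exact congrArg Prod.fst (h _ hs)

theorem HGraph.Reads.exists_lab (h : G.Reads c w) (e : G.shape.E) : ∃ s, (G.lab e, s) ∈ w := by
  obtain ⟨l, hl, rfl⟩ := h
  obtain ⟨s, hs⟩ := hl.exists_mem e
  exact ⟨s, List.mem_map_of_mem hs⟩

variable {S : Shape} {K : S.E → HGraph L}

theorem map_lab_through (le : ∀ e, List ((K e).shape.E × Bool)) (d : S.E × Bool) :
    (Shape.through K le d).map (fun f => ((S.replace K).lab f.1, f.2)) =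
      orient d.2 ((le d.1).map fun f => ((K d.1).lab f.1, f.2)) := by
  rw [Shape.through, ← orient_map, List.map_map]
  rfl

open Shape in
theorem Shape.Trav.reads_replace {l : List (S.E × Bool)} (hS : S.Trav c l)
    {W : S.E → List (L × Bool)} (hK : ∀ e, (K e).Reads false (W e)) :
    (S.replace K).Reads c (l.flatMap fun d => orient d.2 (W d.1)) := by
  choose le hle hW using hK
  refine ⟨_, hS.replace hle, ?_⟩
  rw [List.map_flatMap]
  congr 1
  funext d
  rw [map_lab_through, hW]

end Words

/-! ### Standard paths and cycles -/

section Standard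
variable {L : Type u}

theorem stringShape_trail (n : ℕ) :
    (stringShape n).Trail (0 : Fin (n + 1)) ((List.finRange n).map fun i : Fin n => (i, true))
      ((List.finRange n).map Fin.castSucc) (Fin.last n) := by
  induction n with
  | zero => exact .nil _
  | succ n ih =>
    have h1 := ih.map (T := stringShape (n + 1)) (Fin.succ : Fin (n + 1) → Fin (n + 2))
      (Fin.succ : Fin n → Fin (n + 1)) (fun d _ => rfl)
    have h2 := Shape.Trail.cons (S := stringShape (n + 1)) (x := (0 : Fin (n + 2)))
      (d := ((0 : Fin (n + 1)), true)) rfl h1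
    have e1 : (List.finRange (n + 1)).map (fun i : Fin (n + 1) => (i, true)) = (0, true) ::
        ((List.finRange n).map fun i : Fin n => (i, true)).map fun d => (d.1.succ, d.2) := by
      rw [List.finRange_succ]; simp [Function.comp_def]
    have e2 : (List.finRange (n + 1)).map Fin.castSucc =
        0 :: ((List.finRange n).map Fin.castSucc).map Fin.succ := by
      rw [List.finRange_succ]; simp [Function.comp_def]
    exact h2.congr e1.symm e2.symm

theorem enum_finRange (n : ℕ) : Enum (List.finRange n) := ⟨List.nodup_finRange n, List.mem_finRange⟩

theorem enum_unit : Enum [()] := ⟨by simp, fun _ => by simp⟩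

theorem stringShape_trav {n : ℕ} (hn : n ≠ 0) :
    (stringShape n).Trav false ((List.finRange n).map fun i : Fin n => (i, true)) := by
  have h1 : (List.finRange n).map (fun i : Fin n => (i, true)) ≠ [] := by
    simpa [List.finRange_eq_nil_iff] using hn
  have h2 : ((List.finRange n).map (fun i : Fin n => (i, true))).map Prod.fst =
      List.finRange n := by
    simp [Function.comp_def]
  have h3 : (List.finRange n).map Fin.castSucc ++ [Fin.last n] = List.finRange (n + 1) :=
    (List.finRange_succ_last (n := n)).symm
  exact ⟨h1, (congrArg Enum h2).mpr (enum_finRange n), _, _, _, stringShape_trail n, rfl,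
    (congrArg Enum h3).mpr (enum_finRange (n + 1))⟩

theorem stringGraph_reads {w : List L} (hw : w ≠ []) :
    (stringGraph w).Reads false (w.map fun a => (a, true)) := by
  refine ⟨_, stringShape_trav (by simpa using hw), ?_⟩
  have : ((List.finRange w.length).map fun i => (i, true)).map (fun d => (w.get d.1, d.2)) =
      w.map fun a => (a, true) := by
    apply List.ext_getElem <;> simp
  exact this

theorem string2_trav : (stringShape 2).Trav false [((0 : Fin 2), true), ((1 : Fin 2), true)] :=
  stringShape_trav two_ne_zero

theorem flip_trav : flipShape.Trav false [((), false)] := by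
  have : Enum ([1, 0] : List (Fin 2)) := ⟨by decide, by decide⟩
  exact ⟨List.cons_ne_nil _ _, enum_unit, (1 : Fin 2), _, (0 : Fin 2),
    Shape.Dart.trail rfl, rfl, this⟩

theorem loop_trav : loopShape.Trav true [((), true)] :=
  ⟨List.cons_ne_nil _ _, enum_unit, (), _, (), Shape.Dart.trail rfl, rfl, rfl, enum_unit⟩

theorem handle_reads {Pr : Type u} {rk : Pr → ℕ} {A : HType Pr} (h : A.rank rk = 2) :
    (handle rk A).Reads false [(A, true)] := by
  refine ⟨[((), true)], ⟨List.cons_ne_nil _ _, enum_unit, ?_⟩, rfl⟩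
  have : ∀ n, n = 2 → ∃ x vs y, (handleShape n).Trail x [((), true)] vs y ∧
      (handleShape n).Ends false x vs y := by
    rintro _ rfl
    have h1 : List.finRange 2 = [0, 1] := by decide
    exact ⟨(0 : Fin 2), _, (1 : Fin 2), Shape.Dart.trail h1, h1,
      (congrArg Enum h1).mp (enum_finRange 2)⟩
  exact this _ h

/-- There are paths and cycles with any non-empty signed word. -/
theorem exists_reads (c : Bool) {w : List (L × Bool)} (hw : w ≠ []) :
    ∃ G : HGraph L, G.Reads c w := by
  have h1 : ∃ G : HGraph L, G.Reads false w := by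
    have h := stringShape_trav (n := w.length) (by simpa using hw)
    have hK : ∀ i : Fin w.length, ∃ G : HGraph L, G.Reads false [w[i]] := by
      intro i
      rcases w[i] with ⟨a, _ | _⟩
      · exact ⟨⟨flipShape, fun _ => a⟩, _, flip_trav, rfl⟩
      · exact ⟨stringGraph [a], stringGraph_reads (by simp)⟩
    choose K hK using hK
    refine ⟨(stringShape w.length).replace K, ?_⟩
    have := h.reads_replace hK
    rw [List.flatMap_map] at this
    have e : (List.finRange w.length).flatMap (fun i => [w[i]]) = w := by
      rw [← List.map_eq_flatMap]
      apply List.ext_getElem <;> simp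
    exact (congrArg (HGraph.Reads _ false) e).mp this
  cases c
  · exact h1
  · obtain ⟨G, hG⟩ := h1
    refine ⟨loopShape.replace fun _ => G, ?_⟩
    have := loop_trav.reads_replace (K := fun _ => G) fun _ => hG
    simpa using this

end Standard

/-! ### Contracting paths to hyperedges -/

namespace Shape
variable {L : Type u} {S : Shape} {K : S.E → HGraph L}

theorem Trail.split_at {x y v : S.V} {l : List (S.E × Bool)} {vs : List S.V}
    (h : S.Trail x l vs y) (hv : v ∈ vs) :
    ∃ l1 l2 vs1 vs2, l = l1 ++ l2 ∧ vs = vs1 ++ vs2 ∧ S.Trail x l1 vs1 v ∧ S.Trail v l2 vs2 y := by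
  induction h with
  | nil => simp at hv
  | @cons x y z d l vs hd ht ih =>
    by_cases hx : v = x
    · subst hx
      exact ⟨[], _, [], _, rfl, rfl, .nil v, .cons hd ht⟩
    · obtain ⟨l1, l2, vs1, vs2, rfl, rfl, h1, h2⟩ := ih (by simpa [hx] using hv)
      exact ⟨_, l2, _, vs2, rfl, rfl, .cons hd h1, h2⟩

/-- A cycle can be traversed from each of its nodes. -/
theorem Trav.exists_trail_from {l : List (S.E × Bool)} (h : S.Trav true l) (v : S.V) :
    ∃ l' vs, l ~r l' ∧ S.Trav true l' ∧ S.Trail v l' vs v ∧ Enum vs := by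
  obtain ⟨x, vs, y, ht, hx, rfl, hv⟩ := h.trail
  obtain ⟨l1, l2, vs1, vs2, rfl, rfl, h1, h2⟩ := ht.split_at (hv.2 v)
  exact ⟨l2 ++ l1, vs2 ++ vs1, List.isRotated_append, h.rotate, h2.append h1,
    hv.perm List.perm_append_comm⟩

/-- The trail through a copy of a path of one or two hyperedges. -/
theorem through_cases {le : ∀ e, List ((K e).shape.E × Bool)}
    (hK : ∀ e, (K e).shape.Trav false (le e)) {e : S.E} (hS : (S.att e).length = 2)
    (h2 : (∃ f, le e = [f]) ∨ ∃ f g, le e = [f, g]) :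
    ∃ x y, S.Dart (e, true) x y ∧
      ((∃ g, through K le (e, true) = [g] ∧ (S.replace K).shape.Dart g (S.outer K x) (S.outer K y))
        ∨ ∃ g g' m, m ∉ (K e).shape.ext ∧ through K le (e, true) = [g, g'] ∧
          (S.replace K).shape.Dart g (S.outer K x) (S.inner K e m) ∧
          (S.replace K).shape.Dart g' (S.inner K e m) (S.outer K y)) := by
  obtain ⟨x, y, hxy⟩ := List.length_eq_two.1 hS
  obtain ⟨a, b, int, hx, ht, -, hm⟩ := (hK e).exists_interior
  obtain ⟨ha, hb⟩ := inner_pair hx hxy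
  refine ⟨x, y, hxy, ?_⟩
  rcases h2 with ⟨f, hf⟩ | ⟨f, g, hf⟩
  · refine .inl ⟨(S.copy K e f.1, f.2), by simp [through, hf], ?_⟩
    rw [hf] at ht
    rw [← ha, ← hb]
    exact ht.singleton_inv.1.map (T := (S.replace K).shape) _ (S.copy K e) rfl
  · rw [hf] at ht
    obtain ⟨m, ws, hw, h1, h3⟩ := ht.cons_inv
    obtain ⟨h2, rfl⟩ := h3.singleton_inv
    refine .inr ⟨(S.copy K e f.1, f.2), (S.copy K e g.1, g.2), m, (hm m).1 ?_,
      by simp [through, hf], ?_, ?_⟩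
    · obtain rfl : int = [m] := by simpa using hw
      simp
    · rw [← ha]
      exact h1.map (T := (S.replace K).shape) _ (S.copy K e) rfl
    · rw [← hb]
      exact Dart.map (T := (S.replace K).shape) h2 _ (S.copy K e) rfl

theorem through_false (le : ∀ e, List ((K e).shape.E × Bool)) (e : S.E) :
    through K le (e, false) = inv (through K le (e, true)) := rfl

theorem eq_or_rev {α : Type*} {f g : α × Bool} (h : f.1 = g.1) : f = g ∨ f = (g.1, !g.2) := by
  obtain ⟨a, s⟩ := f
  obtain ⟨b, t⟩ := g
  obtain rfl : a = b := h
  cases s <;> cases t <;> simp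

/-- If the hyperedges of `S` are replaced by paths of one or two hyperedges, a trail in the
replacement between nodes of `S` arises from a trail in `S`, since it cannot turn round halfway
through a path. -/
theorem Trail.contract {le : ∀ e, List ((K e).shape.E × Bool)}
    (hK : ∀ e, (K e).shape.Trav false (le e)) (hS : ∀ e, (S.att e).length = 2)
    (h2 : ∀ e, (∃ f, le e = [f]) ∨ ∃ f g, le e = [f, g]) (n : ℕ) :
    ∀ (l : List ((S.replace K).shape.E × Bool)) (x y : S.V) (vs : List (S.replace K).shape.V),
      l.length ≤ n → (S.replace K).shape.Trail (S.outer K x) l vs (S.outer K y) →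
      (l.map Prod.fst).Nodup → ∃ l' ws, S.Trail x l' ws y ∧ l = l'.flatMap (through K le) ∧
        (ws.map (S.outer K)).Sublist vs ∧ ∀ v, S.outer K v ∈ vs → v ∈ ws := by
  have hf : S.Fits K := fits_of_trav hS hK
  have hinj := outer_injective hf
  induction n with
  | zero =>
    intro l x y vs hl ht _
    obtain rfl : l = [] := by simpa using hl
    obtain ⟨h, rfl⟩ := ht.nil_inv
    obtain rfl := hinj h
    exact ⟨[], [], .nil x, rfl, .refl _, by simp⟩
  | succ n ih =>
    intro l x y vs hl ht hn
    cases l with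
    | nil => exact ih [] x y vs (by simp) ht hn
    | cons f l =>
    obtain ⟨Z, vs, rfl, hd, ht1⟩ := ht.cons_inv
    obtain ⟨e, f1, hef⟩ := exists_copy f.1
    have hmem : f.1 ∈ (through K le (e, true)).map Prod.fst := by
      rw [mem_through, hef]
      exact List.mem_map_of_mem ((hK e).edges.2 f1)
    -- one step of `S`, along one hyperedge of the replacement
    have step1 : ∀ s p q, S.Dart (e, s) p q → through K le (e, s) = [f] →
        (S.replace K).shape.Dart f (S.outer K p) (S.outer K q) →
        ∃ l' ws, S.Trail x l' ws y ∧ f :: l = l'.flatMap (through K le) ∧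
        (ws.map (S.outer K)).Sublist (S.outer K x :: vs) ∧
          ∀ v, S.outer K v ∈ S.outer K x :: vs → v ∈ ws := by
      intro s p q h1 h2 h3
      obtain ⟨hp, rfl⟩ := h3.unique hd
      obtain rfl := hinj hp
      obtain ⟨l', ws, t1, rfl, t3, t4⟩ := ih l q y vs (by simpa using hl) ht1
        (List.nodup_cons.1 hn).2
      refine ⟨(e, s) :: l', p :: ws, .cons h1 t1, by simp [h2], t3.cons_cons _, fun v hv => ?_⟩
      rcases List.mem_cons.1 hv with hv | hv
      · simp [hinj hv]
      · simp [t4 v hv]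
    -- one step of `S`, along two hyperedges of the replacement
    have step2 : ∀ s p q g m, m ∉ (K e).shape.ext → S.Dart (e, s) p q →
        through K le (e, s) = [f, g] →
        (S.replace K).shape.Dart f (S.outer K p) (S.inner K e m) →
        (S.replace K).shape.Dart g (S.inner K e m) (S.outer K q) →
        ∃ l' ws, S.Trail x l' ws y ∧ f :: l = l'.flatMap (through K le) ∧
        (ws.map (S.outer K)).Sublist (S.outer K x :: vs) ∧
          ∀ v, S.outer K v ∈ S.outer K x :: vs → v ∈ ws := by
      intro s p q g m hm h1 h2 h3 h4
      obtain ⟨hp, rfl⟩ := h3.unique hd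
      obtain rfl := hinj hp
      cases l with
      | nil => exact absurd ht1.nil_inv.1 (inner_ne_outer hf hm _)
      | cons g' l =>
      obtain ⟨Z', vs, rfl, hd', ht2⟩ := ht1.cons_inv
      -- the only hyperedges at the middle node are `f` and `g`
      have hg : g' = g := by
        obtain ⟨e', f', he⟩ := exists_copy g'.1
        have h5 := hd'.left_mem
        rw [he, att_replace] at h5
        obtain ⟨w, -, hw⟩ := List.mem_map.1 h5
        obtain rfl := congrArg Sigma.fst (inner_eq_inner hf hm hw.symm)
        have h6 : g'.1 ∈ (through K le (e, s)).map Prod.fst := by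
          rw [mem_through, he]
          exact List.mem_map_of_mem ((hK e).edges.2 f')
        rw [h2] at h6
        simp only [List.map_cons, List.map_nil, List.mem_cons, List.not_mem_nil, or_false] at h6
        rcases h6 with h6 | h6
        · simp [h6] at hn
        · rcases eq_or_rev h6 with rfl | rfl
          · rfl
          · exact absurd (h4.rev.unique hd').1.symm (inner_ne_outer hf hm _)
      subst hg
      obtain ⟨-, rfl⟩ := h4.unique hd'
      obtain ⟨l', ws, t1, rfl, t3, t4⟩ := ih l q y vs (by simp at hl; omega) ht2
        (List.nodup_cons.1 (List.nodup_cons.1 hn).2).2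
      refine ⟨(e, s) :: l', p :: ws, .cons h1 t1, by simp [h2], (t3.cons _).cons_cons _,
        fun v hv => ?_⟩
      rcases List.mem_cons.1 hv with hv | hv
      · simp [hinj hv]
      · rcases List.mem_cons.1 hv with hv | hv
        · exact absurd hv.symm (inner_ne_outer hf hm _)
        · simp [t4 v hv]
    obtain ⟨p, q, h1, ⟨g, h3, h4⟩ | ⟨g, g', m, hm, h3, h4, h5⟩⟩ := through_cases hK (hS e) (h2 e)
    · rw [h3] at hmem
      rcases eq_or_rev (List.mem_singleton.1 hmem) with rfl | rfl
      · exact step1 true p q h1 h3 h4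
      · exact step1 false q p h1.rev (by rw [through_false, h3]; rfl) h4.rev
    · rw [h3] at hmem
      simp only [List.map_cons, List.map_nil, List.mem_cons, List.not_mem_nil, or_false] at hmem
      rcases hmem with h | h <;> rcases eq_or_rev h with rfl | rfl
      · exact step2 true p q g' m hm h1 h3 h4 h5
      · exact absurd (h4.rev.unique hd).1 (inner_ne_outer hf hm _)
      · exact absurd (h5.unique hd).1 (inner_ne_outer hf hm _)
      · exact step2 false q p _ m hm h1.rev (by rw [through_false, h3]; rfl) h5.rev h4.rev

/-- Contracting paths of one or two hyperedges in a path or a cycle gives a path or a cycle. The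
given traversal of a cycle may start in the middle of such a path, hence the rotation. -/
theorem Trav.contract {c : Bool} {l : List ((S.replace K).shape.E × Bool)}
    (h : (S.replace K).shape.Trav c l) {le : ∀ e, List ((K e).shape.E × Bool)}
    (hK : ∀ e, (K e).shape.Trav false (le e)) (hS : ∀ e, (S.att e).length = 2)
    (h2 : ∀ e, (∃ f, le e = [f]) ∨ ∃ f g, le e = [f, g]) :
    ∃ l', S.Trav c l' ∧ (l = l'.flatMap (through K le) ∨
      c = true ∧ l ~r l'.flatMap (through K le)) := by
  have hf : S.Fits K := fits_of_trav hS hK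
  have hinj := outer_injective hf
  have edges : ∀ l' : List (S.E × Bool), Enum ((l'.flatMap (through K le)).map Prod.fst) →
      Enum (l'.map Prod.fst) := by
    intro l' hl
    rw [List.map_flatMap] at hl
    refine ⟨?_, fun e => ?_⟩
    · refine List.pairwise_map.2 ((List.nodup_flatMap.1 hl.1).2.imp ?_)
      intro d d' hdd he
      obtain ⟨f, hfl⟩ := List.exists_mem_of_ne_nil _ (hK d.1).ne
      have hm : S.copy K d.1 f.1 ∈ (through K le d).map Prod.fst :=
        mem_through.2 (List.mem_map_of_mem (List.mem_map_of_mem hfl))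
      refine List.disjoint_left.1 hdd hm (mem_through.2 ?_)
      rw [← he]
      exact mem_through.1 hm
    · obtain ⟨f, hfl⟩ := List.exists_mem_of_ne_nil _ (hK e).ne
      obtain ⟨d, hd, hm⟩ := List.mem_flatMap.1 (hl.2 (S.copy K e f.1))
      obtain ⟨f', -, hf'⟩ := List.mem_map.1 (mem_through.1 hm)
      exact List.mem_map.2 ⟨d, hd, copy_fst hf'⟩
  cases c
  · obtain ⟨X, vs, Y, ht, hX, hv⟩ := h.trail
    rw [ext_replace] at hX
    obtain ⟨x, t, hx, rfl, ht'⟩ := List.map_eq_cons_iff.1 hX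
    obtain ⟨y, t', rfl, rfl, ht''⟩ := List.map_eq_cons_iff.1 ht'
    obtain rfl := List.map_eq_nil_iff.1 ht''
    obtain ⟨l', ws, t1, rfl, t3, t4⟩ := Trail.contract hK hS h2 _ l x y vs le_rfl ht h.edges.1
    refine ⟨l', ⟨?_, edges l' h.edges, x, ws, y, t1, hx, ?_, fun v => ?_⟩, .inl rfl⟩
    · rintro rfl; exact h.ne rfl
    · have : ((ws ++ [y]).map (S.outer K)).Nodup := by
        rw [List.map_append]
        exact hv.1.sublist (t3.append (.refl _))
      exact this.of_map _
    · rcases List.mem_append.1 (hv.2 (S.outer K v)) with h | h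
      · exact List.mem_append_left _ (t4 v h)
      · exact List.mem_append_right _ (by simpa using hinj (List.mem_singleton.1 h))
  · obtain ⟨d, -⟩ := List.exists_mem_of_ne_nil _ h.ne
    obtain ⟨p, hp⟩ : ∃ p, p ∈ S.att d.1.1 := by
      apply List.exists_mem_of_ne_nil
      intro h; have := hS d.1.1; simp [h] at this
    obtain ⟨l1, vs, hr, h1, ht, hv⟩ := h.exists_trail_from (S.outer K p)
    obtain ⟨l', ws, t1, rfl, t3, t4⟩ := Trail.contract hK hS h2 _ l1 p p vs le_rfl ht h1.edges.1
    refine ⟨l', ⟨?_, edges l' h1.edges, p, ws, p, t1, ?_, rfl, ?_, fun v => ?_⟩, .inr ⟨rfl, hr⟩⟩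
    · rintro rfl; exact h1.ne rfl
    · have := h1.rank
      simpa [ext_replace] using this
    · exact (hv.1.sublist t3).of_map _
    · exact t4 v (hv.2 _)

/-! ### Cutting paths and cycles -/

/-- A trail through the whole copy of `K d`, between its external nodes, traverses `K d`. -/
theorem Trav.of_lift {d : S.E} (hK : (K d).shape.NoIsolated) {l : List ((K d).shape.E × Bool)}
    (hl : l ≠ []) (he : Enum (l.map Prod.fst)) {a b : (K d).shape.V} {ws : List (K d).shape.V}
    (hx : (K d).shape.ext = [a, b]) (ht : (K d).shape.Trail a l ws b) (hn : (ws ++ [b]).Nodup) :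
    (K d).shape.Trav false l := by
  refine ⟨hl, he, a, ws, b, ht, hx, hn, fun w => ?_⟩
  obtain ⟨f, hf⟩ := hK w
  obtain ⟨⟨f', s⟩, hd, rfl⟩ := List.mem_map.1 (he.2 f)
  obtain ⟨p, q, h1, h2, h3⟩ := ht.dart_of_mem hd
  rcases h1.eq_or_of_mem hf with rfl | rfl
  · exact List.mem_append_left _ h2
  · rcases List.mem_append.1 h3 with h3 | h3
    · exact List.mem_append_left _ (List.mem_of_mem_tail h3)
    · exact List.mem_append_right _ h3

theorem exists_map_copy {d : S.E} {l : List ((S.replace K).shape.E × Bool)}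
    (h : ∀ f ∈ l, ∃ f', f.1 = S.copy K d f') :
    ∃ l' : List ((K d).shape.E × Bool), l = l'.map fun f => (S.copy K d f.1, f.2) := by
  induction l with
  | nil => exact ⟨[], rfl⟩
  | cons f l ih =>
    obtain ⟨l', hl⟩ := ih fun g hg => h g (by simp [hg])
    obtain ⟨f', hf⟩ := h f (by simp)
    refine ⟨(f', f.2) :: l', ?_⟩
    rw [hl]
    simp [← hf]

theorem enum_of_map_copy {d : S.E} {l : List ((K d).shape.E × Bool)}
    (hn : ((l.map fun f => (S.copy K d f.1, f.2)).map Prod.fst).Nodup)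
    (hm : ∀ f, S.copy K d f ∈ (l.map fun f => (S.copy K d f.1, f.2)).map Prod.fst) :
    Enum (l.map Prod.fst) := by
  have : (l.map fun f => (S.copy K d f.1, f.2)).map Prod.fst =
      (l.map Prod.fst).map (S.copy K d) := by
    rw [List.map_map, List.map_map]; rfl
  rw [this] at hn hm
  refine ⟨hn.of_map _, fun f => ?_⟩
  obtain ⟨f', h, hf⟩ := List.mem_map.1 (hm f)
  rwa [← copy_injective d hf]

/-- If `K d` and one hyperedge form a path of which this hyperedge is the last one, or the first
one, then `K d` is a path. -/
theorem Trav.cut_end {d d1 : S.E} {r : Bool}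
    (hS : S.Trav false (bif r then [(d, true), (d1, true)] else [(d1, true), (d, true)]))
    (hf : S.Fits K) (hK : (K d).shape.NoIsolated) {f0 : (K d1).shape.E}
    (hK1 : (K d1).shape.Trav false [(f0, true)])
    {l : List ((S.replace K).shape.E × Bool)} (h : (S.replace K).shape.Trav false l) :
    ∃ l', (K d).shape.Trav false l' ∧
      l = bif r then (l'.map fun f => (S.copy K d f.1, f.2)) ++ [(S.copy K d1 f0, true)]
        else (S.copy K d1 f0, true) :: l'.map fun f => (S.copy K d f.1, f.2) := by
  have hinj := outer_injective hf
  -- all other hyperedges belong to the copy of `K d`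
  have hdd : ∀ e, e = d ∨ e = d1 := fun e => by
    obtain ⟨s, hs⟩ := hS.exists_mem e
    cases r <;> simp at hs <;> tauto
  obtain ⟨s, hs⟩ := h.exists_mem (S.copy K d1 f0)
  obtain ⟨l1, l2, rfl⟩ := List.append_of_mem hs
  have hn := h.edges.1
  rw [List.map_append, List.map_cons, List.nodup_middle, List.nodup_cons] at hn
  have hl : ∀ f ∈ l1 ++ l2, ∃ f', f.1 = S.copy K d f' := by
    intro f hfl
    obtain ⟨e, f', he⟩ := exists_copy f.1
    rcases hdd e with rfl | rfl
    · exact ⟨f', he⟩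
    · obtain rfl : f' = f0 := by simpa using hK1.edges.2 f'
      refine absurd ?_ hn.1
      rw [← List.map_append, ← he]
      exact (List.mem_map_of_mem hfl : f.1 ∈ (l1 ++ l2).map Prod.fst)
  have hmem : ∀ f, S.copy K d f ∈ l1.map Prod.fst ++ l2.map Prod.fst ∨
      S.copy K d f = S.copy K d1 f0 := by
    intro f
    have := h.edges.2 (S.copy K d f)
    simp only [List.map_append, List.map_cons, List.mem_append, List.mem_cons] at this ⊢
    tauto
  have hne : d ≠ d1 := by
    have := hS.edges.1
    cases r
    · simpa [eq_comm] using this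
    · simpa using this
  have hmem' : ∀ f, S.copy K d f ∈ l1.map Prod.fst ++ l2.map Prod.fst := fun f =>
    (hmem f).resolve_right fun h => hne (copy_fst h)
  obtain ⟨X, vs, Z, ht, hX, hv⟩ := h.trail
  obtain ⟨P, v1, vs, rfl, t1, t2⟩ := ht.append_inv
  obtain ⟨Q, v2, rfl, hd, t3⟩ := t2.cons_inv
  obtain ⟨a1, b1, int1, hx1, ht1, -⟩ := hK1.exists_interior
  have hd1 := ht1.singleton_inv.1
  obtain ⟨x, vs, z, hs, hx, hxv⟩ := hS.trail
  rw [ext_replace, hx] at hX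
  obtain ⟨rfl, rfl⟩ : S.outer K x = X ∧ S.outer K z = Z := by simpa using hX
  cases r
  · obtain ⟨y, ws, rfl, g1, g2⟩ := hs.cons_inv
    obtain ⟨g3, rfl⟩ := g2.singleton_inv
    have hxyz : x ≠ y ∧ x ≠ z ∧ y ≠ z := by simpa [and_assoc] using hxv.1
    obtain ⟨i1, i2⟩ := inner_pair hx1 g1
    have hd1' : (S.replace K).shape.Dart (S.copy K d1 f0, true) (S.outer K x) (S.outer K y) := by
      rw [← i1, ← i2]; exact hd1.map _ _ rfl
    -- no other hyperedge is attached to `x`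
    have hxn : ∀ f ∈ l1 ++ l2, S.outer K x ∉ (S.replace K).shape.att f.1 := by
      intro f hfl hxf
      obtain ⟨f', he⟩ := hl f hfl
      rw [he, att_replace] at hxf
      obtain ⟨w, -, hw⟩ := List.mem_map.1 hxf
      have := mem_att_of_inner_eq_outer hf hw
      rcases g3.eq_or_of_mem this with rfl | rfl
      · exact hxyz.1 rfl
      · exact hxyz.2.1 rfl
    have hs : s = true := by
      cases s
      · obtain ⟨rfl, rfl⟩ := hd1'.rev.unique hd
        by_cases h0 : l2 = []
        · subst h0
          exact absurd (hinj t3.nil_inv.1) hxyz.2.1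
        · obtain ⟨f, h1, h2⟩ := t3.left_mem_att h0
          exact absurd h2 (hxn f (by simp [h1]))
      · rfl
    subst hs
    obtain ⟨rfl, rfl⟩ := hd1'.unique hd
    obtain rfl : l1 = [] := by
      by_contra h0
      obtain ⟨f, h1, h2⟩ := t1.left_mem_att h0
      exact hxn f (by simp [h1]) h2
    obtain ⟨-, rfl⟩ := t1.nil_inv
    obtain ⟨l', rfl⟩ := exists_map_copy (l := l2) fun f h => hl f (by simpa using h)
    refine ⟨l', ?_, rfl⟩
    have hl' : l' ≠ [] := by
      rintro rfl
      exact hxyz.2.2 (hinj t3.nil_inv.1)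
    have hinn : (S.inner K d).Injective := inner_injective hf (by
      have : S.att d = [y, z] := g3
      rw [this]; simpa using hxyz.2.2)
    obtain ⟨p, q, ws, hp, hq, hpq, rfl⟩ := t3.lift hl' (fun _ _ => rfl) fun _ _ h _ => hinn h
    obtain ⟨a, b, hab⟩ := List.length_eq_two.1 ((hf d).2.trans g3.length)
    obtain ⟨ha, hb⟩ := inner_pair hab g3
    obtain rfl := hinn (hp.trans ha.symm)
    obtain rfl := hinn (hq.trans hb.symm)
    refine Trav.of_lift hK hl' (enum_of_map_copy (by simpa using hn.2) (by simpa using hmem'))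
      hab hpq ?_
    have h3 : ((ws ++ [q]).map (S.inner K d)).Nodup := by
      rw [List.map_append, List.map_singleton, hq]
      exact (List.nodup_cons.1 hv.1).2
    exact h3.of_map _
  · obtain ⟨y, ws, rfl, g1, g2⟩ := hs.cons_inv
    obtain ⟨g3, rfl⟩ := g2.singleton_inv
    have hxyz : x ≠ y ∧ x ≠ z ∧ y ≠ z := by simpa [and_assoc] using hxv.1
    obtain ⟨i1, i2⟩ := inner_pair hx1 g3
    have hd1' : (S.replace K).shape.Dart (S.copy K d1 f0, true) (S.outer K y) (S.outer K z) := by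
      rw [← i1, ← i2]; exact hd1.map _ _ rfl
    -- no other hyperedge is attached to `z`
    have hxn : ∀ f ∈ l1 ++ l2, S.outer K z ∉ (S.replace K).shape.att f.1 := by
      intro f hfl hxf
      obtain ⟨f', he⟩ := hl f hfl
      rw [he, att_replace] at hxf
      obtain ⟨w, -, hw⟩ := List.mem_map.1 hxf
      have := mem_att_of_inner_eq_outer hf hw
      rcases g1.eq_or_of_mem this with rfl | rfl
      · exact hxyz.2.1 rfl
      · exact hxyz.2.2 rfl
    have hs : s = true := by
      cases s
      · obtain ⟨rfl, rfl⟩ := hd1'.rev.unique hd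
        by_cases h0 : l1 = []
        · subst h0
          exact absurd (hinj t1.nil_inv.1) hxyz.2.1
        · obtain ⟨f, h1, h2⟩ := t1.right_mem_att h0
          exact absurd h2 (hxn f (by simp [h1]))
      · rfl
    subst hs
    obtain ⟨rfl, rfl⟩ := hd1'.unique hd
    obtain rfl : l2 = [] := by
      by_contra h0
      obtain ⟨f, h1, h2⟩ := t3.left_mem_att h0
      exact hxn f (by simp [h1]) h2
    obtain ⟨-, rfl⟩ := t3.nil_inv
    obtain ⟨l', rfl⟩ := exists_map_copy (l := l1) fun f h => hl f (by simpa using h)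
    refine ⟨l', ?_, rfl⟩
    have hl' : l' ≠ [] := by
      rintro rfl
      exact hxyz.1 (hinj t1.nil_inv.1)
    have hinn : (S.inner K d).Injective := inner_injective hf (by
      have : S.att d = [x, y] := g1
      rw [this]; simpa using hxyz.1)
    obtain ⟨p, q, ws, hp, hq, hpq, rfl⟩ := t1.lift hl' (fun _ _ => rfl) fun _ _ h _ => hinn h
    obtain ⟨a, b, hab⟩ := List.length_eq_two.1 ((hf d).2.trans g1.length)
    obtain ⟨ha, hb⟩ := inner_pair hab g1
    obtain rfl := hinn (hp.trans ha.symm)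
    obtain rfl := hinn (hq.trans hb.symm)
    refine Trav.of_lift hK hl' (enum_of_map_copy (by simpa using hn.2) (by simpa using hmem'))
      hab hpq ?_
    have h3 : ((ws ++ [q]).map (S.inner K d)).Nodup := by
      rw [List.map_append, List.map_singleton, hq]
      exact (List.nodup_append.1 hv.1).1
    exact h3.of_map _

/-- If fusing the external nodes of `K d` yields a cycle, then `K d` is a path. -/
theorem Trav.cut_loop {d : S.E} (hS : S.Trav true [(d, true)]) (hf : S.Fits K)
    (hK : (K d).shape.NoIsolated) {l : List ((S.replace K).shape.E × Bool)}
    (h : (S.replace K).shape.Trav true l) :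
    ∃ l' s, (K d).shape.Trav false l' ∧
      l ~r orient s (l'.map fun f => (S.copy K d f.1, f.2)) := by
  obtain ⟨x, vs, x', hs, hx, rfl, -⟩ := hS.trail
  obtain ⟨hd, rfl⟩ := hs.singleton_inv
  have hd' : S.att d = [x', x'] := hd
  obtain ⟨l1, ws, hr, h1, ht, hv⟩ := h.exists_trail_from (S.outer K x')
  obtain ⟨l', rfl⟩ := exists_map_copy (d := d) (l := l1) fun f _ => by
    obtain ⟨e, f', he⟩ := exists_copy f.1
    obtain rfl : e = d := by simpa using hS.edges.2 e
    exact ⟨f', he⟩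
  have hl' : l' ≠ [] := by simpa using h1.ne
  have he : Enum (l'.map Prod.fst) := enum_of_map_copy h1.edges.1 fun f => h1.edges.2 _
  obtain ⟨ws', rfl⟩ := ht.eq_cons h1.ne
  have hx' : S.outer K x' ∉ ws' := (List.nodup_cons.1 hv.1).1
  have hin : ∀ w, S.inner K d w ≠ S.outer K x' → w ∉ (K d).shape.ext := by
    intro w hw hm
    obtain ⟨y, hy, h⟩ := exists_outer_of_mem_ext hf hm
    rw [hd'] at hy
    obtain rfl : y = x' := by simpa using hy
    exact hw h
  obtain ⟨p, q, ws, hp, hq, hpq, hws⟩ := ht.lift hl' (fun _ _ => rfl) fun a b hab ha => by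
    have hne : S.inner K d a ≠ S.outer K x' := by
      rintro h; exact hx' (h ▸ ha)
    simpa using inner_eq_inner hf (hin a hne) hab
  obtain ⟨a, b, hab⟩ := List.length_eq_two.1 ((hf d).2.trans hd.length)
  obtain ⟨ha, hb⟩ := inner_pair hab hd'
  have hne : a ≠ b := by
    have := (hf d).1
    rw [hab] at this; simpa using this
  have hext : ∀ w, S.inner K d w = S.outer K x' → w = a ∨ w = b := by
    intro w hw
    have : w ∈ (K d).shape.ext := by
      by_contra h
      exact inner_ne_outer hf h _ hw
    rw [hab] at this; simpa using this
  obtain ⟨int, rfl⟩ := hpq.eq_cons hl'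
  have hws' : int.map (S.inner K d) = ws' := (List.cons.inj hws).2
  have hnod : (p :: int).Nodup := by
    have h3 : ((p :: int).map (S.inner K d)).Nodup := hws ▸ hv.1
    exact h3.of_map _
  have hint : ∀ w, S.inner K d w = S.outer K x' → w ∉ int := by
    intro w hw hm
    exact hx' (hws' ▸ hw ▸ List.mem_map_of_mem hm)
  -- A closed trail at one external node would miss the other one.
  have hpq' : p ≠ q := by
    rintro rfl
    have : ∀ w, S.inner K d w = S.outer K x' → w = p := by
      intro w hw
      obtain ⟨f, hf'⟩ := hK w
      obtain ⟨g, hg, rfl⟩ := List.mem_map.1 (he.2 f)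
      obtain ⟨u, v, h2, h3, h4⟩ := hpq.dart_of_mem hg
      have h5 := hint w hw
      rcases h2.eq_or_of_mem hf' with rfl | rfl
      · simpa [h5] using h3
      · simpa [h5] using h4
    exact hne ((this a ha).trans (this b hb).symm)
  have hnod' : ((p :: int) ++ [q]).Nodup := by
    rw [List.nodup_append]
    refine ⟨hnod, by simp, ?_⟩
    simp only [List.mem_cons, List.not_mem_nil, or_false]
    rintro u hu v rfl rfl
    rcases hu with h | h
    · exact hpq' h.symm
    · exact hint u hq h
  rcases hext p hp with rfl | rfl <;> rcases hext q hq with rfl | rfl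
  · exact absurd rfl hpq'
  · exact ⟨l', true, Trav.of_lift hK hl' he hab hpq hnod', hr⟩
  · obtain ⟨us, h2, h3⟩ := hpq.rev
    refine ⟨inv l', false, Trav.of_lift hK (by simpa using hl') ?_ hab h2 ?_, ?_⟩
    · rw [map_fst_inv]; exact he.perm (List.reverse_perm _).symm
    · rw [h3, List.nodup_reverse]; exact hnod'
    · rw [orient_map, orient_false, inv_inv]; exact hr
  · exact absurd rfl hpq'

end Shape

/-! ### Signed words in the string calculus -/

section Strings
variable {P : Type u}

/-- A hyperedge labelled `A` that is passed backwards is read as `Aᴿ`. -/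
def sgn (a : BType P × Bool) : BType P := bif a.2 then a.1 else .rev a.1

theorem LBrac.ne_nil {Γ : List (BType P)} {B : BType P} (h : LBrac Γ B) : Γ ≠ [] := by
  induction h <;> simp_all

theorem LBrac.cut' {Γ X Δ : List (BType P)} {A B : BType P} (h : LBrac X A)
    (h' : LBrac (Γ ++ A :: Δ) B) : LBrac (Γ ++ X ++ Δ) B :=
  .cut Γ X Δ A B h.ne_nil h (by simpa using h')

theorem LBrac.trans {X : List (BType P)} {A B : BType P} (h : LBrac X A) (h' : LBrac [A] B) :
    LBrac X B := by
  simpa using LBrac.cut' (Γ := []) (Δ := []) h h'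

theorem LBrac.to_rev_rev (A : BType P) : LBrac [A] (.rev (.rev A)) :=
  .rev_right [A] A (by simp) (.ax A)

theorem LBrac.of_rev_rev (A : BType P) : LBrac [.rev (.rev A)] A := by
  simpa using LBrac.rev_left [] [] A A (by simpa using LBrac.ax A)

theorem LBrac.mono {Γ Δ : List (BType P)} (h : List.Forall₂ (fun A B => LBrac [A] B) Γ Δ) :
    ∀ {Λ : List (BType P)} {C : BType P}, LBrac (Λ ++ Δ) C → LBrac (Λ ++ Γ) C := by
  induction h with
  | nil => exact fun h => h
  | @cons A B Γ Δ h _ ih =>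
    intro Λ C hC
    have h1 : LBrac ((Λ ++ [A]) ++ Δ) C := h.cut' hC
    simpa using ih h1

theorem LBrac.inv {w : List (BType P × Bool)} {B : BType P} (h : LBrac (w.map sgn) B) :
    LBrac ((inv w).map sgn) (.rev B) := by
  refine LBrac.mono (Λ := []) (Δ := ((w.map sgn).map BType.rev).reverse) ?_
    (LBrac.rev_rev _ B h.ne_nil h)
  rw [HypergraphLambek.inv, List.map_reverse, List.map_map, List.map_map, List.forall₂_reverse_iff,
    List.forall₂_map_left_iff, List.forall₂_map_right_iff, List.forall₂_same]
  rintro ⟨A, _ | _⟩ -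
  · exact .to_rev_rev A
  · exact .ax _

theorem LBrac.orient {w : List (BType P × Bool)} {B : BType P} (h : LBrac (w.map sgn) B)
    (s : Bool) : LBrac ((orient s w).map sgn) (sgn (B, s)) := by
  cases s
  · exact h.inv
  · exact h

theorem LBrac.subst {v w w' : List (BType P × Bool)} {A B : BType P} {s : Bool}
    (h : LBrac (v.map sgn) A) (h' : LBrac ((w ++ (A, s) :: w').map sgn) B) :
    LBrac ((w ++ HypergraphLambek.orient s v ++ w').map sgn) B := by
  simp only [List.map_append, List.map_cons] at h' ⊢
  exact (h.orient s).cut' h'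

/-- `(A · B)ᴿ → Bᴿ · Aᴿ` -/
theorem LBrac.rev_mul (A B : BType P) : LBrac [.rev (.mul A B)] (.mul (.rev B) (.rev A)) := by
  have h1 : LBrac [.rev B, .rev A] (.mul (.rev B) (.rev A)) :=
    .mul_right [_] [_] _ _ (by simp) (by simp) (.ax _) (.ax _)
  have h2 : LBrac [A, B] (.rev (.mul (.rev B) (.rev A))) := by
    have h := LBrac.inv (w := [(B, false), (A, false)]) h1
    exact h
  have h3 : LBrac [.mul A B] (.rev (.mul (.rev B) (.rev A))) := by
    simpa using LBrac.mul_left [] [] A B _ (by simpa using h2)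
  have h4 := LBrac.rev_rev [.mul A B] _ (by simp) h3
  exact LBrac.trans (by simpa using h4) (.of_rev_rev _)

theorem LBrac.of_mul {w w' : List (BType P × Bool)} {A B C : BType P} {s : Bool}
    (h : LBrac ((w ++ HypergraphLambek.orient s [(A, true), (B, true)] ++ w').map sgn) C) :
    LBrac ((w ++ (.mul A B, s) :: w').map sgn) C := by
  cases s
  · have h1 := LBrac.mul_left (w.map sgn) (w'.map sgn) (.rev B) (.rev A) C (by
      simpa [HypergraphLambek.inv, sgn] using h)
    have := LBrac.cut' (LBrac.rev_mul A B) (by simpa using h1)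
    simpa [sgn] using this
  · have h1 := LBrac.mul_left (w.map sgn) (w'.map sgn) A B C (by simpa [sgn] using h)
    simpa [sgn] using h1

theorem LBrac.of_rev {w w' : List (BType P × Bool)} {A C : BType P} {s : Bool}
    (h : LBrac ((w ++ HypergraphLambek.orient s [(A, false)] ++ w').map sgn) C) :
    LBrac ((w ++ (.rev A, s) :: w').map sgn) C := by
  cases s
  · have h1 := LBrac.rev_left (w.map sgn) (w'.map sgn) A C (by simpa [sgn] using h)
    simpa [sgn] using h1
  · simpa [sgn] using h

theorem LBrac.rotate {Γ Δ : List (BType P)} {A : BType P} (h : LBrac (Γ ++ Δ) (.brac A)) :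
    LBrac (Δ ++ Γ) (.brac A) := by
  by_cases hΓ : Γ = []
  · simpa [hΓ] using h
  by_cases hΔ : Δ = []
  · simpa [hΔ] using h
  exact .brac_shift Γ Δ A hΓ hΔ h

theorem LBrac.of_isRotated {Γ Δ : List (BType P)} {A : BType P} (h : LBrac Γ (.brac A))
    (hr : Γ ~r Δ) : LBrac Δ (.brac A) := by
  obtain ⟨n, hn, rfl⟩ := List.isRotated_iff_mod.1 hr
  rw [List.rotate_eq_drop_append_take hn]
  apply LBrac.rotate
  simpa using h

theorem LBrac.brac_inv {w : List (BType P × Bool)} {A : BType P}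
    (h : LBrac (w.map sgn) (.brac A)) : LBrac ((HypergraphLambek.inv w).map sgn) (.brac A) :=
  (h.inv.trans (.ax_rev_brac _)).trans (.brac_left A _ (.ax _))

end Strings

/-! ### Types up to isomorphism -/

section Types
variable {Pr : Type u}

/-- The inverse of an isomorphism. -/
def Shape.Iso.symm {S T : Shape} (i : S.Iso T) : T.Iso S where
  node := i.node.symm
  edge := i.edge.symm
  att_edge e := by
    obtain ⟨e, rfl⟩ := i.edge.surjective e
    simp [i.att_edge]
  ext_eq := by simp [i.ext_eq]

/-- The composition of isomorphisms. -/
def Shape.Iso.trans {S T U : Shape} (i : S.Iso T) (j : T.Iso U) : S.Iso U where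
  node := i.node.trans j.node
  edge := i.edge.trans j.edge
  att_edge e := by simp [i.att_edge, j.att_edge]
  ext_eq := by simp [i.ext_eq, j.ext_eq]

theorem HType.Same.refl (A : HType Pr) : A.Same A := by
  induction A with
  | prim p => exact .prim p
  | div N S d lab ihN ih =>
    refine .div ⟨Equiv.refl _, Equiv.refl _, by simp, by simp⟩ rfl ihN fun e e' h => ?_
    obtain rfl : e = e' := Subtype.ext h
    exact ih e
  | times S lab ih => exact .times ⟨Equiv.refl _, Equiv.refl _, by simp, by simp⟩ ih

theorem HType.Same.trans {A B C : HType Pr} (h : A.Same B) (h' : B.Same C) : A.Same C := by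
  induction h generalizing C with
  | prim p => exact h'
  | @div N N' S S' d d' lab lab' i hd hN hl ihN ih =>
    cases h' with
    | div j hd' hN' hl' =>
      refine .div (i.trans j) (by rw [← hd', ← hd]; rfl) (ihN hN') fun e e'' h => ?_
      have hne : i.edge e.1 ≠ d' := by
        rw [← hd]; exact fun h => e.2 (i.edge.injective h)
      exact ih e ⟨_, hne⟩ rfl (hl' ⟨_, hne⟩ e'' h)
  | @times S S' lab lab' i hl ih =>
    cases h' with
    | times j hl' => exact .times (i.trans j) fun e => ih e (hl' _)

variable {rk : Pr → ℕ}

/-- The type `×(Loop(A))` of rank `0`. -/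
def loopType (A : HType Pr) : HType Pr := .times loopShape fun _ => A

theorem same_prim_tr {p : Pr} {C : BType {p : Pr // rk p = 2}}
    (h : (HType.prim p).Same (tr C)) : ∃ hp, C = .prim ⟨p, hp⟩ := by
  cases C with
  | prim q =>
    obtain ⟨q, hq⟩ := q
    cases h
    exact ⟨hq, rfl⟩
  | _ => cases h

theorem not_same_prim_loopType {p : Pr} {A : HType Pr} : ¬ (HType.prim p).Same (loopType A) :=
  fun h => by cases h

theorem not_same_div_loopType {N : HType Pr} {S : Shape} {d : S.E}
    {lab : {e : S.E // e ≠ d} → HType Pr} {A : HType Pr} :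
    ¬ (HType.div N S d lab).Same (loopType A) := fun h => by cases h

theorem same_times_loopType {S : Shape} {lab : S.E → HType Pr} {A : HType Pr}
    (h : (HType.times S lab).Same (loopType A)) :
    ∃ d, S.Trav true [(d, true)] ∧ (lab d).Same A := by
  cases h with
  | times i hl =>
    exact ⟨i.edge.symm (), loop_trav.iso i.symm, hl _⟩

theorem same_times_tr {S : Shape} {lab : S.E → HType Pr} {C : BType {p : Pr // rk p = 2}}
    (h : (HType.times S lab).Same (tr C)) :
    (∃ A B d d', C = .mul A B ∧ S.Trav false [(d, true), (d', true)] ∧ (lab d).Same (tr A) ∧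
      (lab d').Same (tr B)) ∨
    ∃ A d, C = .rev A ∧ S.Trav false [(d, false)] ∧ (lab d).Same (tr A) := by
  cases C with
  | mul A B =>
    cases h with
    | times i hl =>
      have h2 : ∀ j : Fin 2, (lab (i.edge.symm j)).Same (![tr A, tr B] j) := fun j =>
        (congrArg (fun k : Fin 2 => (lab (i.edge.symm j)).Same (![tr A, tr B] k))
          (i.edge.apply_symm_apply j)).mp (hl (i.edge.symm j))
      exact .inl ⟨A, B, i.edge.symm (0 : Fin 2), i.edge.symm (1 : Fin 2), rfl,
        string2_trav.iso i.symm, h2 0, h2 1⟩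
  | rev A =>
    cases h with
    | times i hl => exact .inr ⟨A, i.edge.symm (), rfl, flip_trav.iso i.symm, hl _⟩
  | _ => cases h

/-- In the cases of `A / B` and `B \ A`, which differ in the flag `r`, the distinguished hyperedge
forms a path with one other hyperedge. -/
theorem same_div_tr {N : HType Pr} {S : Shape} {d : S.E} {lab : {e : S.E // e ≠ d} → HType Pr}
    {C : BType {p : Pr // rk p = 2}} (h : (HType.div N S d lab).Same (tr C)) :
    (∃ (r : Bool) (A B : BType _) (d' : S.E), C = (bif r then .rdiv A B else .ldiv B A) ∧
      S.Trav false (bif r then [(d, true), (d', true)] else [(d', true), (d, true)]) ∧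
      N.Same (tr A) ∧ ∀ e, (lab e).Same (tr B)) ∨
    ∃ A, C = .brac A ∧ S.Trav true [(d, true)] ∧ N.Same (loopType (tr A)) := by
  cases C with
  | rdiv A B =>
    cases h with
    | div i hd hN hl =>
      refine .inl ⟨true, A, B, i.edge.symm (1 : Fin 2), rfl, ?_, hN, fun e => ?_⟩
      · have := string2_trav.iso i.symm
        rw [← hd] at this
        simpa [Shape.Iso.symm] using this
      · exact hl e ⟨i.edge e.1, fun h => e.2 (i.edge.injective (h.trans hd.symm))⟩ rfl
  | ldiv B A =>
    cases h with
    | div i hd hN hl =>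
      refine .inl ⟨false, A, B, i.edge.symm (0 : Fin 2), rfl, ?_, hN, fun e => ?_⟩
      · have := string2_trav.iso i.symm
        rw [← hd] at this
        simpa [Shape.Iso.symm] using this
      · exact hl e ⟨i.edge e.1, fun h => e.2 (i.edge.injective (h.trans hd.symm))⟩ rfl
  | brac A =>
    cases h with
    | div i hd hN hl =>
      refine .inr ⟨A, rfl, ?_, hN⟩
      have := loop_trav.iso i.symm
      rw [← hd] at this
      simpa [Shape.Iso.symm] using this
  | _ => cases h

theorem not_same_tr_and_loopType {T A : HType Pr} {C : BType {p : Pr // rk p = 2}}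
    (h : T.Same (tr C)) (h' : T.Same (loopType A)) : False := by
  cases T with
  | prim => exact not_same_prim_loopType h'
  | div => exact not_same_div_loopType h'
  | times S lab =>
    obtain ⟨d, hd, -⟩ := same_times_loopType h'
    have h0 := hd.rank
    rcases same_times_tr h with ⟨A, B, d, d', -, h1, -⟩ | ⟨A, d, -, h1, -⟩ <;>
    · have h2 := h1.rank
      simp [h0] at h2

theorem same_unique_aux (T : HType Pr) : ∀ C C' : BType {p : Pr // rk p = 2},
    (T.Same (tr C) → T.Same (tr C') → C = C') ∧
    (T.Same (loopType (tr C)) → T.Same (loopType (tr C')) → C = C') := by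
  induction T with
  | prim p =>
    refine fun C C' => ⟨fun h h' => ?_, fun h => absurd h not_same_prim_loopType⟩
    obtain ⟨_, rfl⟩ := same_prim_tr h
    obtain ⟨_, rfl⟩ := same_prim_tr h'
    rfl
  | times S lab ih =>
    refine fun C C' => ⟨fun h h' => ?_, fun h h' => ?_⟩
    · rcases same_times_tr h with ⟨A, B, d, d', rfl, h1, h2, h3⟩ | ⟨A, d, rfl, h1, h2⟩ <;>
      rcases same_times_tr h' with ⟨A', B', e, e', rfl, g1, g2, g3⟩ | ⟨A', e, rfl, g1, g2⟩ <;>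
      have hu := h1.unique g1 <;> simp at hu
      · obtain ⟨rfl, rfl⟩ := hu
        rw [(ih _ _ _).1 h2 g2, (ih _ _ _).1 h3 g3]
      · obtain rfl := hu
        rw [(ih _ _ _).1 h2 g2]
    · obtain ⟨d, h1, h2⟩ := same_times_loopType h
      obtain ⟨e, -, g2⟩ := same_times_loopType h'
      obtain rfl : e = d := by simpa using h1.edges.2 e
      exact (ih _ _ _).1 h2 g2
  | div N S d lab ihN ih =>
    refine fun C C' => ⟨fun h h' => ?_, fun h => absurd h not_same_div_loopType⟩
    rcases same_div_tr h with ⟨r, A, B, d', rfl, h1, h2, h3⟩ | ⟨A, rfl, h1, h2⟩ <;>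
    rcases same_div_tr h' with ⟨r', A', B', e', rfl, g1, g2, g3⟩ | ⟨A', rfl, g1, g2⟩
    · have hne : d' ≠ d := by
        have := h1.edges.1
        cases r
        · simpa using this
        · simpa [eq_comm] using this
      have hr : r = r' := by
        have hu := h1.unique g1
        cases r <;> cases r' <;> simp at hu ⊢
        · exact hne hu.1
        · exact hne hu.2
      subst hr
      rw [(ihN _ _).1 h2 g2, (ih ⟨d', hne⟩ _ _).1 (h3 _) (g3 _)]
    · simpa [h1.rank] using g1.rank
    · simpa [h1.rank] using g1.rank
    · rw [(ihN _ _).2 h2 g2]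

/-- A type is the translation of at most one type of the string calculus. -/
theorem same_tr_unique {T : HType Pr} {C C' : BType {p : Pr // rk p = 2}} (h : T.Same (tr C))
    (h' : T.Same (tr C')) : C = C' :=
  (same_unique_aux T C C').1 h h'

theorem same_loopType_unique {T : HType Pr} {C C' : BType {p : Pr // rk p = 2}}
    (h : T.Same (loopType (tr C))) (h' : T.Same (loopType (tr C'))) : C = C' :=
  (same_unique_aux T C C').2 h h'

end Types

/-! ### Replacing one hyperedge -/

namespace Shape
variable {L : Type u} {S : Shape} {d : S.E} {F : HGraph L} {K : {e : S.E // e ≠ d} → HGraph L}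

theorem assign_self : S.assign d F K d = F := by simp [assign]

theorem assign_of_ne {e : S.E} (h : e ≠ d) : S.assign d F K e = K ⟨e, h⟩ := by simp [assign, h]

theorem assign_forall {p : S.E → HGraph L → Prop} (hd : p d F) (h : ∀ e, p e.1 (K e)) (e : S.E) :
    p e (S.assign d F K e) := by
  by_cases he : e = d
  · subst he; rwa [assign_self]
  · rw [assign_of_ne he]; exact h ⟨e, he⟩

/-- A shape without nodes and with `e` as its only hyperedge. -/
def IsPoint (S : Shape) (e : S.E) : Prop := IsEmpty S.V ∧ ∀ e', e' = e

theorem IsPoint.reads_replace {S : Shape} {e : S.E} (hS : S.IsPoint e) {K : S.E → HGraph L}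
    {w : List (L × Bool)} (h : (K e).Reads true w) : (S.replace K).Reads true w := by
  obtain ⟨l, hl, rfl⟩ := h
  have hS1 := hS.1
  have nil : ∀ t : List S.V, t = [] := fun t => by
    cases t with
    | nil => rfl
    | cons v => exact hS1.elim v
  have hx : (K e).shape.ext = [] := List.length_eq_zero_iff.1 hl.rank
  have hf : S.Fits K := fun e' => by
    rw [hS.2 e', hx, nil (S.att e)]; simp
  refine ⟨l.map fun f => (S.copy K e f.1, f.2), hl.map (T := (S.replace K).shape)
    (g := S.inner K e) ⟨?_, ?_⟩ ⟨copy_injective e, ?_⟩ (fun _ => rfl) ?_, ?_⟩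
  · exact inner_injective hf (by rw [nil (S.att e)]; exact List.nodup_nil)
  · intro v
    rcases node_cases hf v with ⟨x, -⟩ | ⟨e', w, -, rfl⟩
    · exact hS1.elim x
    · obtain rfl := hS.2 e'
      exact ⟨w, rfl⟩
  · intro f
    obtain ⟨e', f', rfl⟩ := exists_copy f
    obtain rfl := hS.2 e'
    exact ⟨f', rfl⟩
  · rw [ext_replace, hx, nil S.ext]; rfl
  · rw [List.map_map]; rfl

theorem IsPoint.isEmpty_of_replace {S : Shape} {K : S.E → HGraph L}
    {f : (S.replace K).shape.E} (h : (S.replace K).shape.IsPoint f) :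
    IsEmpty S.V ∧ ∀ e, IsEmpty (K e).shape.V :=
  ⟨⟨fun v => h.1.elim (S.outer K v)⟩, fun e => ⟨fun v => h.1.elim (S.inner K e v)⟩⟩

theorem Trav.nonempty {c : Bool} {l : List (S.E × Bool)} (h : S.Trav c l) : Nonempty S.V := by
  obtain ⟨x, -⟩ := h.trail
  exact ⟨x⟩

/-- If a path or a cycle contains a loop, then there is nothing else. -/
theorem Trav.contract_loop {S : Shape} {K : S.E → HGraph L} (hf : S.Fits K)
    (hne : ∀ e, Nonempty (K e).shape.E) {e : S.E} {f : (K e).shape.E}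
    (hK : (K e).shape.Trav true [(f, true)]) {c : Bool} {l : List ((S.replace K).shape.E × Bool)}
    (h : (S.replace K).shape.Trav c l) :
    c = true ∧ S.IsPoint e ∧ ∃ s, l = [(S.copy K e f, s)] := by
  obtain ⟨m, vs, m', t, hx, rfl, -⟩ := hK.trail
  obtain ⟨hd, rfl⟩ := t.singleton_inv
  have hm : m' ∉ (K e).shape.ext := by rw [hx]; simp
  have hd1 : (S.replace K).shape.Dart (S.copy K e f, true) (S.inner K e m') (S.inner K e m') :=
    Dart.map (T := (S.replace K).shape) hd _ (S.copy K e) rfl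
  obtain ⟨s, hs⟩ := h.exists_mem (S.copy K e f)
  have hd2 : (S.replace K).shape.Dart (S.copy K e f, s) (S.inner K e m') (S.inner K e m') := by
    cases s
    · exact hd1.rev
    · exact hd1
  obtain ⟨l1, l2, rfl⟩ := List.append_of_mem hs
  obtain ⟨X, vs, Y, t, hE⟩ := h.trail
  obtain ⟨P, v1, v2, rfl, t1, t2⟩ := t.append_inv
  obtain ⟨Q, v3, rfl, hd3, t3⟩ := t2.cons_inv
  obtain ⟨rfl, rfl⟩ := hd2.unique hd3
  have hn := (List.nodup_append.1 hE.nodup)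
  obtain rfl : l2 = [] := by
    by_contra h0
    obtain ⟨ws, rfl⟩ := t3.eq_cons h0
    simp at hn
  obtain ⟨rfl, rfl⟩ := t3.nil_inv
  cases c
  · have := hE.2.1
    simp [List.nodup_append] at this
  · obtain rfl := hE.2.1
    obtain rfl : l1 = [] := by
      by_contra h0
      obtain ⟨ws, rfl⟩ := t1.eq_cons h0
      simp at hn
    obtain ⟨-, rfl⟩ := t1.nil_inv
    refine ⟨rfl, ⟨⟨fun v => ?_⟩, fun e' => ?_⟩, s, rfl⟩
    · have := hE.2.2.2 (S.outer K v)
      exact inner_ne_outer hf hm v (List.mem_singleton.1 this).symm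
    · obtain ⟨f'⟩ := hne e'
      have := h.edges.2 (S.copy K e' f')
      exact copy_fst (by simpa using this)

end Shape

section ReplaceAt
variable {Pr : Type u} {rk : Pr → ℕ} {G F : HGraph (HType Pr)} {c : Bool}

/-- The word read along the darts `l`. -/
abbrev HGraph.word {L : Type u} (G : HGraph L) (l : List (G.shape.E × Bool)) : List (L × Bool) :=
  l.map fun d => (G.lab d.1, d.2)

/-- The ranks of the labels are the numbers of attachment nodes. -/
def HGraph.Ranked (rk : Pr → ℕ) (G : HGraph (HType Pr)) : Prop :=
  ∀ e, (G.lab e).rank rk = (G.shape.att e).length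

theorem handle_att (A : HType Pr) (e : (handle rk A).shape.E) :
    ((handle rk A).shape.att e).length = A.rank rk := List.length_finRange

theorem handle_ext (A : HType Pr) :
    (handle rk A).shape.ext.Nodup ∧ (handle rk A).shape.ext.length = A.rank rk :=
  ⟨List.nodup_finRange _, List.length_finRange⟩

open Classical in
theorem flatMap_orient_update {l1 l2 : List (G.shape.E × Bool)} {e : G.shape.E} {s : Bool}
    (hn : ((l1 ++ (e, s) :: l2).map Prod.fst).Nodup) (v : List (HType Pr × Bool)) :
    (l1 ++ (e, s) :: l2).flatMap (fun d => orient d.2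
      (if d.1 = e then v else [(G.lab d.1, true)])) = G.word l1 ++ orient s v ++ G.word l2 := by
  have key : ∀ l : List (G.shape.E × Bool), e ∉ l.map Prod.fst → l.flatMap (fun d => orient d.2
      (if d.1 = e then v else [(G.lab d.1, true)])) = G.word l := by
    intro l hl
    rw [HGraph.word, List.map_eq_flatMap]
    refine List.flatMap_congr fun d hd => ?_
    rw [if_neg, orient_singleton]
    rintro rfl
    exact hl (List.mem_map_of_mem hd)
  rw [List.map_append, List.map_cons, List.nodup_middle, List.nodup_cons] at hn
  simp only [List.mem_append, not_or] at hn
  rw [List.flatMap_append, List.flatMap_cons, key l1 hn.1.1, key l2 hn.1.2]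
  simp

open Classical in
theorem reads_assign_handle (hG : ∀ e, (G.lab e).rank rk = 2) {e : G.shape.E}
    {v : List (HType Pr × Bool)} (hF : F.Reads false v) (e' : G.shape.E) :
    (G.shape.assign e F (fun e' => handle rk (G.lab e'.1)) e').Reads false
      (if e' = e then v else [(G.lab e', true)]) := by
  refine Shape.assign_forall (p := fun e' H => H.Reads false
    (if e' = e then v else [(G.lab e', true)])) (by simpa using hF) (fun e' => ?_) e'
  rw [if_neg e'.2]
  exact handle_reads (hG _)

/-- Replacing a hyperedge of a path or a cycle by a path. -/
theorem reads_replaceAt (hG : G.Ranked rk) {l1 l2 : List (G.shape.E × Bool)} {e : G.shape.E}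
    {s : Bool} (h : G.shape.Trav c (l1 ++ (e, s) :: l2)) {v : List (HType Pr × Bool)}
    (hF : F.Reads false v) :
    (G.replaceAt rk e F).Reads c (G.word l1 ++ orient s v ++ G.word l2) := by
  classical
  rw [← flatMap_orient_update h.edges.1]
  exact h.reads_replace (reads_assign_handle (fun e => (hG e).trans (h.length_att e)) hF)

/-- Contracting a path of one or two hyperedges in a path or a cycle. -/
theorem trav_of_reads_replaceAt (hG : G.Ranked rk) {e : G.shape.E}
    (he : (G.shape.att e).length = 2) {v : List (HType Pr × Bool)} (hF : F.Reads false v)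
    (hv : (∃ a, v = [a]) ∨ ∃ a b, v = [a, b]) {w : List (HType Pr × Bool)}
    (h : (G.replaceAt rk e F).Reads c w) :
    ∃ l1 s l2, G.shape.Trav c (l1 ++ (e, s) :: l2) ∧
      (w = G.word l1 ++ orient s v ++ G.word l2 ∨
        c = true ∧ w ~r G.word l1 ++ orient s v ++ G.word l2) := by
  classical
  obtain ⟨l, hl, rfl⟩ := h
  have hS : ∀ e', (G.shape.att e').length = 2 := by
    intro e'
    have : ∃ f, ((G.shape.assign e F (fun e' => handle rk (G.lab e'.1)) e').shape.att f).length =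
        (G.shape.att e').length := by
      refine Shape.assign_forall (p := fun e' H => ∃ f, (H.shape.att f).length =
        (G.shape.att e').length) ?_ (fun e' => ⟨(), ?_⟩) e'
      · obtain ⟨l, hl, rfl⟩ := hF
        obtain ⟨f, -⟩ := List.exists_mem_of_ne_nil _ hl.ne
        exact ⟨f.1, by rw [hl.length_att, he]⟩
      · exact (handle_att _ _).trans (hG e'.1)
    obtain ⟨f, hf⟩ := this
    have h2 := hl.length_att (Shape.copy _ _ e' f)
    exact hf.symm.trans (Eq.trans (Eq.symm (List.length_map _)) h2)
  choose le hle hW using reads_assign_handle (F := F) (e := e)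
    (fun e => (hG e).trans (hS e)) hF
  have h2 : ∀ e', (∃ f, le e' = [f]) ∨ ∃ f g, le e' = [f, g] := by
    intro e'
    have : (le e').length = 1 ∨ (le e').length = 2 := by
      have h3 := congrArg List.length (hW e')
      rw [List.length_map] at h3
      rw [h3]
      split
      · rcases hv with ⟨a, rfl⟩ | ⟨a, b, rfl⟩ <;> simp
      · simp
    rcases this with h | h
    · exact .inl (List.length_eq_one_iff.1 h)
    · exact .inr (List.length_eq_two.1 h)
  obtain ⟨l', hl', hw⟩ := Shape.Trav.contract hl hle hS h2
  obtain ⟨s, hs⟩ := hl'.exists_mem e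
  obtain ⟨l1, l2, rfl⟩ := List.append_of_mem hs
  refine ⟨l1, s, l2, hl', ?_⟩
  have key : (G.shape.replace (G.shape.assign e F fun e' => handle rk (G.lab e'.1))).word
      ((l1 ++ (e, s) :: l2).flatMap (Shape.through _ le)) =
      G.word l1 ++ orient s v ++ G.word l2 := by
    rw [← flatMap_orient_update hl'.edges.1, HGraph.word, List.map_flatMap]
    refine List.flatMap_congr fun d _ => ?_
    rw [← hW]
    exact map_lab_through le d
  rw [← key]
  rcases hw with hw | ⟨hc, hw⟩
  · exact .inl (congrArg _ hw)
  · exact .inr ⟨hc, hw.map _⟩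

theorem fits_assign {S : Shape} {d : S.E} {K : {e : S.E // e ≠ d} → HGraph (HType Pr)}
    (hF : F.shape.ext.Nodup ∧ F.shape.ext.length = (S.att d).length)
    (hK : ∀ e, (K e).shape.ext.Nodup ∧ (K e).shape.ext.length = (S.att e.1).length) :
    S.Fits (S.assign d F K) :=
  Shape.assign_forall (p := fun e H => H.shape.ext.Nodup ∧ H.shape.ext.length = (S.att e).length)
    hF hK

theorem reads_cut_end {S : Shape} {d d' : S.E} {r : Bool}
    (hS : S.Trav false (bif r then [(d, true), (d', true)] else [(d', true), (d, true)]))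
    (hF : F.shape.ext.Nodup) (hF' : F.shape.ext.length = 2) (hI : F.shape.NoIsolated)
    {lab : {e : S.E // e ≠ d} → HType Pr} (hlab : ∀ e, (lab e).rank rk = 2) (hd : d' ≠ d)
    {w : List (HType Pr × Bool)}
    (h : (S.replace (S.assign d F fun e => handle rk (lab e))).Reads false w) :
    ∃ v, F.Reads false v ∧ w = bif r then v ++ [(lab ⟨d', hd⟩, true)]
      else (lab ⟨d', hd⟩, true) :: v := by
  obtain ⟨l, hl, rfl⟩ := h
  have hf : S.Fits (S.assign d F fun e => handle rk (lab e)) := by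
    refine fits_assign ⟨hF, by rw [hF', hS.length_att]⟩ fun e => ?_
    rw [hS.length_att, ← hlab e]
    exact handle_ext _
  obtain ⟨l1, h1, h2⟩ : (S.assign d F (fun e => handle rk (lab e)) d').Reads false
      [(lab ⟨d', hd⟩, true)] := by
    rw [Shape.assign_of_ne hd]; exact handle_reads (hlab _)
  obtain ⟨⟨f0, s⟩, rfl, h3⟩ := List.map_eq_singleton_iff.1 h2
  obtain ⟨h4, rfl⟩ := Prod.mk.inj h3
  obtain ⟨l', h5, rfl⟩ := hS.cut_end hf (by rwa [Shape.assign_self]) h1 hl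
  obtain ⟨v, h6, hv⟩ : ∃ v, (S.assign d F (fun e => handle rk (lab e)) d).Reads false v ∧
      v = HGraph.word _ l' := ⟨_, ⟨l', h5, rfl⟩, rfl⟩
  rw [Shape.assign_self] at h6
  refine ⟨v, h6, ?_⟩
  have e1 : (S.replace (S.assign d F fun e => handle rk (lab e))).word
      (l'.map fun f => (S.copy _ d f.1, f.2)) = HGraph.word _ l' := by
    rw [HGraph.word, List.map_map]; rfl
  have e2 : (S.replace (S.assign d F fun e => handle rk (lab e))).lab (S.copy _ d' f0) =
    lab ⟨d', hd⟩ := h4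
  cases r
  · simp only [cond_false, List.map_cons, e2, hv]
    exact congrArg _ e1
  · simp only [cond_true, List.map_append, List.map_singleton, e2, hv]
    exact congrArg (· ++ _) e1

theorem reads_cut_loop {S : Shape} {d : S.E} (hS : S.Trav true [(d, true)])
    (hF : F.shape.ext.Nodup) (hF' : F.shape.ext.length = 2) (hI : F.shape.NoIsolated)
    {K : {e : S.E // e ≠ d} → HGraph (HType Pr)} {w : List (HType Pr × Bool)}
    (h : (S.replace (S.assign d F K)).Reads true w) :
    ∃ v s, F.Reads false v ∧ w ~r orient s v := by
  obtain ⟨l, hl, rfl⟩ := h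
  have hf : S.Fits (S.assign d F K) := by
    refine fits_assign ⟨hF, by rw [hF', hS.length_att]⟩ fun e => ?_
    exact absurd (by simpa using hS.edges.2 e.1) e.2
  obtain ⟨l', s, h5, h6⟩ := hS.cut_loop hf (by rwa [Shape.assign_self]) hl
  obtain ⟨v, h7, hv⟩ : ∃ v, (S.assign d F K d).Reads false v ∧ v = HGraph.word _ l' :=
    ⟨_, ⟨l', h5, rfl⟩, rfl⟩
  rw [Shape.assign_self] at h7
  refine ⟨v, s, h7, ?_⟩
  rw [hv]
  have := h6.map fun f => ((S.replace (S.assign d F K)).lab f.1, f.2)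
  rw [← orient_map, List.map_map] at this
  exact this

end ReplaceAt

/-! ### From hypergraphs to strings -/

section Backward
variable {Pr : Type u} {rk : Pr → ℕ}

theorem HLDerivable.isSequent {Adm : Shape → Prop} {H : HGraph (HType Pr)} {A : HType Pr}
    (h : HLDerivable rk Adm H A) : IsSequent rk Adm H A := by
  cases h <;> assumption

/-- The signed word `w` of types is the translation of `u`, up to isomorphism. -/
def Codes (w : List (HType Pr × Bool)) (u : List (BType {p : Pr // rk p = 2} × Bool)) : Prop :=
  List.Forall₂ (fun a b => a.1.Same (tr b.1) ∧ a.2 = b.2) w u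

theorem Codes.unique {w : List (HType Pr × Bool)} {u u' : List (BType {p : Pr // rk p = 2} × Bool)}
    (h : Codes w u) (h' : Codes w u') : u = u' := by
  unfold Codes at h h'
  induction h generalizing u' with
  | nil => cases h'; rfl
  | cons hab _ ih =>
    cases h' with
    | cons hab' h' =>
      rw [ih h']
      congr 1
      exact Prod.ext (same_tr_unique hab.1 hab'.1) (hab.2.symm.trans hab'.2)

theorem Codes.append {w w' : List (HType Pr × Bool)}
    {u u' : List (BType {p : Pr // rk p = 2} × Bool)} (h : Codes w u) (h' : Codes w' u') :
    Codes (w ++ w') (u ++ u') :=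
  List.rel_append h h'

theorem Codes.cons {w : List (HType Pr × Bool)} {u : List (BType {p : Pr // rk p = 2} × Bool)}
    {A : HType Pr} {C : BType {p : Pr // rk p = 2}} (s : Bool) (hA : A.Same (tr C))
    (h : Codes w u) : Codes ((A, s) :: w) ((C, s) :: u) :=
  List.Forall₂.cons ⟨hA, rfl⟩ h

theorem Codes.singleton {A : HType Pr} {C : BType {p : Pr // rk p = 2}} (s : Bool)
    (hA : A.Same (tr C)) : Codes [(A, s)] [(C, s)] :=
  .cons s hA .nil

theorem Codes.append_inv {w w' : List (HType Pr × Bool)}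
    {u : List (BType {p : Pr // rk p = 2} × Bool)} (h : Codes (w ++ w') u) :
    ∃ v v', u = v ++ v' ∧ Codes w v ∧ Codes w' v' := by
  induction w generalizing u with
  | nil => exact ⟨[], u, rfl, .nil, h⟩
  | cons a w ih =>
    cases h with
    | cons hab h =>
      obtain ⟨v, v', rfl, h1, h2⟩ := ih h
      exact ⟨_ :: v, v', rfl, List.Forall₂.cons hab h1, h2⟩

theorem Codes.cons_inv {w : List (HType Pr × Bool)} {u : List (BType {p : Pr // rk p = 2} × Bool)}
    {A : HType Pr} {s : Bool} (h : Codes ((A, s) :: w) u) :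
    ∃ C v, u = (C, s) :: v ∧ A.Same (tr C) ∧ Codes w v := by
  cases h with
  | @cons _ b _ v hab h =>
    obtain ⟨C, t⟩ := b
    obtain ⟨h1, rfl⟩ := hab
    exact ⟨C, v, rfl, h1, h⟩

theorem Codes.inv {w : List (HType Pr × Bool)} {u : List (BType {p : Pr // rk p = 2} × Bool)}
    (h : Codes w u) : Codes (HypergraphLambek.inv w) (HypergraphLambek.inv u) := by
  unfold Codes at *
  rw [HypergraphLambek.inv, HypergraphLambek.inv, List.forall₂_reverse_iff,
    List.forall₂_map_left_iff, List.forall₂_map_right_iff]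
  exact h.imp fun a b hab => ⟨hab.1, by rw [hab.2]⟩

theorem Codes.orient {w : List (HType Pr × Bool)} {u : List (BType {p : Pr // rk p = 2} × Bool)}
    (h : Codes w u) (s : Bool) :
    Codes (HypergraphLambek.orient s w) (HypergraphLambek.orient s u) := by
  cases s
  · exact h.inv
  · exact h

theorem Codes.isRotated {w w' : List (HType Pr × Bool)}
    {u : List (BType {p : Pr // rk p = 2} × Bool)} (h : Codes w u) (hr : w ~r w') :
    ∃ u', u ~r u' ∧ Codes w' u' := by
  obtain ⟨n, hn, rfl⟩ := List.isRotated_iff_mod.1 hr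
  rw [List.rotate_eq_drop_append_take hn]
  rw [← List.take_append_drop n w] at h
  obtain ⟨v, v', rfl, h1, h2⟩ := h.append_inv
  exact ⟨v' ++ v, List.isRotated_append, h2.append h1⟩

theorem Codes.exists_of_mem {w : List (HType Pr × Bool)}
    {u : List (BType {p : Pr // rk p = 2} × Bool)} (h : Codes w u) {a : HType Pr × Bool}
    (ha : a ∈ w) : ∃ C : BType {p : Pr // rk p = 2}, a.1.Same (tr C) := by
  obtain ⟨w1, w2, rfl⟩ := List.append_of_mem ha
  obtain ⟨v, v', rfl, h1, h2⟩ := h.append_inv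
  obtain ⟨C, -, -, h3, -⟩ := h2.cons_inv
  exact ⟨C, h3⟩

variable (rk) in
/-- The types that occur in the translations, up to isomorphism. -/
def Translated (T : HType Pr) : Prop :=
  (∃ C : BType {p : Pr // rk p = 2}, T.Same (tr C)) ∨
    ∃ C : BType {p : Pr // rk p = 2}, T.Same (loopType (tr C))

/-- `Target A c B`: a path (`c = false`) or a cycle (`c = true`) with the succedent `A` is read as a
sequence with the succedent `B`. A cycle in front of `×(Loop(tr C))` corresponds to a sequence in
front of the bracelet of `C`. -/
def Target (A : HType Pr) (c : Bool) (B : BType {p : Pr // rk p = 2}) : Prop :=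
  bif c then ∃ C, B = .brac C ∧ A.Same (loopType (tr C)) else A.Same (tr B)

/-- The sequent `H → A` is the translation of a derivable sequent, or `H` consists of one
hyperedge labelled `×(Loop(tr C))` and `C → B` is derivable, where `B` is the bracelet that
corresponds to `A`. -/
def Faithful (rk : Pr → ℕ) (H : HGraph (HType Pr)) (A : HType Pr) : Prop :=
  ∀ c (B : BType {p : Pr // rk p = 2}), Target A c B →
    (∃ w u, H.Reads c w ∧ Codes w u ∧ LBrac (u.map sgn) B) ∨
    c = true ∧ ∃ e C, H.shape.IsPoint e ∧ (H.lab e).Same (loopType (tr (rk := rk) C)) ∧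
      LBrac [C] B

theorem Target.same {A A' : HType Pr} {c : Bool} {B : BType {p : Pr // rk p = 2}}
    (h : Target A' c B) (hA : A.Same A') : Target A c B := by
  cases c
  · exact hA.trans h
  · obtain ⟨C, hB, h⟩ := h
    exact ⟨C, hB, hA.trans h⟩

/-- If the succedent is the translation of a type, the antecedent is a path. -/
theorem Faithful.path {H : HGraph (HType Pr)} {A : HType Pr} (h : Faithful rk H A)
    {B : BType {p : Pr // rk p = 2}} (hA : A.Same (tr B)) :
    ∃ w u, H.Reads false w ∧ Codes w u ∧ LBrac (u.map sgn) B := by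
  rcases h false B hA with h | ⟨h, -⟩
  · exact h
  · cases h

theorem Translated.same {A A' : HType Pr} (h : Translated rk A') (hA : A.Same A') :
    Translated rk A := by
  rcases h with ⟨C, h⟩ | ⟨C, h⟩
  · exact .inl ⟨C, hA.trans h⟩
  · exact .inr ⟨C, hA.trans h⟩

/-- The hypergraph `H` has a hyperedge labelled `T`. -/
def HGraph.HasLab {L : Type u} (H : HGraph L) (T : L) : Prop := ∃ e, H.lab e = T

theorem hasLab_replace {L : Type u} {S : Shape} {K : S.E → HGraph L} {e : S.E} {T : L}
    (h : (K e).HasLab T) : (S.replace K).HasLab T := by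
  obtain ⟨f, rfl⟩ := h
  exact ⟨S.copy K e f, rfl⟩

theorem hasLab_assign_self {L : Type u} {S : Shape} {d : S.E} {F : HGraph L}
    {K : {e : S.E // e ≠ d} → HGraph L} {T : L} (h : F.HasLab T) :
    (S.replace (S.assign d F K)).HasLab T :=
  hasLab_replace (e := d) (by rwa [Shape.assign_self])

theorem hasLab_assign {L : Type u} {S : Shape} {d : S.E} {F : HGraph L}
    {K : {e : S.E // e ≠ d} → HGraph L} (e : {e : S.E // e ≠ d}) {T : L} (h : (K e).HasLab T) :
    (S.replace (S.assign d F K)).HasLab T :=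
  hasLab_replace (e := e.1) (by rwa [Shape.assign_of_ne e.2])

theorem forall_lab_assign {L : Type u} {S : Shape} {d : S.E} {F : HGraph L}
    {K : {e : S.E // e ≠ d} → HGraph L} {p : L → Prop} (hF : ∀ f, p (F.lab f))
    (hK : ∀ e f, p ((K e).lab f)) (f : (S.replace (S.assign d F K)).shape.E) :
    p ((S.replace (S.assign d F K)).lab f) := by
  obtain ⟨e, f, rfl⟩ := Shape.exists_copy f
  exact Shape.assign_forall (p := fun _ H => ∀ f, p (H.lab f)) hF hK e f

theorem faithful_same {H H' : HGraph (HType Pr)} {A A' : HType Pr} (hH : H.Same H')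
    (hA : A.Same A') (hl : ∀ e, Translated rk (H'.lab e))
    (ih : (∀ e, Translated rk (H.lab e)) → Faithful rk H A) : Faithful rk H' A' := by
  obtain ⟨i, hi⟩ := hH
  intro c B hB
  rcases ih (fun e => (hl _).same (hi e)) c B (hB.same hA) with
    ⟨w, u, ⟨l, h1, rfl⟩, h2, h3⟩ | ⟨hc, e, C, h1, h2, h3⟩
  · refine .inl ⟨_, u, ⟨_, h1.iso i, rfl⟩, ?_, h3⟩
    unfold Codes at h2 ⊢
    rw [List.map_map, List.forall₂_map_left_iff]
    rw [List.forall₂_map_left_iff] at h2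
    refine h2.imp fun d b hab => ⟨?_, hab.2⟩
    rcases hl (i.edge d.1) with ⟨C, h4⟩ | ⟨C, h4⟩
    · rw [same_tr_unique hab.1 ((hi _).trans h4)]
      exact h4
    · exact (not_same_tr_and_loopType hab.1 ((hi _).trans h4)).elim
  · refine .inr ⟨hc, i.edge e, C, ⟨⟨fun v => h1.1.elim (i.node.symm v)⟩, fun e' => ?_⟩, ?_, h3⟩
    · rw [← h1.2 (i.edge.symm e'), Equiv.apply_symm_apply]
    · rcases hl (i.edge e) with ⟨C', h4⟩ | ⟨C', h4⟩
      · exact (not_same_tr_and_loopType ((hi _).trans h4) h2).elim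
      · rw [same_loopType_unique h2 ((hi _).trans h4)]
        exact h4

/-- Reading a path or a cycle in which one hyperedge is replaced by a path. -/
theorem exists_reads_replaceAt {H F : HGraph (HType Pr)} (hH : H.Ranked rk) {c : Bool}
    {w : List (HType Pr × Bool)} {u : List (BType {p : Pr // rk p = 2} × Bool)}
    (h : H.Reads c w) (hu : Codes w u) {e : H.shape.E} {C : BType {p : Pr // rk p = 2}}
    (he : (H.lab e).Same (tr C)) {v : List (HType Pr × Bool)}
    {t : List (BType {p : Pr // rk p = 2} × Bool)} (hF : F.Reads false v) (ht : Codes v t)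
    (hC : LBrac (t.map sgn) C) {B : BType {p : Pr // rk p = 2}} (hB : LBrac (u.map sgn) B) :
    ∃ w u, (H.replaceAt rk e F).Reads c w ∧ Codes w u ∧ LBrac (u.map sgn) B := by
  obtain ⟨l, hl, rfl⟩ := h
  obtain ⟨s, hs⟩ := hl.exists_mem e
  obtain ⟨l1, l2, rfl⟩ := List.append_of_mem hs
  rw [List.map_append, List.map_cons] at hu
  obtain ⟨u1, u', rfl, g1, g2⟩ := hu.append_inv
  obtain ⟨C', u2, rfl, g3, g4⟩ := g2.cons_inv
  obtain rfl := same_tr_unique he g3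
  exact ⟨_, u1 ++ orient s t ++ u2, reads_replaceAt hH hl hF, (g1.append (ht.orient s)).append g4,
    hC.subst hB⟩

theorem reads_div {S : Shape} {d d' : S.E} {r : Bool}
    (hS : S.Trav false (bif r then [(d, true), (d', true)] else [(d', true), (d, true)]))
    {L : Type u} {F : HGraph L} {K : {e : S.E // e ≠ d} → HGraph L} {v w : List (L × Bool)}
    (hd : d' ≠ d) (hF : F.Reads false v) (hK : (K ⟨d', hd⟩).Reads false w) :
    (S.replace (S.assign d F K)).Reads false (bif r then v ++ w else w ++ v) := by
  classical
  have hdd : ∀ e, e = d ∨ e = d' := fun e => by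
    obtain ⟨s, hs⟩ := hS.exists_mem e
    cases r <;> simp at hs <;> tauto
  have h1 : ∀ e, (S.assign d F K e).Reads false (if e = d then v else w) := by
    intro e
    rcases hdd e with rfl | rfl
    · rw [Shape.assign_self, if_pos rfl]; exact hF
    · rw [Shape.assign_of_ne hd, if_neg hd]; exact hK
  have := hS.reads_replace h1
  cases r <;> simpa [hd] using this

theorem reads_neck {S : Shape} {d : S.E} (hS : S.Trav true [(d, true)]) {L : Type u}
    {F : HGraph L} {K : {e : S.E // e ≠ d} → HGraph L} {v : List (L × Bool)}
    (hF : F.Reads false v) : (S.replace (S.assign d F K)).Reads true v := by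
  have h1 : ∀ e, (S.assign d F K e).Reads false v := by
    intro e
    obtain rfl : e = d := by simpa using hS.edges.2 e
    rw [Shape.assign_self]; exact hF
  simpa using hS.reads_replace h1

theorem ne_of_trav {S : Shape} {d d' : S.E} {r : Bool}
    (hS : S.Trav false (bif r then [(d, true), (d', true)] else [(d', true), (d, true)])) :
    d' ≠ d := by
  have := hS.edges.1
  cases r
  · simpa using this
  · simpa [eq_comm] using this

theorem rank_of_same_tr {T : HType Pr} {C : BType {p : Pr // rk p = 2}} (h : T.Same (tr C)) :
    T.rank rk = 2 := by
  cases T with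
  | prim p =>
    obtain ⟨hp, -⟩ := same_prim_tr h
    exact hp
  | times S lab =>
    rcases same_times_tr h with ⟨A, B, d, d', -, h1, -⟩ | ⟨A, d, -, h1, -⟩ <;> exact h1.rank
  | div N S d lab =>
    rcases same_div_tr h with ⟨r, A, B, d', -, h1, -⟩ | ⟨A, -, h1, -⟩ <;> exact h1.length_att d

theorem faithful_div_left {H : HGraph (HType Pr)} {A : HType Pr} {e : H.shape.E}
    {N : HType Pr} {S : Shape} {d : S.E} {lab : {e : S.E // e ≠ d} → HType Pr}
    {K : {e : S.E // e ≠ d} → HGraph (HType Pr)} (he : H.lab e = N) (hH : H.Ranked rk)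
    (hl : ∀ f, Translated rk
      ((H.replaceAt rk e (S.replace (S.assign d (handle rk (.div N S d lab)) K))).lab f))
    (ih : (∀ e, Translated rk (H.lab e)) → Faithful rk H A)
    (ihK : ∀ i, (∀ e, Translated rk ((K i).lab e)) → Faithful rk (K i) (lab i)) :
    Faithful rk (H.replaceAt rk e (S.replace (S.assign d (handle rk (.div N S d lab)) K))) A := by
  have hF : ∀ T, (S.replace (S.assign d (handle rk (.div N S d lab)) K)).HasLab T →
      Translated rk T := by
    intro T hT
    obtain ⟨f, rfl⟩ := hasLab_assign_self (S := H.shape) (d := e)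
      (K := fun e' => handle rk (H.lab e'.1)) hT
    exact hl f
  have hK : ∀ i f, Translated rk ((K i).lab f) := fun i f =>
    hF _ (hasLab_assign i ⟨f, rfl⟩)
  have hH' : ∀ e', e' ≠ e → Translated rk (H.lab e') := by
    intro e' hne
    obtain ⟨f, hf⟩ := hasLab_assign (S := H.shape) (d := e)
      (F := S.replace (S.assign d (handle rk (.div N S d lab)) K))
      (K := fun e' => handle rk (H.lab e'.1)) ⟨e', hne⟩ (T := H.lab e') ⟨(), rfl⟩
    rw [← hf]; exact hl f
  have hD : Translated rk (.div N S d lab) := hF _ (hasLab_assign_self ⟨(), rfl⟩)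
  have hHN : Translated rk N → ∀ e', Translated rk (H.lab e') := by
    intro hN e'
    by_cases h : e' = e
    · subst h; rwa [he]
    · exact hH' e' h
  rcases hD with ⟨C, hC⟩ | ⟨C, hC⟩
  · have hrank := rank_of_same_tr hC
    rcases same_div_tr hC with ⟨r, A', B', d', rfl, h1, h2, h3⟩ | ⟨A', rfl, h1, h2⟩
    · have hd := ne_of_trav h1
      obtain ⟨wK, uK, k1, k2, k3⟩ := (ihK ⟨d', hd⟩ (hK _)).path (h3 _)
      have hR := reads_div h1 hd (handle_reads hrank) k1
      have hc := Codes.singleton true hC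
      have ht : Codes (bif r then [(HType.div N S d lab, true)] ++ wK
          else wK ++ [(HType.div N S d lab, true)])
          (bif r then [(bif r then BType.rdiv A' B' else BType.ldiv B' A', true)] ++ uK
            else uK ++ [(bif r then BType.rdiv A' B' else BType.ldiv B' A', true)]) := by
        cases r
        · exact k2.append hc
        · exact hc.append k2
      have hLB : LBrac ((bif r then
          [(bif r then BType.rdiv A' B' else BType.ldiv B' A', true)] ++ uK
          else uK ++ [(bif r then BType.rdiv A' B' else BType.ldiv B' A', true)]).map sgn) A' := by
        cases r
        · have := LBrac.ldiv_left [] _ [] B' A' A' k3.ne_nil (.ax A') k3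
          simpa [sgn] using this
        · have := LBrac.rdiv_left [] _ [] B' A' A' k3.ne_nil (.ax A') k3
          simpa [sgn] using this
      intro c B hB
      rcases ih (hHN (.inl ⟨_, h2⟩)) c B hB with ⟨w, u, g1, g2, g3⟩ | ⟨-, e0, C, g1, g2, -⟩
      · exact .inl (exists_reads_replaceAt hH g1 g2 (he ▸ h2) hR ht hLB g3)
      · obtain rfl := g1.2 e
        exact (not_same_tr_and_loopType h2 (he ▸ g2)).elim
    -- for a bracelet, `e` is labelled `×(Loop(tr A'))`, so `H` is a point and the result is a cycle
    · have hR := reads_neck (K := K) h1 (handle_reads hrank)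
      intro c B hB
      rcases ih (hHN (.inr ⟨_, h2⟩)) c B hB with ⟨w, u, g1, g2, g3⟩ | ⟨hc, e0, C, g1, g2, g3⟩
      · obtain ⟨s, hs⟩ := g1.exists_lab e
        obtain ⟨C, hC'⟩ := g2.exists_of_mem hs
        exact (not_same_tr_and_loopType (he ▸ hC') h2).elim
      · obtain rfl := g1.2 e
        obtain rfl := same_loopType_unique h2 (he ▸ g2)
        subst hc
        obtain ⟨B, rfl, -⟩ := hB
        refine .inl ⟨_, _, g1.reads_replace ?_, Codes.singleton true hC, ?_⟩
        · rw [Shape.assign_self]; exact hR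
        · exact .brac_left B A' g3
  · exact absurd hC not_same_div_loopType

/-- The antecedent is recovered as a path by removing an end of a path, or by cutting a cycle. A
cycle may be cut so that the path is read backwards, which `Aᴿ → A^brac` compensates. -/
theorem faithful_div_right {F : HGraph (HType Pr)} {N : HType Pr} {S : Shape} {d : S.E}
    {lab : {e : S.E // e ≠ d} → HType Pr}
    (hs : IsSequent rk Shape.NoIsolated F (.div N S d lab)) (hl : ∀ e, Translated rk (F.lab e))
    (ih : (∀ e, Translated rk
      ((S.replace (S.assign d F fun i => handle rk (lab i))).lab e)) →
      Faithful rk (S.replace (S.assign d F fun i => handle rk (lab i))) N) :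
    Faithful rk F (.div N S d lab) := by
  obtain ⟨hx, hI, -, -, -, hr⟩ := hs
  intro c B hB
  cases c
  · have hrank : (HType.div N S d lab).rank rk = 2 := rank_of_same_tr hB
    rcases same_div_tr hB with ⟨r, A', B', d', rfl, h1, h2, h3⟩ | ⟨A', rfl, h1, h2⟩
    · have hd := ne_of_trav h1
      obtain ⟨w, u, g1, g2, g3⟩ := (ih (forall_lab_assign hl fun i f => .inl ⟨B', h3 i⟩)).path h2
      obtain ⟨v, hv, rfl⟩ := reads_cut_end h1 hx (hr.trans hrank) hI
        (fun e => rank_of_same_tr (h3 e)) hd g1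
      left
      cases r
      · obtain ⟨C, t, rfl, k1, k2⟩ := Codes.cons_inv g2
        obtain rfl := same_tr_unique (h3 _) k1
        refine ⟨v, t, hv, k2, .ldiv_right _ _ _ ?_ (by simpa [sgn] using g3)⟩
        rintro h
        rw [List.map_eq_nil_iff] at h
        subst h
        exact hv.ne (by cases k2; rfl)
      · obtain ⟨t, t', rfl, k1, k2⟩ := Codes.append_inv g2
        obtain ⟨C, t'', rfl, k3, k4⟩ := Codes.cons_inv k2
        obtain rfl : t'' = [] := by cases k4; rfl
        obtain rfl := same_tr_unique (h3 _) k3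
        refine ⟨v, t, hv, k1, .rdiv_right _ _ _ ?_ (by simpa [sgn] using g3)⟩
        rintro h
        rw [List.map_eq_nil_iff] at h
        subst h
        exact hv.ne (by cases k1; rfl)
    · have hlab : ∀ (i : {e : S.E // e ≠ d}) (f : (handle rk (lab i)).shape.E),
          Translated rk ((handle rk (lab i)).lab f) := fun i =>
        absurd (by simpa using h1.edges.2 i.1) i.2
      rcases ih (forall_lab_assign hl hlab) true (.brac A') ⟨A', rfl, h2⟩ with
        ⟨w, u, g1, g2, g3⟩ | ⟨-, e0, C, g1, -⟩
      · obtain ⟨v, s, hv, hrot⟩ := reads_cut_loop h1 hx (hr.trans hrank) hI g1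
        obtain ⟨t, k1, k2⟩ := g2.isRotated hrot
        have k3 := g3.of_isRotated (k1.map sgn)
        left
        cases s
        · refine ⟨v, inv t, hv, ?_, k3.brac_inv⟩
          have := Codes.inv k2
          rwa [orient_false, inv_inv] at this
        · exact ⟨v, t, hv, k2, k3⟩
      · exact (not_isEmpty_of_nonempty _ (h := h1.nonempty) g1.isEmpty_of_replace.1).elim
  · obtain ⟨C, -, h⟩ := hB
    exact absurd h not_same_div_loopType

/-- The step for `×` in the antecedent where the type is the translation of a type: the
hyperedge `e` replaces a path of one or two hyperedges. -/
theorem faithful_times_left_tr {G F : HGraph (HType Pr)} {A : HType Pr} {e : G.shape.E}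
    (hG : G.Ranked rk) {C : BType {p : Pr // rk p = 2}} (he : (G.lab e).Same (tr C))
    {v : List (HType Pr × Bool)} (hF : F.Reads false v) (hv : (∃ a, v = [a]) ∨ ∃ a b, v = [a, b])
    {t : List (BType {p : Pr // rk p = 2} × Bool)} (ht : Codes v t)
    (hC : ∀ (u u' : List (BType {p : Pr // rk p = 2} × Bool)) (s : Bool) (B : BType _),
      LBrac ((u ++ orient s t ++ u').map sgn) B → LBrac ((u ++ (C, s) :: u').map sgn) B)
    (ih : Faithful rk (G.replaceAt rk e F) A) : Faithful rk G A := by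
  intro c B hB
  rcases ih c B hB with ⟨w, u, g1, g2, g3⟩ | ⟨-, e0, C, g1, -⟩
  · obtain ⟨l1, s, l2, h1, h2⟩ := trav_of_reads_replaceAt hG
      ((hG e).symm.trans (rank_of_same_tr he)) hF hv g1
    obtain ⟨u', k1, k2⟩ : ∃ u', Codes (G.word l1 ++ orient s v ++ G.word l2) u' ∧
        LBrac (u'.map sgn) B := by
      rcases h2 with rfl | ⟨rfl, h2⟩
      · exact ⟨u, g2, g3⟩
      · obtain ⟨u', k1, k2⟩ := g2.isRotated h2
        obtain ⟨B, rfl, -⟩ := hB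
        exact ⟨u', k2, g3.of_isRotated (k1.map sgn)⟩
    obtain ⟨u1, u2, rfl, k3, k4⟩ := Codes.append_inv k1
    obtain ⟨u0, u1, rfl, k5, k6⟩ := Codes.append_inv k3
    obtain rfl := (ht.orient s).unique k6
    refine .inl ⟨_, u0 ++ (C, s) :: u2, ⟨_, h1, rfl⟩, ?_, hC _ _ _ _ k2⟩
    rw [List.map_append, List.map_cons]
    exact k5.append (k4.cons s he)
  · have h1 := (g1.isEmpty_of_replace).2 e
    rw [Shape.assign_self] at h1
    obtain ⟨l, hl, -⟩ := hF
    exact (not_isEmpty_of_nonempty _ (h := hl.nonempty) h1).elim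

/-- If `e` is labelled `×(Loop(tr C))`, then expanding it gives a loop, which is the whole cycle, so
that `G` consists of `e` alone. -/
theorem faithful_times_left {G : HGraph (HType Pr)} {A : HType Pr} {e : G.shape.E} {S : Shape}
    {lab : S.E → HType Pr} (he : G.lab e = .times S lab)
    (hG : G.Ranked rk) (hx : S.ext.Nodup) (hl : ∀ e, Translated rk (G.lab e))
    (ih : (∀ f, Translated rk ((G.replaceAt rk e ⟨S, lab⟩).lab f)) →
      Faithful rk (G.replaceAt rk e ⟨S, lab⟩) A) : Faithful rk G A := by
  have hl' : (∀ f, Translated rk (lab f)) →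
      ∀ f, Translated rk ((G.replaceAt rk e ⟨S, lab⟩).lab f) := fun h =>
    forall_lab_assign h fun e' _ => hl e'.1
  rcases hl e with ⟨C, hC⟩ | ⟨C, hC⟩
  · rcases same_times_tr (he ▸ hC) with ⟨A', B', d, d', rfl, h1, h2, h3⟩ | ⟨A', d, rfl, h1, h2⟩
    · refine faithful_times_left_tr (F := ⟨S, lab⟩) hG hC ⟨_, h1, rfl⟩ (.inr ⟨_, _, rfl⟩)
        (.cons true h2 (.singleton true h3)) (fun _ _ _ _ h => h.of_mul) (ih (hl' fun f => ?_))
      obtain ⟨s, hs⟩ := h1.exists_mem f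
      simp only [List.mem_cons, Prod.mk.injEq, List.not_mem_nil, or_false] at hs
      rcases hs with ⟨rfl, -⟩ | ⟨rfl, -⟩
      · exact .inl ⟨_, h2⟩
      · exact .inl ⟨_, h3⟩
    · refine faithful_times_left_tr (F := ⟨S, lab⟩) hG hC ⟨_, h1, rfl⟩ (.inl ⟨_, rfl⟩)
        (.singleton false h2) (fun _ _ _ _ h => h.of_rev) (ih (hl' fun f => ?_))
      obtain rfl : f = d := by simpa using h1.edges.2 f
      exact .inl ⟨_, h2⟩
  · obtain ⟨d, h1, h2⟩ := same_times_loopType (he ▸ hC)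
    intro c B hB
    rcases ih (hl' fun f => by
      obtain rfl : f = d := by simpa using h1.edges.2 f
      exact .inl ⟨_, h2⟩) c B hB with ⟨w, u, ⟨l, g1, rfl⟩, g2, g3⟩ | ⟨-, e0, C, g1, -⟩
    · have hf : G.shape.Fits (G.shape.assign e ⟨S, lab⟩ fun e' => handle rk (G.lab e'.1)) :=
        fits_assign ⟨hx, by rw [← hG e, he]; rfl⟩ fun e' => by
          rw [← hG e'.1]; exact handle_ext _
      have hne : ∀ e', Nonempty
          (G.shape.assign e ⟨S, lab⟩ (fun e' => handle rk (G.lab e'.1)) e').shape.E :=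
        Shape.assign_forall (p := fun _ H => Nonempty H.shape.E) ⟨d⟩ fun _ => ⟨()⟩
      obtain ⟨f, hf1, hf2⟩ : ∃ f, (G.shape.assign e ⟨S, lab⟩
          (fun e' => handle rk (G.lab e'.1)) e).shape.Trav true [(f, true)] ∧
          ((G.shape.assign e ⟨S, lab⟩
            (fun e' => handle rk (G.lab e'.1)) e).lab f).Same (tr C) := by
        rw [Shape.assign_self]; exact ⟨d, h1, h2⟩
      obtain ⟨rfl, hp, s, rfl⟩ := Shape.Trav.contract_loop hf hne hf1 g1
      obtain ⟨B, rfl, -⟩ := hB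
      refine .inr ⟨rfl, e, C, hp, hC, ?_⟩
      obtain rfl := Codes.unique g2 (Codes.singleton s hf2)
      cases s
      · have := g3.brac_inv
        simpa [sgn] using this
      · simpa [sgn] using g3
    · have h3 := (g1.isEmpty_of_replace).2 e
      rw [Shape.assign_self] at h3
      exact (not_isEmpty_of_nonempty _ (h := h1.nonempty) h3).elim

/-- Paths are inserted in `SG(tr A tr B)`, in the reversed hyperedge, or in a loop, according to
the succedent. -/
theorem faithful_times_right {S : Shape} {lab : S.E → HType Pr} {K : S.E → HGraph (HType Pr)}
    (hl : ∀ f, Translated rk ((S.replace K).lab f))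
    (ih : ∀ m, (∀ e, Translated rk ((K m).lab e)) → Faithful rk (K m) (lab m)) :
    Faithful rk (S.replace K) (.times S lab) := by
  have key : (∀ m, ∃ C : BType {p : Pr // rk p = 2}, (lab m).Same (tr C)) →
      ∀ m, ∃ w, ∃ u : List (BType {p : Pr // rk p = 2} × Bool), (K m).Reads false w ∧
        Codes w u ∧
        ∀ C : BType {p : Pr // rk p = 2}, (lab m).Same (tr C) → LBrac (u.map sgn) C := by
    intro h m
    obtain ⟨C, hC⟩ := h m
    obtain ⟨w, u, h1, h2, h3⟩ := (ih m fun e => hl (S.copy K m e)).path hC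
    exact ⟨w, u, h1, h2, fun C' hC' => same_tr_unique hC hC' ▸ h3⟩
  intro c B hB
  left
  cases c
  · rcases same_times_tr hB with ⟨A', B', d, d', rfl, h1, h2, h3⟩ | ⟨A', d, rfl, h1, h2⟩
    · choose W U hW hU hL using key fun f => by
        obtain ⟨s, hs⟩ := h1.exists_mem f
        simp only [List.mem_cons, Prod.mk.injEq, List.not_mem_nil, or_false] at hs
        rcases hs with ⟨rfl, -⟩ | ⟨rfl, -⟩
        · exact ⟨_, h2⟩
        · exact ⟨_, h3⟩
      refine ⟨W d ++ W d', U d ++ U d', by simpa using h1.reads_replace hW,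
        (hU d).append (hU d'), ?_⟩
      rw [List.map_append]
      have g1 := hL d _ h2
      have g2 := hL d' _ h3
      exact .mul_right _ _ _ _ g1.ne_nil g2.ne_nil g1 g2
    · choose W U hW hU hL using key fun f => by
        obtain rfl : f = d := by simpa using h1.edges.2 f
        exact ⟨_, h2⟩
      exact ⟨inv (W d), inv (U d), by simpa using h1.reads_replace hW, (hU d).inv,
        (hL d _ h2).inv⟩
  · obtain ⟨C, rfl, hC⟩ := hB
    obtain ⟨d, h1, h2⟩ := same_times_loopType hC
    choose W U hW hU hL using key fun f => by
      obtain rfl : f = d := by simpa using h1.edges.2 f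
      exact ⟨_, h2⟩
    have g1 := hL d _ h2
    exact ⟨W d, U d, by simpa using h1.reads_replace hW, hU d, .brac_right _ _ g1.ne_nil g1⟩

theorem HLDerivable.faithful {H : HGraph (HType Pr)} {A : HType Pr}
    (h : HLDerivable rk Shape.NoIsolated H A) :
    (∀ e, Translated rk (H.lab e)) → Faithful rk H A := by
  induction h with
  | same H H' A A' hs hH hA _ ih => exact fun hl => faithful_same hH hA hl ih
  | ax p hs =>
    intro _ c B hB
    cases c
    · obtain ⟨hp, rfl⟩ := same_prim_tr hB
      exact .inl ⟨_, _, handle_reads hp, .singleton true hB, .ax _⟩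
    · obtain ⟨C, -, h⟩ := hB
      exact absurd h not_same_prim_loopType
  | div_left H A e N S d lab K he hs hH hK ih ihK =>
    exact fun hl => faithful_div_left he hH.isSequent.2.2.1 hl ih ihK
  | div_right F N S d lab hs h ih => exact fun hl => faithful_div_right hs hl ih
  | times_left G A e S lab he hs h ih =>
    intro hl
    have ht := hs.2.2.2.1 e
    rw [he] at ht
    exact faithful_times_left he hs.2.2.1 ht.1 hl ih
  | times_right S lab K hs h ih => exact fun hl => faithful_times_right hl ih

theorem LBrac.of_HLWI {Γ : List (BType {p : Pr // rk p = 2})} {B : BType {p : Pr // rk p = 2}}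
    (h : HLWI rk (stringGraph (Γ.map tr)) (tr B)) : LBrac Γ B := by
  have hne : Γ ≠ [] := by
    rintro rfl
    have : ([0, 0] : List (Fin 1)).Nodup := h.isSequent.1
    simp at this
  have hr := stringGraph_reads (w := Γ.map (tr (rk := rk))) (by simpa using hne)
  have hc : Codes ((Γ.map (tr (rk := rk))).map fun a => (a, true)) (Γ.map fun A => (A, true)) := by
    unfold Codes
    rw [List.forall₂_map_left_iff, List.forall₂_map_left_iff, List.forall₂_map_right_iff,
      List.forall₂_same]
    exact fun A _ => ⟨.refl _, rfl⟩
  have hl : ∀ e, Translated rk ((stringGraph (Γ.map (tr (rk := rk)))).lab e) := by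
    intro e
    obtain ⟨s, hs⟩ := hr.exists_lab e
    exact .inl (hc.exists_of_mem hs)
  obtain ⟨w, u, h1, h2, h3⟩ := (HLDerivable.faithful h hl).path (.refl (tr B))
  obtain rfl := hr.unique h1
  obtain rfl := hc.unique h2
  simpa [sgn, Function.comp_def] using h3

end Backward

/-! ### Derivable sequents with signed words as antecedents -/

section Provable
variable {Pr : Type u} {rk : Pr → ℕ}

theorem rank_tr (C : BType {p : Pr // rk p = 2}) : (tr C).rank rk = 2 :=
  rank_of_same_tr (.refl _)

theorem isType_tr (C : BType {p : Pr // rk p = 2}) : (tr C).IsType rk Shape.NoIsolated := by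
  induction C with
  | prim p => trivial
  | ldiv B A ihB ihA =>
    exact ⟨ihA, rank_tr A, string2_trav.ext_nodup, string2_trav.noIsolated, fun _ => rank_tr B,
      fun _ => ihB⟩
  | rdiv A B ihA ihB =>
    exact ⟨ihA, rank_tr A, string2_trav.ext_nodup, string2_trav.noIsolated, fun _ => rank_tr B,
      fun _ => ihB⟩
  | mul A B ihA ihB =>
    exact ⟨string2_trav.ext_nodup, string2_trav.noIsolated,
      Fin.forall_fin_two.2 ⟨rank_tr A, rank_tr B⟩, Fin.forall_fin_two.2 ⟨ihA, ihB⟩⟩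
  | rev A ihA =>
    exact ⟨flip_trav.ext_nodup, flip_trav.noIsolated, fun _ => rank_tr A, fun _ => ihA⟩
  | brac A ihA =>
    exact ⟨⟨loop_trav.ext_nodup, loop_trav.noIsolated, fun _ => rank_tr A, fun _ => ihA⟩, rfl,
      loop_trav.ext_nodup, loop_trav.noIsolated, fun e => (e.2 rfl).elim,
      fun e => (e.2 rfl).elim⟩

theorem isType_loopType (C : BType {p : Pr // rk p = 2}) :
    (loopType (tr C)).IsType rk Shape.NoIsolated :=
  ⟨loop_trav.ext_nodup, loop_trav.noIsolated, fun _ => rank_tr C, fun _ => isType_tr C⟩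

/-- The translation of a signed word. -/
def code (u : List (BType {p : Pr // rk p = 2} × Bool)) : List (HType Pr × Bool) :=
  u.map fun a => (tr a.1, a.2)

theorem code_append (u v : List (BType {p : Pr // rk p = 2} × Bool)) :
    code (u ++ v) = code u ++ code v := List.map_append

theorem code_orient (s : Bool) (u : List (BType {p : Pr // rk p = 2} × Bool)) :
    code (orient s u) = orient s (code u) := (orient_map tr s u).symm

theorem code_inv (u : List (BType {p : Pr // rk p = 2} × Bool)) :
    code (inv u) = inv (code u) := code_orient false u

/-- The succedent that stands for `C` if the antecedent is a path (`c = false`) or a cycle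
(`c = true`). -/
def goal (c : Bool) (C : BType {p : Pr // rk p = 2}) : HType Pr :=
  bif c then loopType (tr C) else tr C

theorem isSequent_of_reads {c : Bool} {u : List (BType {p : Pr // rk p = 2} × Bool)}
    {G : HGraph (HType Pr)} (h : G.Reads c (code u)) (C : BType {p : Pr // rk p = 2}) :
    IsSequent rk Shape.NoIsolated G (goal c C) := by
  have hl : ∀ e, ∃ A : BType {p : Pr // rk p = 2}, G.lab e = tr A := by
    intro e
    obtain ⟨s, hs⟩ := h.exists_lab e
    obtain ⟨a, -, ha⟩ := List.mem_map.1 hs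
    exact ⟨a.1, (congrArg Prod.fst ha).symm⟩
  obtain ⟨l, hl', -⟩ := h
  refine ⟨hl'.ext_nodup, hl'.noIsolated, fun e => ?_, fun e => ?_, ?_, ?_⟩
  · obtain ⟨A, hA⟩ := hl e
    rw [hA, rank_tr, hl'.length_att]
  · obtain ⟨A, hA⟩ := hl e
    rw [hA]
    exact isType_tr A
  · cases c
    · exact isType_tr C
    · exact isType_loopType C
  · rw [hl'.rank]
    cases c
    · exact (rank_tr C).symm
    · rfl

theorem exists_trav_of_reads {c : Bool}
    {w1 w2 : List (BType {p : Pr // rk p = 2} × Bool)} {A : BType {p : Pr // rk p = 2}} {s : Bool}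
    {G : HGraph (HType Pr)}
    (h : G.Reads c (code (w1 ++ (A, s) :: w2))) :
    ∃ l1 e l2, G.shape.Trav c (l1 ++ (e, s) :: l2) ∧ G.lab e = tr A ∧ G.word l1 = code w1 ∧
      G.word l2 = code w2 := by
  obtain ⟨l, hl, h⟩ := h
  rw [code_append] at h
  obtain ⟨l1, l', rfl, h1, h2⟩ := List.map_eq_append_iff.1 h
  obtain ⟨⟨e, t⟩, l2, rfl, h3, h4⟩ := List.map_eq_cons_iff.1 h2
  obtain ⟨h5, rfl⟩ := Prod.mk.inj h3
  exact ⟨l1, e, l2, hl, h5, h1, h4⟩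

/-- There is a sequent whose antecedent is a hyperedge without nodes, labelled `×(Loop(tr A))`. -/
theorem exists_point (A B : BType {p : Pr // rk p = 2}) :
    ∃ (G : HGraph (HType Pr)) (e : G.shape.E), G.shape.IsPoint e ∧ G.lab e = loopType (tr A) ∧
      IsSequent rk Shape.NoIsolated G (loopType (tr B)) := by
  let S : Shape :=
    { V := Empty
      E := Unit
      finV := inferInstance
      finE := inferInstance
      att := fun _ => []
      ext := [] }
  exact ⟨⟨S, fun _ => loopType (tr A)⟩, (), ⟨⟨fun v : Empty => v.elim⟩, fun _ => rfl⟩, rfl,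
    List.nodup_nil, fun v : Empty => v.elim, fun _ => rfl, fun _ => isType_loopType A,
    isType_loopType B, rfl⟩

theorem Shape.IsPoint.reads_replaceAt {G F : HGraph (HType Pr)}
    {e : G.shape.E} (h : G.shape.IsPoint e) {w : List (HType Pr × Bool)} (hF : F.Reads true w) :
    (G.replaceAt rk e F).Reads true w :=
  h.reads_replace (by rwa [Shape.assign_self])

/-- The path (`c = false`) or the cycle (`c = true`) with the labels and directions given by `u`
is the antecedent of a derivable sequent with the succedent `goal c C`. -/
def Provable (c : Bool) (u : List (BType {p : Pr // rk p = 2} × Bool))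
    (C : BType {p : Pr // rk p = 2}) : Prop :=
  u ≠ [] ∧ ∀ G : HGraph (HType Pr), G.Reads c (code u) → HLWI rk G (goal c C)

namespace Provable
variable {c : Bool} {u v w1 w2 : List (BType {p : Pr // rk p = 2} × Bool)}
  {A B C : BType {p : Pr // rk p = 2}} {s : Bool}

theorem exists_reads (h : Provable c u C) :
    ∃ G : HGraph (HType Pr), G.Reads c (code u) ∧ HLWI rk G (goal c C) := by
  obtain ⟨G, hG⟩ := HypergraphLambek.exists_reads c (w := code u) (by simpa [code] using h.1)
  exact ⟨G, hG, h.2 G hG⟩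

/-- A path and a cycle are determined up to isomorphism by what is read along them. -/
theorem of_reads {G : HGraph (HType Pr)} (hG : G.Reads c (code u)) (h : HLWI rk G (goal c C)) :
    Provable c u C := by
  refine ⟨by simpa [code] using hG.ne, fun G' hG' => ?_⟩
  obtain ⟨i, hi⟩ := hG.exists_iso hG'
  exact .same G G' _ _ (isSequent_of_reads hG' C) ⟨i, fun e => hi e ▸ .refl _⟩ (.refl _) h

theorem prim (p : {p : Pr // rk p = 2}) : Provable false [(.prim p, true)] (.prim p) := by
  have h : (handle rk (HType.prim p.1)).Reads false (code [(BType.prim p, true)]) :=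
    handle_reads p.2
  exact of_reads h (.ax p.1 (isSequent_of_reads h (.prim p)))

theorem mul_right (hu : Provable false u A) (hv : Provable false v B) :
    Provable false (u ++ v) (.mul A B) := by
  obtain ⟨G, hG, hG'⟩ := hu.exists_reads
  obtain ⟨H, hH, hH'⟩ := hv.exists_reads
  have h : ((stringShape 2).replace (![G, H] : Fin 2 → HGraph (HType Pr))).Reads false
      (code (u ++ v)) := by
    have := string2_trav.reads_replace (K := (![G, H] : Fin 2 → HGraph (HType Pr)))
      (W := (![code u, code v] : Fin 2 → List (HType Pr × Bool)))
      (Fin.forall_fin_two.2 ⟨hG, hH⟩)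
    simpa [code_append] using this
  exact of_reads h (.times_right (stringShape 2) ![tr A, tr B] _ (isSequent_of_reads h (.mul A B))
    (Fin.forall_fin_two.2 ⟨hG', hH'⟩))

theorem rev_right (hu : Provable false u A) : Provable false (inv u) (.rev A) := by
  obtain ⟨G, hG, hG'⟩ := hu.exists_reads
  have h : (flipShape.replace fun _ => G).Reads false (code (inv u)) := by
    have := flip_trav.reads_replace (K := fun _ => G) (fun _ => hG)
    simpa [code_inv] using this
  exact of_reads h (.times_right flipShape (fun _ => tr A) _ (isSequent_of_reads h (.rev A))
    fun _ => hG')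

theorem loop_right (hu : Provable false u A) : Provable true u A := by
  obtain ⟨G, hG, hG'⟩ := hu.exists_reads
  have h : (loopShape.replace fun _ => G).Reads true (code u) := by
    have := loop_trav.reads_replace (K := fun _ => G) (fun _ => hG)
    simpa using this
  exact of_reads h (.times_right loopShape (fun _ => tr A) _ (isSequent_of_reads h A)
    fun _ => hG')

theorem rdiv_right (hu : u ≠ []) (h : Provable false (u ++ [(B, true)]) A) :
    Provable false u (.rdiv A B) := by
  refine ⟨hu, fun G hG => .div_right G (tr A) (stringShape 2) (0 : Fin 2) (fun _ => tr B)
    (isSequent_of_reads hG (.rdiv A B)) (h.2 _ ?_)⟩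
  rw [code_append]
  exact reads_div (r := true) string2_trav Fin.zero_ne_one.symm hG (handle_reads (rank_tr B))

theorem ldiv_right (hu : u ≠ []) (h : Provable false ((B, true) :: u) A) :
    Provable false u (.ldiv B A) := by
  refine ⟨hu, fun G hG => .div_right G (tr A) (stringShape 2) (1 : Fin 2) (fun _ => tr B)
    (isSequent_of_reads hG (.ldiv B A)) (h.2 _ ?_)⟩
  exact reads_div (S := stringShape 2) (d := (1 : Fin 2)) (d' := (0 : Fin 2)) (r := false)
    (K := fun _ => handle rk (tr B)) string2_trav Fin.zero_ne_one hG (handle_reads (rank_tr B))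

theorem brac_right (h : Provable true u A) : Provable false u (.brac A) :=
  ⟨h.1, fun G hG => .div_right G _ loopShape () _ (isSequent_of_reads hG (.brac A))
    (h.2 _ (reads_neck loop_trav hG))⟩

theorem rotate (h : Provable true (u ++ v) A) : Provable true (v ++ u) A := by
  obtain ⟨G, hG, hG'⟩ := h.exists_reads
  refine of_reads (G := G) ?_ hG'
  rw [code_append] at hG ⊢
  exact hG.rotate

theorem inverse (h : Provable true u A) : Provable true (inv u) A := by
  obtain ⟨G, hG, hG'⟩ := h.exists_reads
  refine of_reads (G := G) ?_ hG'
  rw [code_inv]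
  exact hG.inverse

/-- The rule for `×` in the antecedent, where the type stands for a path. -/
theorem times_left {S : Shape} {lab : S.E → HType Pr} (hA : tr A = .times S lab)
    (hS : HGraph.Reads ⟨S, lab⟩ false (code v))
    (h : Provable c (w1 ++ orient s v ++ w2) C) : Provable c (w1 ++ (A, s) :: w2) C := by
  refine ⟨by simp, fun G hG => ?_⟩
  have hs := isSequent_of_reads hG C
  obtain ⟨l1, e, l2, hl, he, h1, h2⟩ := exists_trav_of_reads hG
  refine .times_left G _ e S lab (he.trans hA) hs (h.2 _ ?_)
  rw [code_append, code_append, ← h1, ← h2, code_orient]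
  exact reads_replaceAt hs.2.2.1 hl hS

theorem mul_left (h : Provable c (w1 ++ orient s [(A, true), (B, true)] ++ w2) C) :
    Provable c (w1 ++ (.mul A B, s) :: w2) C :=
  h.times_left rfl ⟨_, string2_trav, rfl⟩

theorem rev_left (h : Provable c (w1 ++ orient s [(A, false)] ++ w2) C) :
    Provable c (w1 ++ (.rev A, s) :: w2) C :=
  h.times_left rfl ⟨_, flip_trav, rfl⟩

/-- The rule for `÷` in the antecedent, where the type stands for a path. -/
theorem div_left {N : BType {p : Pr // rk p = 2}} {S : Shape} {d : S.E}
    {lab : {e : S.E // e ≠ d} → HType Pr} (K : {e : S.E // e ≠ d} → HGraph (HType Pr))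
    (hS : (S.replace (S.assign d (handle rk (.div (tr N) S d lab)) K)).Reads false (code v))
    (hK : ∀ i, HLWI rk (K i) (lab i)) (h : Provable c (w1 ++ (N, s) :: w2) C) :
    Provable c (w1 ++ orient s v ++ w2) C := by
  obtain ⟨G, hG, hG'⟩ := h.exists_reads
  obtain ⟨l1, e, l2, hl, he, h1, h2⟩ := exists_trav_of_reads hG
  have hR := reads_replaceAt (isSequent_of_reads hG C).2.2.1 hl hS
  rw [h1, h2, ← code_orient, ← code_append, ← code_append] at hR
  exact of_reads hR (.div_left G _ e (tr N) S d lab K he (isSequent_of_reads hR C) hG' hK)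

theorem rdiv_left (hv : Provable false v B) (h : Provable c (w1 ++ (A, s) :: w2) C) :
    Provable c (w1 ++ orient s ((.rdiv A B, true) :: v) ++ w2) C := by
  obtain ⟨H, hH, hH'⟩ := hv.exists_reads
  exact h.div_left (fun _ => H) (reads_div (r := true) string2_trav Fin.zero_ne_one.symm
    (handle_reads (rank_tr (.rdiv A B))) hH) fun _ => hH'

theorem ldiv_left (hv : Provable false v B) (h : Provable c (w1 ++ (A, s) :: w2) C) :
    Provable c (w1 ++ orient s (v ++ [(.ldiv B A, true)]) ++ w2) C := by
  obtain ⟨H, hH, hH'⟩ := hv.exists_reads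
  refine h.div_left (S := stringShape 2) (d := (1 : Fin 2)) (fun _ => H) ?_ fun _ => hH'
  rw [code_append]
  exact reads_div (S := stringShape 2) (d := (1 : Fin 2)) (d' := (0 : Fin 2)) (r := false)
    string2_trav Fin.zero_ne_one (handle_reads (rank_tr (.ldiv B A))) hH

/-- The hyperedge of a cycle of length one is first enclosed in a hyperedge without nodes, labelled
`×(Loop(tr A))`, which is then expanded to a hyperedge labelled with the translation of the
bracelet. -/
theorem brac_left (h : Provable true [(A, true)] B) : Provable true [(.brac A, true)] B := by
  obtain ⟨G, e, hp, he, hs⟩ := exists_point A B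
  have h1 : HLWI rk G (goal true B) :=
    .times_left G _ e loopShape (fun _ => tr A) he hs
      (h.2 _ (hp.reads_replaceAt ⟨_, loop_trav, rfl⟩))
  have h2 : (G.replaceAt rk e (loopShape.replace (loopShape.assign ()
      (handle rk (tr (.brac A))) fun e => (e.2 rfl).elim))).Reads true
      (code [(BType.brac A, true)]) :=
    hp.reads_replaceAt (reads_neck loop_trav (handle_reads (rank_tr (.brac A))))
  exact of_reads h2 (.div_left G _ e (loopType (tr A)) loopShape () _ _ he
    (isSequent_of_reads h2 B) h1 fun e => (e.2 rfl).elim)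

end Provable
end Provable

/-! ### Interpretation of types by languages of signed words -/

section Phase
variable {Pr : Type u} {rk : Pr → ℕ}

/-- `u` is a word that may replace the words in `X` in the antecedents of derivable sequents.
Inverses of antecedents are admitted as well, so that the inverses of the words in a closed language
form a closed language. -/
def InClosure (X : Language (BType {p : Pr // rk p = 2} × Bool))
    (u : List (BType {p : Pr // rk p = 2} × Bool)) : Prop :=
  u ≠ [] ∧ ∀ c s C Γ Δ, (∀ v ∈ X, Provable c (orient s (Γ ++ v ++ Δ)) C) →
    Provable c (orient s (Γ ++ u ++ Δ)) C

/-- The languages that interpret types: they consist of non-empty words and contain the words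
that may replace their elements. -/
def IsClosed (X : Language (BType {p : Pr // rk p = 2} × Bool)) : Prop :=
  (∀ v ∈ X, v ≠ []) ∧ ∀ u, InClosure X u → u ∈ X

/-- The closure of a language. -/
def closure (X : Language (BType {p : Pr // rk p = 2} × Bool)) :
    Language (BType {p : Pr // rk p = 2} × Bool) :=
  {u | InClosure X u}

/-- The interpretation of a type. -/
def val : BType {p : Pr // rk p = 2} → Language (BType {p : Pr // rk p = 2} × Bool)
  | .prim p => {u | Provable false u (.prim p)}
  | .ldiv B A => {u | u ≠ [] ∧ ∀ v ∈ val B, v ++ u ∈ val A}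
  | .rdiv A B => {u | u ≠ [] ∧ ∀ v ∈ val B, u ++ v ∈ val A}
  | .mul A B => closure (val A * val B)
  | .rev A => {u | inv u ∈ val A}
  | .brac A => {u | u ≠ [] ∧ ∀ C, (∀ v ∈ val A, Provable true v C) → Provable true u C}

variable {X Y : Language (BType {p : Pr // rk p = 2} × Bool)}
  {u v : List (BType {p : Pr // rk p = 2} × Bool)} {A B C : BType {p : Pr // rk p = 2}}

theorem InClosure.provable (h : InClosure X u) {c : Bool} (hX : ∀ v ∈ X, Provable c v C) :
    Provable c u C := by
  simpa using h.2 c true C [] [] (by simpa using hX)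

theorem InClosure.append (h : InClosure X u) {Γ Δ : List (BType {p : Pr // rk p = 2} × Bool)}
    (hX : ∀ v ∈ X, Γ ++ v ++ Δ ∈ Y) : InClosure Y (Γ ++ u ++ Δ) := by
  refine ⟨by simp [h.1], fun c s C Γ' Δ' hY => ?_⟩
  have := h.2 c s C (Γ' ++ Γ) (Δ ++ Δ') fun v hv => by simpa using hY _ (hX v hv)
  simpa using this

theorem InClosure.inv (h : InClosure X u) (hX : ∀ v ∈ X, HypergraphLambek.inv v ∈ Y) :
    InClosure Y (HypergraphLambek.inv u) := by
  refine ⟨by simpa using h.1, fun c s C Γ Δ hY => ?_⟩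
  have key : ∀ v : List (BType {p : Pr // rk p = 2} × Bool),
      orient s (Γ ++ HypergraphLambek.inv v ++ Δ) =
        orient (!s) (HypergraphLambek.inv Δ ++ v ++ HypergraphLambek.inv Γ) := by
    intro v
    cases s <;> simp
  rw [key]
  exact h.2 c (!s) C _ _ fun v hv => by
    rw [← key]
    exact hY _ (hX v hv)

theorem isClosed_closure : IsClosed (closure X) :=
  ⟨fun _ h => h.1, fun _ hu => ⟨hu.1, fun c s C Γ Δ hX => hu.2 c s C Γ Δ fun _ hv =>
    hv.2 c s C Γ Δ hX⟩⟩

theorem isClosed_val (A : BType {p : Pr // rk p = 2}) : IsClosed (val A) := by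
  induction A with
  | prim p => exact ⟨fun _ h => h.1, fun _ h => h.provable fun _ hv => hv⟩
  | ldiv B A ihB ihA =>
    refine ⟨fun _ h => h.1, fun u hu => ⟨hu.1, fun v hv => ihA.2 _ ?_⟩⟩
    simpa using hu.append (Y := val A) (Γ := v) (Δ := []) fun w hw => by simpa using hw.2 v hv
  | rdiv A B ihA ihB =>
    refine ⟨fun _ h => h.1, fun u hu => ⟨hu.1, fun v hv => ihA.2 _ ?_⟩⟩
    simpa using hu.append (Y := val A) (Γ := []) (Δ := v) fun w hw => by simpa using hw.2 v hv
  | mul A B ihA ihB => exact isClosed_closure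
  | rev A ih =>
    exact ⟨fun v hv => by simpa using ih.1 _ hv, fun u hu => ih.2 _ (hu.inv fun _ hv => hv)⟩
  | brac A ih =>
    exact ⟨fun _ h => h.1, fun u hu => ⟨hu.1, fun C hC => hu.provable fun v hv => hv.2 C hC⟩⟩

/-- The left rules hold for positive occurrences of a type in a word or its inverse. -/
theorem provable_orient {c s : Bool} {Γ Δ : List (BType {p : Pr // rk p = 2} × Bool)}
    (hl : ∀ s w1 w2, Provable c (w1 ++ orient s u ++ w2) C → Provable c (w1 ++ orient s v ++ w2) C)
    (h : Provable c (orient s (Γ ++ u ++ Δ)) C) : Provable c (orient s (Γ ++ v ++ Δ)) C := by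
  cases s
  · simpa using hl false (inv Δ) (inv Γ) (by simpa using h)
  · exact hl true Γ Δ h

/-- A type belongs to its interpretation, whose elements derive it. -/
theorem mem_val_and_provable (A : BType {p : Pr // rk p = 2}) :
    [(A, true)] ∈ val A ∧ ∀ u ∈ val A, Provable false u A := by
  induction A with
  | prim p => exact ⟨.prim p, fun _ h => h⟩
  | ldiv B A ihB ihA =>
    refine ⟨⟨by simp, fun v hv => (isClosed_val A).2 _ ⟨by simp, fun c s C Γ Δ h => ?_⟩⟩,
      fun u hu => .ldiv_right hu.1 (ihA.2 _ (hu.2 _ ihB.1))⟩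
    refine provable_orient (u := [(A, true)]) (fun s w1 w2 h => ?_) (h _ ihA.1)
    rw [orient_singleton] at h
    exact .ldiv_left (ihB.2 v hv) (by simpa using h)
  | rdiv A B ihA ihB =>
    refine ⟨⟨by simp, fun v hv => (isClosed_val A).2 _ ⟨by simp, fun c s C Γ Δ h => ?_⟩⟩,
      fun u hu => .rdiv_right hu.1 (ihA.2 _ (hu.2 _ ihB.1))⟩
    refine provable_orient (u := [(A, true)]) (fun s w1 w2 h => ?_) (h _ ihA.1)
    rw [orient_singleton] at h
    exact .rdiv_left (ihB.2 v hv) (by simpa using h)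
  | mul A B ihA ihB =>
    refine ⟨⟨by simp, fun c s C Γ Δ h => ?_⟩, fun u hu => hu.provable ?_⟩
    · refine provable_orient (u := [(A, true), (B, true)]) (fun s w1 w2 h => ?_)
        (h _ (Language.append_mem_mul ihA.1 ihB.1))
      simpa [orient_singleton] using h.mul_left
    · rintro _ ⟨v, hv, w, hw, rfl⟩
      exact .mul_right (ihA.2 v hv) (ihB.2 w hw)
  | rev A ih =>
    refine ⟨(isClosed_val A).2 _ ⟨by simp, fun c s C Γ Δ h => ?_⟩, fun u hu => ?_⟩
    · refine provable_orient (u := [(A, true)]) (fun s w1 w2 h => ?_) (h _ ih.1)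
      have : orient s (inv [(BType.rev A, true)]) = [(BType.rev A, !s)] := by cases s <;> rfl
      rw [this]
      have h' : Provable c (w1 ++ (.rev A, !s) :: w2) C := by
        refine .rev_left ?_
        cases s <;> exact h
      simpa using h'
    · have := (ih.2 _ hu).rev_right
      rwa [inv_inv] at this
  | brac A ih =>
    exact ⟨⟨by simp, fun C h => .brac_left (h _ ih.1)⟩, fun u hu =>
      .brac_right (hu.2 A fun v hv => (ih.2 v hv).loop_right)⟩

theorem mul_closure_mul_le (hY : IsClosed Y) {Γ Δ : Language (BType {p : Pr // rk p = 2} × Bool)}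
    (h : Γ * X * Δ ≤ Y) : Γ * closure X * Δ ≤ Y := by
  rintro _ ⟨_, ⟨a, ha, u, hu, rfl⟩, b, hb, rfl⟩
  exact hY.2 _ (hu.append fun v hv =>
    h (Language.append_mem_mul (Language.append_mem_mul ha hv) hb))

theorem val_mul_ldiv_le : val B * val (.ldiv B A) ≤ val A := by
  rintro _ ⟨v, hv, u, hu, rfl⟩
  exact hu.2 v hv

theorem val_rdiv_mul_le : val (.rdiv A B) * val B ≤ val A := by
  rintro _ ⟨u, hu, v, hv, rfl⟩
  exact hu.2 v hv

theorem val_rev_rev : val (.rev (.rev A)) = val A := by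
  ext u
  change inv (inv u) ∈ val A ↔ u ∈ val A
  rw [inv_inv]

theorem inv_mem_prod_val {Γ : List (BType {p : Pr // rk p = 2})} :
    ∀ {u}, u ∈ ((Γ.map BType.rev).reverse.map val).prod → inv u ∈ (Γ.map val).prod := by
  induction Γ with
  | nil =>
    intro u hu
    obtain rfl : u = [] := hu
    exact rfl
  | cons A Γ ih =>
    intro u hu
    rw [List.map_cons, List.reverse_cons, List.map_append, List.prod_append, List.map_singleton,
      List.prod_singleton] at hu
    obtain ⟨v, hv, w, hw, rfl⟩ := hu
    rw [inv_append, List.map_cons, List.prod_cons]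
    exact Language.append_mem_mul hw (ih hv)

theorem ne_nil_of_mem_prod_val {Γ : List (BType {p : Pr // rk p = 2})} (hΓ : Γ ≠ [])
    (hu : u ∈ (Γ.map val).prod) : u ≠ [] := by
  cases Γ with
  | nil => exact absurd rfl hΓ
  | cons A Γ =>
    rw [List.map_cons, List.prod_cons] at hu
    obtain ⟨v, hv, w, -, rfl⟩ := hu
    simp [(isClosed_val A).1 v hv]

/-- The interpretation is sound. -/
theorem LBrac.prod_val_le {Γ : List (BType {p : Pr // rk p = 2})} (h : LBrac Γ A) :
    (Γ.map val).prod ≤ val A := by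
  induction h with
  | ax A => simp
  | ldiv_left Γ X Δ A B C hX _ _ ih1 ih2 =>
    simp only [List.map_append, List.prod_append, List.map_singleton, List.prod_singleton]
      at ih1 ⊢
    rw [mul_assoc (List.map val Γ).prod]
    have h := (mul_le_mul_left ih2 _).trans (val_mul_ldiv_le (A := B))
    exact le_trans (mul_le_mul_left (mul_le_mul_right h _) _) ih1
  | ldiv_right X A B hX _ ih =>
    rw [List.map_append, List.prod_append, List.map_singleton, List.prod_singleton] at ih
    exact fun u hu => ⟨ne_nil_of_mem_prod_val hX hu, fun v hv =>
      ih (Language.append_mem_mul hv hu)⟩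
  | rdiv_left Γ X Δ A B C hX _ _ ih1 ih2 =>
    simp only [List.map_append, List.prod_append, List.map_singleton, List.prod_singleton]
      at ih1 ⊢
    rw [mul_assoc (List.map val Γ).prod]
    have h := (mul_le_mul_right ih2 _).trans (val_rdiv_mul_le (A := B))
    exact le_trans (mul_le_mul_left (mul_le_mul_right h _) _) ih1
  | rdiv_right X A B hX _ ih =>
    rw [List.map_append, List.prod_append, List.map_singleton, List.prod_singleton] at ih
    exact fun u hu => ⟨ne_nil_of_mem_prod_val hX hu, fun v hv =>
      ih (Language.append_mem_mul hu hv)⟩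
  | mul_left Γ Δ A B C _ ih =>
    simp only [List.map_append, List.prod_append, List.map_cons, List.map_nil, List.prod_cons,
      List.prod_nil, mul_one] at ih ⊢
    exact mul_closure_mul_le (isClosed_val C) ih
  | mul_right X Y A B hX hY _ _ ih1 ih2 =>
    rw [List.map_append, List.prod_append]
    rintro _ ⟨u, hu, v, hv, rfl⟩
    exact ⟨by simp [ne_nil_of_mem_prod_val hX hu], fun c s C Γ Δ h =>
      h _ (Language.append_mem_mul (ih1 hu) (ih2 hv))⟩
  | cut Γ X Δ A B hX _ _ ih1 ih2 =>
    simp only [List.map_append, List.prod_append, List.map_singleton, List.prod_singleton]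
      at ih2 ⊢
    refine le_trans ?_ ih2
    gcongr
  | rev_rev X B hX _ ih => exact fun u hu => ih (inv_mem_prod_val hu)
  | rev_left Γ Δ A B _ ih => simpa [val_rev_rev] using ih
  | rev_right X A hX _ ih => rwa [val_rev_rev]
  | brac_right X A hX _ ih =>
    exact fun u hu => ⟨ne_nil_of_mem_prod_val hX hu, fun C hC => hC u (ih hu)⟩
  | brac_left A B _ ih =>
    rw [List.map_singleton, List.prod_singleton] at ih ⊢
    exact fun u hu => ⟨hu.1, fun C hC => hu.2 C fun v hv => (ih hv).2 C hC⟩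
  | brac_shift X Y A hX hY _ ih =>
    rw [List.map_append, List.prod_append] at ih ⊢
    rintro _ ⟨u, hu, v, hv, rfl⟩
    have h := ih (Language.append_mem_mul hv hu)
    exact ⟨by simp [ne_nil_of_mem_prod_val hY hu], fun C hC => (h.2 C hC).rotate⟩
  | ax_rev_brac A =>
    rw [List.map_singleton, List.prod_singleton]
    intro u hu
    refine ⟨by simpa using (isClosed_val A).1 _ hu, fun C hC => ?_⟩
    simpa using (hC _ hu).inverse

theorem HLWI.of_LBrac {Γ : List (BType {p : Pr // rk p = 2})} {B : BType {p : Pr // rk p = 2}}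
    (h : LBrac Γ B) : HLWI rk (stringGraph (Γ.map tr)) (tr B) := by
  have h1 : ∀ Γ : List (BType {p : Pr // rk p = 2}),
      Γ.map (fun A => (A, true)) ∈ (Γ.map val).prod := by
    intro Γ
    induction Γ with
    | nil => exact rfl
    | cons A Γ ih =>
      rw [List.map_cons, List.map_cons, List.prod_cons]
      exact Language.append_mem_mul (mem_val_and_provable A).1 ih
  refine ((mem_val_and_provable B).2 _ (h.prod_val_le (h1 Γ))).2 _ ?_
  have := stringGraph_reads (w := Γ.map (tr (rk := rk))) (by simpa using h.ne_nil)
  simpa [code, Function.comp_def] using this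

end Phase
end HypergraphLambek

theorem mainTheorem6 {Pr : Type*} (rk : Pr → ℕ)
    (Γ : List (HypergraphLambek.BType {p : Pr // rk p = 2}))
    (B : HypergraphLambek.BType {p : Pr // rk p = 2}) :
    HypergraphLambek.LBrac Γ B ↔
      HypergraphLambek.HLWI rk
        (HypergraphLambek.stringGraph (Γ.map HypergraphLambek.tr)) (HypergraphLambek.tr B) :=
  ⟨HypergraphLambek.HLWI.of_LBrac, HypergraphLambek.LBrac.of_HLWI⟩
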